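/- Path-flows. Let $G$ be a finite graph with edge set $\mathcal E$. A path-flow on $G$ is a finite nonnegative measure $\mu$ on the countable set of finite oriented paths $\sigma=(v_0,\dots,v_k)$, $k\ge 0$, in $G$. Its transportation measure $\mathrm{tra}(\mu)$ is the push-forward of $\mu$ under $\sigma\mapsto(v_0,v_k)$, and its flow-volume is $\mathrm{flo}(\mu)(e)=\int n(\sigma,e)\,\mu(d\sigma)$, where $n(\sigma,e)$ is the number of times that $\sigma$ crosses $e$ in either direction. An environment is a family $\mathbf c=(c(e))_{e\in\mathcal E}$ of nonnegative reals, and $\mathrm{cost}(\mathbf f,\mathbf c)=\sum_{e\in\mathcal E} c(e)f(e)^2$. Infima over the empty set are $+\infty$. Torus. Let $\mathcal T_N^2$ be the discrete $N\times N$ torus. For $B>0$ let $\mathrm{cost}_{(N)}(\mathbf c,B)$ be the infimum of $\mathrm{cost}(\mathrm{flo}(\mu),\mathbf c)$ over path-flows $\mu$ on $\mathcal T_N^2$ with $\mathrm{tra}(\mu)(v,w)=N^{-3}$ for all vertices $v,w$ and $\mathrm{flo}(\mu)(e)\le B$ for all edges $e$. Square. The extended $M\times M$ square is the lattice square $[0,M-1]^2\subset\mathbb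 Z^2$ together with the half-edges that lead from it to the $4M$ boundary points $(-\tfrac12,j)$, $(M-\tfrac12,j)$, $(i,-\tfrac12)$, $(i,M-\tfrac12)$, $0\le i,j\le M-1$. Let $\mathrm{Bou}_M$ be the set of boundary points and $b\mapsto b^{\mathrm{reflect}}$ the left-right, respectively top-bottom, reflection on it. Let $\mathcal Q_M$ be the set of finite measures $Q$ on $\mathrm{Bou}_M\times\mathrm{Bou}_M$ such that the push-forward of the second marginal under $b\mapsto b^{\mathrm{reflect}}$ equals the first marginal, and put $\mathrm{drift}(Q)=M^{-2}\sum_{b_1,b_2}(b_2-b_1)Q(b_1,b_2)\in\mathbb R^2$. Let $\mathcal Q_M^{\mathrm{iso}}$ be the set of finite measures $Q_0=\int_{\mathcal Q_M}Q\,\psi(dQ)$, where $\psi$ is a probability distribution on $\mathcal Q_M$ under which $\mathrm{drift}(Q)$ modulo $(1,1)$ is uniformly distributed on $[0,1)^2$. For a finite measure $Q$ on $\mathrm{Bou}_M\times\mathrm{Bou}_M$ let $\mathrm{cost}_{M,B}(Q,\mathbf c)$ be the infimum of $\mathrm{cost}(\mathrm{flo}(\mu),\mathbf c)$ over path-flows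 $\mu$ on the extended $M\times M$ square with $\mathrm{tra}(\mu)=Q$ and $\mathrm{flo}(\mu)(e)\le B$ for all edges $e$. Random environment. Let $\kappa$ be a probability distribution with $\kappa[0,c^*]=1$ for some $0<c^*<\infty$. On the torus the $c(e)$ are i.i.d. with law $\kappa$. On the extended square the $c(e)$ are i.i.d. with law $\kappa$ on the internal edges and on the half-edges at the left and bottom sides, and $c(e)=0$ on the half-edges at the right and top sides. Put $c_{M,B}=\inf\{\mathbb E\,\mathrm{cost}_{M,B}(Q,\mathbf c):Q\in\mathcal Q_M^{\mathrm{iso}}\}$. Proposition. Let $B>\tfrac14$. Then for every $B''>B$, $$\limsup_{M\to\infty} M^{-2}c_{M,B''}\;\le\;\liminf_{N\to\infty}N^{-2}\,\mathbb E\,\mathrm{cost}_{(N)}(\mathbf c,B).$$ -/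

import Mathlib

open scoped NNReal ENNReal

noncomputable section

namespace LatticeFlow

/-! ### Path-flows on a graph -/

/-- A finite oriented path `(v₀, …, v_k)`, `k ≥ 0`, in `G`, with entrance `v₀` and exit `v_k`. -/
structure FinPath {V : Type*} (G : SimpleGraph V) where
  ent : V
  exi : V
  walk : G.Walk ent exi

/-- The set of finite paths of a finite graph is countable, so measures on it are taken on all
subsets. -/
instance {V : Type*} (G : SimpleGraph V) : MeasurableSpace (FinPath G) := ⊤

section Graph

variable {V : Type*} {G : SimpleGraph V}

/-- `n(σ, e)`: the number of times that `e` occurs, in either direction, in `σ`. -/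
def FinPath.crossings [DecidableEq V] (σ : FinPath G) (e : G.edgeSet) : ℕ :=
  σ.walk.edges.count (e : Sym2 V)

/-- Point masses of the transportation measure of the path-flow `μ`. -/
def tra (μ : MeasureTheory.Measure (FinPath G)) (v w : V) : ℝ≥0∞ :=
  μ {σ | σ.ent = v ∧ σ.exi = w}

/-- The flow-volume of the path-flow `μ`. -/
def flo [DecidableEq V] (μ : MeasureTheory.Measure (FinPath G)) (e : G.edgeSet) : ℝ≥0∞ :=
  ∫⁻ σ, (σ.crossings e : ℝ≥0∞) ∂μ

/-- An environment: a nonnegative cost-factor for each edge. -/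
abbrev Environment (G : SimpleGraph V) : Type _ := G.edgeSet → ℝ≥0

/-- The cost `∑ₑ c(e) f(e)²` of the flow-volume `f` in the environment `c`. -/
def cost [Fintype G.edgeSet] (f : G.edgeSet → ℝ≥0∞) (c : Environment G) : ℝ≥0∞ :=
  ∑ e, (c e : ℝ≥0∞) * f e ^ 2

/-- The least cost of a path-flow with transportation measure `T` and with flow-volume at most
`B` across every edge; it is `∞` if there is no such path-flow. -/
def minCost [DecidableEq V] [Fintype G.edgeSet] (T : V → V → ℝ≥0∞) (B : ℝ≥0)
    (c : Environment G) : ℝ≥0∞ :=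
  ⨅ (μ : MeasureTheory.Measure (FinPath G)) (_ : MeasureTheory.IsFiniteMeasure μ)
    (_ : tra μ = T) (_ : ∀ e, flo μ e ≤ B), cost (flo μ) c

end Graph

/-! ### The torus -/

/-- The discrete `N × N` torus. -/
abbrev torus (N : ℕ) : SimpleGraph (Fin N × Fin N) :=
  (SimpleGraph.cycleGraph N).boxProd (SimpleGraph.cycleGraph N)

instance (N : ℕ) : Fintype (torus N).edgeSet := Fintype.ofFinite _

/-- The least cost of a standardized global flow (volume `N⁻³` between every ordered pair of
vertices) that satisfies the capacity constraint `f(e) ≤ B`. -/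
def torusCost (N : ℕ) (B : ℝ≥0) (c : Environment (torus N)) : ℝ≥0∞ :=
  minCost (fun _ _ => ((N : ℝ≥0∞) ^ 3)⁻¹) B c

/-- The law of an i.i.d. environment on the torus. -/
def torusLaw (κ : MeasureTheory.Measure ℝ≥0) (N : ℕ) :
    MeasureTheory.Measure (Environment (torus N)) :=
  MeasureTheory.Measure.pi fun _ => κ

/-- The expectation of the minimum cost on the torus in the i.i.d. environment. -/
def expTorusCost (κ : MeasureTheory.Measure ℝ≥0) (N : ℕ) (B : ℝ≥0) : ℝ≥0∞ :=
  ∫⁻ c, torusCost N B c ∂torusLaw κ N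

/-! ### The extended square -/

/-- The four sides of a square. -/
inductive Side
  | left
  | right
  | bottom
  | top
  deriving DecidableEq

instance : Fintype Side where
  elems := {.left, .right, .bottom, .top}
  complete := by rintro (_ | _ | _ | _) <;> simp

/-- The `4M` boundary points of the `M × M` square: a side and the coordinate along it. -/
abbrev Bou (M : ℕ) : Type := Side × Fin M

/-- The vertices of the extended `M × M` square: internal vertices and boundary points. -/
abbrev SqVertex (M : ℕ) : Type := (Fin M × Fin M) ⊕ Bou M

/-- The internal vertex `p` is the end of the boundary half-edge at the boundary point. -/
def Attached {M : ℕ} (p : Fin M × Fin M) : Bou M → Prop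
  | (.left, j) => (p.1 : ℕ) = 0 ∧ p.2 = j
  | (.right, j) => (p.1 : ℕ) + 1 = M ∧ p.2 = j
  | (.bottom, i) => (p.2 : ℕ) = 0 ∧ p.1 = i
  | (.top, i) => (p.2 : ℕ) + 1 = M ∧ p.1 = i

/-- The adjacency relation of the extended `M × M` square. -/
def SqAdj {M : ℕ} : SqVertex M → SqVertex M → Prop
  | .inl p, .inl q => ((SimpleGraph.pathGraph M).boxProd (SimpleGraph.pathGraph M)).Adj p q
  | .inl p, .inr b => Attached p b
  | .inr b, .inl p => Attached p b
  | .inr _, .inr _ => False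

/-- The extended `M × M` square: the square `[0, M-1]²` of the lattice together with a half-edge
from each of the `4M` boundary points. -/
def extSquare (M : ℕ) : SimpleGraph (SqVertex M) where
  Adj := SqAdj
  symm := ⟨by
    rintro (p | b) (q | b') h
    · exact SimpleGraph.Adj.symm h
    · exact h
    · exact h
    · exact h⟩
  loopless := ⟨by
    rintro (p | b) h
    · exact SimpleGraph.irrefl _ h
    · exact h⟩

instance (M : ℕ) : Fintype (extSquare M).edgeSet := Fintype.ofFinite _

/-- The position in the plane of a boundary point. -/
def Bou.pos {M : ℕ} : Bou M → ℝ × ℝ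
  | (.left, j) => (-(1 / 2), (j : ℕ))
  | (.right, j) => ((M : ℝ) - 1 / 2, (j : ℕ))
  | (.bottom, i) => ((i : ℕ), -(1 / 2))
  | (.top, i) => ((i : ℕ), (M : ℝ) - 1 / 2)

/-- Reflection of boundary points, left-to-right or top-to-bottom. -/
def Bou.reflect {M : ℕ} : Bou M → Bou M
  | (.left, j) => (.right, j)
  | (.right, j) => (.left, j)
  | (.bottom, i) => (.top, i)
  | (.top, i) => (.bottom, i)

/-! ### Transportation measures across the square -/

/-- Finite measures on `Bou_M × Bou_M`, given by their point masses. -/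
abbrev Transport (M : ℕ) : Type := Bou M × Bou M → ℝ≥0

/-- The entrance marginal. -/
def Transport.ent {M : ℕ} (Q : Transport M) (b : Bou M) : ℝ≥0 := ∑ b', Q (b, b')

/-- The exit marginal. -/
def Transport.exi {M : ℕ} (Q : Transport M) (b : Bou M) : ℝ≥0 := ∑ b', Q (b', b)

/-- The set `𝒬_M` of transportation measures for which the push-forward of the exit marginal under
reflection equals the entrance marginal. -/
def compatible (M : ℕ) : Set (Transport M) :=
  {Q | ∀ b, ∑ b' with Bou.reflect b' = b, Q.exi b' = Q.ent b}

/-- `drift(Q) = M⁻² ∑_{b₁, b₂} (b₂ - b₁) Q(b₁, b₂)`. -/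
def Transport.drift {M : ℕ} (Q : Transport M) : ℝ × ℝ :=
  (1 / (M : ℝ) ^ 2) • ∑ b₁, ∑ b₂, (Q (b₁, b₂) : ℝ) • (Bou.pos b₂ - Bou.pos b₁)

/-- `drift(Q)` modulo `(1, 1)`, a point of `[0, 1)²`. -/
def Transport.driftMod {M : ℕ} (Q : Transport M) : ℝ × ℝ :=
  (Int.fract Q.drift.1, Int.fract Q.drift.2)

/-- `Q₀` is isotropic: it is a mixture of elements of `𝒬_M` under a probability distribution `ψ`
for which the drift modulo `(1, 1)` is uniformly distributed on `[0, 1)²`. -/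
def IsIsotropic {M : ℕ} (Q₀ : Transport M) : Prop :=
  ∃ ψ : MeasureTheory.Measure (Transport M), MeasureTheory.IsProbabilityMeasure ψ ∧
    (∀ᵐ Q ∂ψ, Q ∈ compatible M) ∧
    (∀ b, (Q₀ b : ℝ≥0∞) = ∫⁻ Q, (Q b : ℝ≥0∞) ∂ψ) ∧
    ψ.map Transport.driftMod =
      MeasureTheory.volume.restrict (Set.Ico (0 : ℝ) 1 ×ˢ Set.Ico (0 : ℝ) 1)

/-- `Q` as a measure on pairs of vertices of the extended square, carried by pairs of boundary
points. -/
def Transport.onVertices {M : ℕ} (Q : Transport M) : SqVertex M → SqVertex M → ℝ≥0∞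
  | .inr b, .inr b' => Q (b, b')
  | _, _ => 0

/-- `cost_{M,B}(Q, c)`: the least cost of a path-flow across the square with transportation
measure `Q` and flow-volume at most `B` across every edge. -/
def squareCost (M : ℕ) (B : ℝ≥0) (Q : Transport M) (c : Environment (extSquare M)) : ℝ≥0∞ :=
  minCost Q.onVertices B c

/-- The edge ends at a boundary point on the right or on the top side. -/
def IsRightTop {M : ℕ} (e : (extSquare M).edgeSet) : Prop :=
  ∃ j : Fin M, (Sum.inr (Side.right, j) : SqVertex M) ∈ (e : Sym2 (SqVertex M)) ∨
    (Sum.inr (Side.top, j) : SqVertex M) ∈ (e : Sym2 (SqVertex M))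

open Classical in
/-- The law of the environment on the extended square: the cost-factors are independent, zero on
the half-edges at the right and top sides, and with law `κ` on all other edges. -/
def squareLaw (κ : MeasureTheory.Measure ℝ≥0) (M : ℕ) :
    MeasureTheory.Measure (Environment (extSquare M)) :=
  MeasureTheory.Measure.pi fun e => if IsRightTop e then MeasureTheory.Measure.dirac 0 else κ

/-- `c_{M,B}`: the infimum over isotropic `Q` of the expectation of `cost_{M,B}(Q, c)`. -/
def cInf (κ : MeasureTheory.Measure ℝ≥0) (M : ℕ) (B : ℝ≥0) : ℝ≥0∞ :=
  ⨅ (Q : Transport M) (_ : IsIsotropic Q), ∫⁻ c, squareCost M B Q c ∂squareLaw κ M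

end LatticeFlow

end

/-! Cut the paths of a nearly optimal flow in the torus along an `M × M` square in a uniformly
random position. The pieces of a closed path enter and leave opposite sides equally often, and on
average over the positions their drift is the displacement of the path's lift to the lattice,
divided by `N`. Under the global transportation measure the displacement in the torus is uniformly
distributed, so that, after small corrections which close the paths and fill the cells of side
`N⁻¹`, the averaged transport is isotropic. Every edge of the torus is seen by the square with
probability `M² / N²`, up to the half-edges of cost zero, and this compares the costs.

The transport across the square still depends on the environment, whereas `Q` in `c_{M,B}` may not.
Replace the flow by about `M ^ (3 / 2)` paths drawn at random from it. The flow-volumes change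
little by Chernoff's bound, and only `exp (O (M ^ (3 / 2) * log M))` transportation measures are
possible. By McDiarmid's inequality the minimal costs for all of them, functions of `O (M²)`
independent cost-factors, are simultaneously within `o (M²)` of their expectations. Convexity of the
minimal cost in the transportation measure then allows one to average over the sample and the
environment. -/

noncomputable section

namespace LatticeFlow

open MeasureTheory SimpleGraph

/-! ### Flows carried by simple paths -/

section SimpleFlow

variable {V : Type*} {G : SimpleGraph V}

/-- The finite paths without repeated vertices: up to loop deletion, these are the only paths that
a path-flow of small cost needs. -/
abbrev SimplePath (G : SimpleGraph V) : Type _ := {σ : FinPath G // σ.walk.IsPath}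

/-- A path-flow carried by simple paths, given by its point masses. -/
abbrev SimpleFlow (G : SimpleGraph V) : Type _ := SimplePath G → ℝ≥0

instance [Finite V] : Finite (SimplePath G) := by
  classical
  have := Fintype.ofFinite V
  exact Finite.of_surjective
    (fun q : Σ u v, G.Path u v => (⟨⟨q.1, q.2.1, q.2.2.1⟩, q.2.2.2⟩ : SimplePath G))
    fun σ => ⟨⟨σ.1.ent, σ.1.exi, σ.1.walk, σ.2⟩, rfl⟩

instance [Finite V] : Fintype (SimplePath G) := Fintype.ofFinite _

instance : DecidableEq (SimplePath G) := Classical.decEq _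

/-- The cost of a flow-volume that is finite across every edge. -/
def nncost [Fintype G.edgeSet] (f : G.edgeSet → ℝ≥0) (c : Environment G) : ℝ≥0 :=
  ∑ e, c e * f e ^ 2

lemma nncost_le_mul_card [Fintype G.edgeSet] {f : G.edgeSet → ℝ≥0} {c : Environment G}
    {B cs : ℝ≥0} (hf : ∀ e, f e ≤ B) (hc : ∀ e, c e ≤ cs) :
    nncost f c ≤ cs * Fintype.card G.edgeSet * B ^ 2 := by
  calc nncost f c ≤ ∑ _e : G.edgeSet, cs * B ^ 2 := by
        refine Finset.sum_le_sum fun e _ => ?_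
        gcongr
        exacts [hc e, hf e]
    _ = cs * Fintype.card G.edgeSet * B ^ 2 := by
        rw [Finset.sum_const, Finset.card_univ, nsmul_eq_mul]
        ring

lemma coe_nncost [Fintype G.edgeSet] (f : G.edgeSet → ℝ≥0) (c : Environment G) :
    (nncost f c : ℝ≥0∞) = cost (fun e => (f e : ℝ≥0∞)) c := by
  simp [nncost, cost]

namespace SimpleFlow

variable [Finite V]

/-- A flow carried by simple paths, as a path-flow. -/
def toMeasure (x : SimpleFlow G) : Measure (FinPath G) :=
  ∑ σ, (x σ : ℝ≥0∞) • Measure.dirac σ.1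

lemma toMeasure_apply (x : SimpleFlow G) (s : Set (FinPath G)) :
    x.toMeasure s = ∑ σ, (x σ : ℝ≥0∞) * s.indicator 1 σ.1 := by
  simp only [toMeasure, Measure.finsetSum_apply, Measure.smul_apply, smul_eq_mul,
    Measure.dirac_apply' _ (MeasurableSpace.measurableSet_top : MeasurableSet[⊤] s)]

instance (x : SimpleFlow G) : IsFiniteMeasure x.toMeasure := ⟨by
  simp [toMeasure_apply]⟩

end SimpleFlow

variable [DecidableEq V]

/-- Loop deletion. -/
def FinPath.simplify (σ : FinPath G) : SimplePath G :=
  ⟨⟨σ.ent, σ.exi, σ.walk.bypass⟩, σ.walk.bypass_isPath⟩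

@[simp] lemma FinPath.simplify_ent (σ : FinPath G) : σ.simplify.1.ent = σ.ent := rfl

@[simp] lemma FinPath.simplify_exi (σ : FinPath G) : σ.simplify.1.exi = σ.exi := rfl

lemma FinPath.crossings_simplify_le (σ : FinPath G) (e : G.edgeSet) :
    σ.simplify.1.crossings e ≤ σ.crossings e :=
  σ.walk.edges_bypass_sublist_edges.count_le _

lemma SimplePath.crossings_le_one (σ : SimplePath G) (e : G.edgeSet) : σ.1.crossings e ≤ 1 :=
  List.nodup_iff_count_le_one.1 σ.2.isTrail.edges_nodup _

namespace SimpleFlow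

variable [Finite V]

/-- The flow-volume of a flow carried by simple paths. -/
def vol (x : SimpleFlow G) (e : G.edgeSet) : ℝ≥0 := ∑ σ, x σ * (σ.1.crossings e : ℝ≥0)

/-- The transportation measure of a flow carried by simple paths. -/
def trans (x : SimpleFlow G) (v w : V) : ℝ≥0 :=
  ∑ σ, if σ.1.ent = v ∧ σ.1.exi = w then x σ else 0

lemma tra_toMeasure (x : SimpleFlow G) (v w : V) : tra x.toMeasure v w = x.trans v w := by
  rw [tra, toMeasure_apply, trans]
  push_cast
  refine Finset.sum_congr rfl fun σ _ => ?_
  by_cases h : σ.1.ent = v ∧ σ.1.exi = w <;> simp [h]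

lemma flo_toMeasure (x : SimpleFlow G) (e : G.edgeSet) : flo x.toMeasure e = x.vol e := by
  rw [flo, toMeasure, lintegral_finsetSum_measure, vol]
  push_cast
  refine Finset.sum_congr rfl fun σ _ => ?_
  rw [lintegral_smul_measure, lintegral_dirac' _ measurable_from_top, smul_eq_mul]

lemma trans_eq_sum_mul (x : SimpleFlow G) (v w : V) :
    x.trans v w = ∑ σ, x σ * if σ.1.ent = v ∧ σ.1.exi = w then 1 else 0 := by
  simp only [trans, mul_ite, mul_one, mul_zero]

/-- The simple flow `x` competes in the infimum `minCost T B`. -/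
structure Feasible (x : SimpleFlow G) (T : V → V → ℝ≥0∞) (B : ℝ≥0) : Prop where
  trans_eq : ∀ v w, (x.trans v w : ℝ≥0∞) = T v w
  vol_le : ∀ e, x.vol e ≤ B

lemma Feasible.minCost_le [Fintype G.edgeSet] {x : SimpleFlow G} {T : V → V → ℝ≥0∞} {B : ℝ≥0}
    (hx : x.Feasible T B) (c : Environment G) : minCost T B c ≤ nncost x.vol c := by
  have htra : tra x.toMeasure = T := by
    ext v w
    rw [tra_toMeasure, hx.trans_eq]
  have hflo : ∀ e, flo x.toMeasure e ≤ B := fun e => by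
    rw [flo_toMeasure]
    exact_mod_cast hx.vol_le e
  refine (iInf_le_of_le x.toMeasure <|
    iInf_le_of_le (inferInstance : IsFiniteMeasure x.toMeasure) <| iInf_le_of_le htra <|
    iInf_le_of_le hflo le_rfl).trans_eq ?_
  simp only [coe_nncost, flo_toMeasure, cost]

end SimpleFlow

/-- The simple flow obtained from a path-flow by loop deletion. -/
def simplifyFlow (μ : Measure (FinPath G)) : SimpleFlow G :=
  fun σ => (μ (FinPath.simplify ⁻¹' {σ})).toNNReal

lemma coe_simplifyFlow (μ : Measure (FinPath G)) [IsFiniteMeasure μ] (σ : SimplePath G) :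
    (simplifyFlow μ σ : ℝ≥0∞) = μ (FinPath.simplify ⁻¹' {σ}) :=
  ENNReal.coe_toNNReal (measure_ne_top _ _)

variable [Finite V]

lemma trans_simplifyFlow (μ : Measure (FinPath G)) [IsFiniteMeasure μ] (v w : V) :
    ((simplifyFlow μ).trans v w : ℝ≥0∞) = tra μ v w := by
  have hset : {σ : FinPath G | σ.ent = v ∧ σ.exi = w} = FinPath.simplify ⁻¹'
      (({σ : SimplePath G | σ.1.ent = v ∧ σ.1.exi = w} : Finset (SimplePath G)) :
        Set (SimplePath G)) := by
    ext σ
    simp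
  rw [tra, hset, ← sum_measure_preimage_singleton _
    (fun _ _ => MeasurableSpace.measurableSet_top), Finset.sum_filter, SimpleFlow.trans]
  push_cast
  refine Finset.sum_congr rfl fun σ _ => ?_
  split_ifs
  · exact coe_simplifyFlow μ σ
  · rfl

lemma vol_simplifyFlow_le (μ : Measure (FinPath G)) [IsFiniteMeasure μ] (e : G.edgeSet) :
    ((simplifyFlow μ).vol e : ℝ≥0∞) ≤ flo μ e := by
  have hsplit : ∀ τ : FinPath G, (τ.simplify.1.crossings e : ℝ≥0∞) =
      ∑ σ, (FinPath.simplify ⁻¹' {σ}).indicator (fun _ => (σ.1.crossings e : ℝ≥0∞)) τ := fun τ => by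
    rw [Fintype.sum_eq_single τ.simplify fun σ hσ => by simp [hσ.symm]]
    simp
  calc ((simplifyFlow μ).vol e : ℝ≥0∞)
      = ∑ σ, ∫⁻ τ, (FinPath.simplify ⁻¹' {σ}).indicator
          (fun _ => (σ.1.crossings e : ℝ≥0∞)) τ ∂μ := by
        rw [SimpleFlow.vol]
        push_cast
        refine Finset.sum_congr rfl fun σ _ => ?_
        rw [lintegral_indicator MeasurableSpace.measurableSet_top, setLIntegral_const,
          coe_simplifyFlow, mul_comm]
    _ = ∫⁻ τ, (τ.simplify.1.crossings e : ℝ≥0∞) ∂μ := by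
        rw [← lintegral_finsetSum _ fun _ _ => measurable_from_top]
        simp only [hsplit]
    _ ≤ flo μ e := lintegral_mono fun τ =>
        Nat.cast_le.2 (τ.crossings_simplify_le e)

end SimpleFlow

/-! ### The minimum cost as a function of its data -/

section MinCost

variable {V : Type*} {G : SimpleGraph V} [DecidableEq V] [Fintype G.edgeSet]

lemma minCost_anti (T : V → V → ℝ≥0∞) (c : Environment G) : Antitone fun B => minCost T B c :=
  fun _ _ hB => iInf_mono fun _ => iInf_mono fun _ => iInf_mono fun _ =>
    le_iInf fun h => iInf_le _ fun e => (h e).trans (by exact_mod_cast hB)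

variable [Finite V]

lemma exists_feasible_nncost_le {T : V → V → ℝ≥0∞} {B : ℝ≥0} {c : Environment G}
    (h : minCost T B c ≠ ∞) {η : ℝ≥0} (hη : 0 < η) :
    ∃ x : SimpleFlow G, x.Feasible T B ∧ (nncost x.vol c : ℝ≥0∞) ≤ minCost T B c + η := by
  have hlt : minCost T B c < minCost T B c + η := ENNReal.lt_add_right h (by simpa using hη.ne')
  conv_lhs at hlt => rw [minCost]
  simp only [iInf_lt_iff] at hlt
  obtain ⟨μ, _, hT, hB, hcost⟩ := hlt
  refine ⟨simplifyFlow μ, ⟨fun v w => by rw [trans_simplifyFlow, hT], fun e => ?_⟩,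
    le_trans ?_ hcost.le⟩
  · exact_mod_cast (vol_simplifyFlow_le μ e).trans (hB e)
  · rw [coe_nncost, cost, cost]
    gcongr with e
    exact vol_simplifyFlow_le μ e

lemma minCost_ne_top_of_ne_top {T : V → V → ℝ≥0∞} {B : ℝ≥0} {c c' : Environment G}
    (h : minCost T B c ≠ ∞) : minCost T B c' ≠ ∞ := by
  obtain ⟨x, hx, -⟩ := exists_feasible_nncost_le h one_pos
  exact ne_top_of_le_ne_top ENNReal.coe_ne_top (hx.minCost_le c')

lemma SimpleFlow.Feasible.minCost_le_mul_card {x : SimpleFlow G} {T : V → V → ℝ≥0∞} {B cs : ℝ≥0}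
    (hx : x.Feasible T B) {c : Environment G} (hc : ∀ e, c e ≤ cs) :
    minCost T B c ≤ (cs * Fintype.card G.edgeSet * B ^ 2 : ℝ≥0) :=
  (hx.minCost_le c).trans (ENNReal.coe_le_coe.2 (nncost_le_mul_card hx.vol_le hc))

lemma minCost_le_add (T : V → V → ℝ≥0∞) (B : ℝ≥0) {c c' d : Environment G} (h : c' ≤ c + d) :
    minCost T B c' ≤ minCost T B c + ((∑ e, d e) * B ^ 2 : ℝ≥0) := by
  by_cases hc : minCost T B c = ∞
  · simp [hc]
  refine ENNReal.le_of_forall_pos_le_add fun η hη _ => ?_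
  obtain ⟨x, hx, hcost⟩ := exists_feasible_nncost_le hc hη
  have hcompare : nncost x.vol c' ≤ nncost x.vol c + (∑ e, d e) * B ^ 2 := by
    rw [nncost, nncost, Finset.sum_mul, ← Finset.sum_add_distrib]
    refine Finset.sum_le_sum fun e _ => ?_
    calc c' e * x.vol e ^ 2 ≤ (c e + d e) * x.vol e ^ 2 := by gcongr; exact h e
      _ = c e * x.vol e ^ 2 + d e * x.vol e ^ 2 := by ring
      _ ≤ c e * x.vol e ^ 2 + d e * B ^ 2 := by gcongr; exact hx.vol_le e
  calc minCost T B c' ≤ (nncost x.vol c' : ℝ≥0) := hx.minCost_le c'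
    _ ≤ ((nncost x.vol c + (∑ e, d e) * B ^ 2 : ℝ≥0) : ℝ≥0∞) := by exact_mod_cast hcompare
    _ ≤ (minCost T B c + η) + ((∑ e, d e) * B ^ 2 : ℝ≥0) := by rw [ENNReal.coe_add]; gcongr
    _ = _ := add_right_comm _ _ _

lemma continuous_minCost (T : V → V → ℝ≥0∞) (B : ℝ≥0) :
    Continuous fun c : Environment G => minCost T B c := by
  refine continuous_of_le_add_edist ((Fintype.card G.edgeSet * B ^ 2 : ℝ≥0) : ℝ≥0∞)
    ENNReal.coe_ne_top fun c c' => ?_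
  have hle : c ≤ c' + fun _ => nndist c c' := fun e => by
    have hdist : (c e : ℝ) - c' e ≤ nndist c c' :=
      (le_abs_self _).trans ((NNReal.dist_eq _ _).symm.trans_le (dist_le_pi_dist c c' e))
    exact_mod_cast sub_le_iff_le_add'.1 hdist
  refine (minCost_le_add T B hle).trans_eq ?_
  rw [edist_nndist, ← ENNReal.coe_mul, Finset.sum_const, Finset.card_univ, nsmul_eq_mul]
  congr 2
  ring

@[fun_prop]
lemma measurable_minCost (T : V → V → ℝ≥0∞) (B : ℝ≥0) :
    Measurable fun c : Environment G => minCost T B c :=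
  (continuous_minCost T B).measurable

-- An infeasible problem has `toReal` equal to `0` in every environment.
lemma toReal_minCost_le (T : V → V → ℝ≥0∞) (B : ℝ≥0) {cs : ℝ≥0} {c : Environment G}
    (hc : ∀ e, c e ≤ cs) :
    (minCost T B c).toReal ≤ (cs * Fintype.card G.edgeSet * B ^ 2 : ℝ≥0) := by
  by_cases h : minCost T B c = ∞
  · simpa [h] using by positivity
  obtain ⟨x, hx, -⟩ := exists_feasible_nncost_le h one_pos
  exact ENNReal.toReal_le_coe_of_le_coe (hx.minCost_le_mul_card hc)

lemma toReal_minCost_le_add (T : V → V → ℝ≥0∞) (B : ℝ≥0) {cs : ℝ≥0} {c c' : Environment G}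
    (i : G.edgeSet) (hcc' : ∀ e, e ≠ i → c' e = c e) (hi : c' i ≤ cs) :
    (minCost T B c').toReal ≤ (minCost T B c).toReal + cs * B ^ 2 := by
  classical
  by_cases h : minCost T B c = ∞
  · have h' : minCost T B c' = ∞ := by
      by_contra h'
      exact minCost_ne_top_of_ne_top h' h
    simpa [h, h'] using by positivity
  have hle : c' ≤ c + Pi.single i cs := fun e => by
    by_cases he : e = i
    · subst he
      simpa using le_add_left hi
    · simp [hcc' e he]
  have hadd := ENNReal.toReal_mono (by finiteness) (minCost_le_add T B hle)
  rw [ENNReal.toReal_add h ENNReal.coe_ne_top, Finset.sum_pi_single'] at hadd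
  simpa using hadd

end MinCost

/-! ### Convexity of the minimum cost -/

section Convexity

lemma sq_sum_mul_le {ι : Type*} (s : Finset ι) (w a : ι → ℝ≥0) (hw : ∑ i ∈ s, w i ≤ 1) :
    (∑ i ∈ s, w i * a i) ^ 2 ≤ ∑ i ∈ s, w i * a i ^ 2 :=
  (Finset.sum_sq_le_sum_mul_sum_of_sq_le_mul s (f := w) (g := fun i => w i * a i ^ 2)
    (fun _ _ => zero_le) (fun _ _ => zero_le) fun _ _ => (by ring : _ = _).le).trans
    (mul_le_of_le_one_left zero_le hw)

variable {V : Type*} {G : SimpleGraph V} {ι : Type*} [Fintype ι]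

lemma nncost_sum_mul_le [Fintype G.edgeSet] (w : ι → ℝ≥0) (hw : ∑ i, w i ≤ 1)
    (f : ι → G.edgeSet → ℝ≥0) (c : Environment G) :
    nncost (fun e => ∑ i, w i * f i e) c ≤ ∑ i, w i * nncost (f i) c := by
  simp only [nncost, Finset.mul_sum]
  rw [Finset.sum_comm]
  refine Finset.sum_le_sum fun e _ => ?_
  calc c e * (∑ i, w i * f i e) ^ 2 ≤ c e * ∑ i, w i * f i e ^ 2 := by
        gcongr
        exact sq_sum_mul_le _ w _ hw
    _ = ∑ i, w i * (c e * f i e ^ 2) := by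
        rw [Finset.mul_sum]
        exact Finset.sum_congr rfl fun i _ => mul_left_comm _ _ _

variable [DecidableEq V] [Finite V]

namespace SimpleFlow

lemma trans_sum_mul (w : ι → ℝ≥0) (x : ι → SimpleFlow G) (u v : V) :
    trans (fun σ => ∑ i, w i * x i σ) u v = ∑ i, w i * (x i).trans u v := by
  simp only [trans, Finset.mul_sum]
  rw [Finset.sum_comm]
  refine Finset.sum_congr rfl fun σ _ => ?_
  split_ifs <;> simp

lemma vol_sum_mul (w : ι → ℝ≥0) (x : ι → SimpleFlow G) (e : G.edgeSet) :
    vol (fun σ => ∑ i, w i * x i σ) e = ∑ i, w i * (x i).vol e := by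
  simp only [vol, Finset.mul_sum, Finset.sum_mul]
  rw [Finset.sum_comm]
  simp only [mul_assoc]

lemma Feasible.sum_mul {w : ι → ℝ≥0} {x : ι → SimpleFlow G} {T : ι → V → V → ℝ≥0∞}
    {B : ι → ℝ≥0} (hx : ∀ i, w i ≠ 0 → (x i).Feasible (T i) (B i)) :
    Feasible (fun σ => ∑ i, w i * x i σ) (fun u v => ∑ i, w i * T i u v) (∑ i, w i * B i) where
  trans_eq u v := by
    rw [trans_sum_mul]
    push_cast
    refine Finset.sum_congr rfl fun i _ => ?_
    rcases eq_or_ne (w i) 0 with hi | hi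
    · simp [hi]
    · rw [(hx i hi).trans_eq]
  vol_le e := by
    rw [vol_sum_mul]
    refine Finset.sum_le_sum fun i _ => ?_
    rcases eq_or_ne (w i) 0 with hi | hi
    · simp [hi]
    · gcongr
      exact (hx i hi).vol_le e

end SimpleFlow

variable [Fintype G.edgeSet]

theorem minCost_sum_mul_le (w : ι → ℝ≥0) (hw : ∑ i, w i ≤ 1) (T : ι → V → V → ℝ≥0∞)
    (B : ι → ℝ≥0) (c : Environment G) :
    minCost (fun u v => ∑ i, w i * T i u v) (∑ i, w i * B i) c ≤
      ∑ i, (w i : ℝ≥0∞) * minCost (T i) (B i) c := by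
  by_cases htop : ∑ i, (w i : ℝ≥0∞) * minCost (T i) (B i) c = ∞
  · exact htop ▸ le_top
  have hfin : ∀ i, w i ≠ 0 → minCost (T i) (B i) c ≠ ∞ := fun i hi h =>
    ENNReal.sum_ne_top.1 htop i (Finset.mem_univ i)
      (by rw [h]; exact ENNReal.mul_top (by simpa using hi))
  refine ENNReal.le_of_forall_pos_le_add fun η hη _ => ?_
  have hex : ∀ i, ∃ x : SimpleFlow G, w i ≠ 0 →
      x.Feasible (T i) (B i) ∧ (nncost x.vol c : ℝ≥0∞) ≤ minCost (T i) (B i) c + η := fun i => by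
    by_cases hi : w i = 0
    · exact ⟨0, fun h => absurd hi h⟩
    · obtain ⟨x, hx⟩ := exists_feasible_nncost_le (hfin i hi) hη
      exact ⟨x, fun _ => hx⟩
  choose x hx using hex
  have hfeas := SimpleFlow.Feasible.sum_mul fun i hi => (hx i hi).1
  have hvol : SimpleFlow.vol (fun σ => ∑ i, w i * x i σ) = fun e => ∑ i, w i * (x i).vol e :=
    funext (SimpleFlow.vol_sum_mul w x)
  calc _ ≤ ((nncost (fun e => ∑ i, w i * (x i).vol e) c : ℝ≥0) : ℝ≥0∞) := by
        exact hvol ▸ hfeas.minCost_le c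
    _ ≤ ∑ i, (w i : ℝ≥0∞) * (nncost (x i).vol c : ℝ≥0) := by
        exact_mod_cast nncost_sum_mul_le w hw _ c
    _ ≤ ∑ i, (w i : ℝ≥0∞) * (minCost (T i) (B i) c + η) := by
        refine Finset.sum_le_sum fun i _ => ?_
        rcases eq_or_ne (w i) 0 with hi | hi
        · simp [hi]
        · gcongr
          exact (hx i hi).2
    _ = ∑ i, (w i : ℝ≥0∞) * minCost (T i) (B i) c + (∑ i, (w i : ℝ≥0∞)) * η := by
        simp only [mul_add, Finset.sum_add_distrib, Finset.sum_mul]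
    _ ≤ _ := by
        gcongr
        exact mul_le_of_le_one_left zero_le (by exact_mod_cast hw)

end Convexity

/-! ### The bounded differences inequality -/

section BoundedDifferences

variable {X Y : Type*} [MeasurableSpace X] [MeasurableSpace Y]

lemma abs_integral_le_of_forall_abs_le (μ : Measure X) [IsProbabilityMeasure μ] {f : X → ℝ} {K : ℝ}
    (hf : ∀ x, |f x| ≤ K) : |∫ x, f x ∂μ| ≤ K := by
  simpa using norm_integral_le_of_norm_le_const (μ := μ) (f := f) (.of_forall hf)

lemma integrable_of_measurable_of_abs_le (μ : Measure X) [IsFiniteMeasure μ] {f : X → ℝ} {K : ℝ}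
    (hf : Measurable f) (hK : ∀ x, |f x| ≤ K) : Integrable f μ :=
  .of_bound hf.aestronglyMeasurable K (.of_forall hK)

lemma abs_exp_mul_sub_le (t : ℝ) {a b K : ℝ} (ha : |a| ≤ K) (hb : |b| ≤ K) :
    |Real.exp (t * (a - b))| ≤ Real.exp (|t| * (2 * K)) := by
  rw [Real.abs_exp, Real.exp_le_exp]
  refine (le_abs_self _).trans ?_
  rw [abs_mul]
  gcongr
  exact (abs_sub _ _).trans (by linarith)

lemma integral_exp_centered_le (μ : Measure X) [IsProbabilityMeasure μ] {f : X → ℝ}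
    (hf : Measurable f) {D : ℝ} (hD : ∀ x y, |f x - f y| ≤ D) (t : ℝ) :
    ∫ x, Real.exp (t * ((∫ y, f y ∂μ) - f x)) ∂μ ≤ Real.exp (t ^ 2 * D ^ 2 / 2) := by
  obtain ⟨x₀⟩ : Nonempty X := nonempty_of_isProbabilityMeasure μ
  have hD0 : 0 ≤ D := (abs_nonneg _).trans (hD x₀ x₀)
  have hmem : ∀ x, f x ∈ Set.Icc (f x₀ - D) (f x₀ + D) := fun x => by
    rw [← Real.closedBall_eq_Icc]
    exact hD x x₀
  have hmgf := (ProbabilityTheory.hasSubgaussianMGF_of_mem_Icc (μ := μ) hf.aemeasurable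
    (.of_forall hmem)).mgf_le (-t)
  have hwidth : ((‖f x₀ + D - (f x₀ - D)‖₊ / 2 : ℝ≥0) : ℝ) = D := by
    push_cast
    rw [show f x₀ + D - (f x₀ - D) = 2 * D by ring, Real.norm_of_nonneg (by positivity)]
    ring
  rw [ProbabilityTheory.mgf] at hmgf
  convert hmgf using 2
  · ring_nf
  · rw [NNReal.coe_pow, hwidth]
    ring

lemma integral_exp_centered_prod_le (μ : Measure X) (ν : Measure Y) [IsProbabilityMeasure μ]
    [IsProbabilityMeasure ν] {h : X × Y → ℝ} (hh : Measurable h) {K D s t : ℝ}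
    (hK : ∀ z, |h z| ≤ K) (hD : ∀ x x' y, |h (x, y) - h (x', y)| ≤ D)
    (hs : ∀ x, ∫ y, Real.exp (t * ((∫ y', h (x, y') ∂ν) - h (x, y))) ∂ν ≤ Real.exp s) :
    ∫ z, Real.exp (t * ((∫ z', h z' ∂μ.prod ν) - h z)) ∂μ.prod ν ≤
      Real.exp (t ^ 2 * D ^ 2 / 2 + s) := by
  set H : X → ℝ := fun x => ∫ y, h (x, y) ∂ν with hH
  have hsec : ∀ x, Integrable (fun y => h (x, y)) ν := fun x =>
    integrable_of_measurable_of_abs_le ν (by fun_prop) fun _ => hK _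
  have hHmeas : Measurable H := hh.stronglyMeasurable.integral_prod_right'.measurable
  have hHK : ∀ x, |H x| ≤ K := fun x => abs_integral_le_of_forall_abs_le ν fun _ => hK _
  have hHD : ∀ x x', |H x - H x'| ≤ D := fun x x' => by
    rw [hH, ← integral_sub (hsec x) (hsec x')]
    exact abs_integral_le_of_forall_abs_le ν fun y => hD x x' y
  have hmean : ∫ z, h z ∂μ.prod ν = ∫ x, H x ∂μ :=
    integral_prod _ (integrable_of_measurable_of_abs_le _ hh hK)
  have hmeanK : |∫ x, H x ∂μ| ≤ K := abs_integral_le_of_forall_abs_le μ hHK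
  have hsplit : ∀ x, ∫ y, Real.exp (t * ((∫ x, H x ∂μ) - h (x, y))) ∂ν ≤
      Real.exp (t * ((∫ x, H x ∂μ) - H x)) * Real.exp s := fun x => by
    have hfactor : ∀ y, Real.exp (t * ((∫ x, H x ∂μ) - h (x, y))) =
        Real.exp (t * ((∫ x, H x ∂μ) - H x)) * Real.exp (t * (H x - h (x, y))) := fun y => by
      rw [← Real.exp_add]
      ring_nf
    simp only [hfactor, integral_const_mul]
    gcongr
    exact hs x
  rw [hmean, integral_prod _ (integrable_of_measurable_of_abs_le _ (by fun_prop)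
    fun z => abs_exp_mul_sub_le t hmeanK (hK z))]
  calc _ ≤ ∫ x, Real.exp (t * ((∫ x, H x ∂μ) - H x)) * Real.exp s ∂μ :=
        integral_mono_of_nonneg (.of_forall fun x => by positivity)
          ((integrable_of_measurable_of_abs_le μ (by fun_prop)
            fun x => abs_exp_mul_sub_le t hmeanK (hHK x)).mul_const _) (.of_forall hsplit)
    _ ≤ Real.exp (t ^ 2 * D ^ 2 / 2 + s) := by
        rw [integral_mul_const, Real.exp_add]
        gcongr
        exact integral_exp_centered_le μ hHmeas hHD t

lemma integral_exp_centered_pi_fin_le {D K : ℝ} (t : ℝ) (n : ℕ) :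
    ∀ (μ : Fin n → Measure X) [∀ i, IsProbabilityMeasure (μ i)] (g : (Fin n → X) → ℝ),
      Measurable g → (∀ c, |g c| ≤ K) → (∀ c i a, |g c - g (Function.update c i a)| ≤ D) →
      ∫ c, Real.exp (t * ((∫ c', g c' ∂Measure.pi μ) - g c)) ∂Measure.pi μ ≤
        Real.exp (n * (t ^ 2 * D ^ 2 / 2)) := by
  induction n with
  | zero =>
    intro μ _ g _ _ _
    have hconst : ∀ c, g c = g default := fun c => congrArg g (Subsingleton.elim _ _)
    simp [hconst]
  | succ n ih =>
    intro μ _ g hg hK hD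
    let e := (MeasurableEquiv.piFinSuccAbove (fun _ : Fin (n + 1) => X) 0).symm
    have he : MeasurePreserving e ((μ 0).prod (Measure.pi fun j => μ (Fin.succAbove 0 j)))
        (Measure.pi μ) := (measurePreserving_piFinSuccAbove μ 0).symm
    have hcons : ∀ x y, e (x, y) = Fin.cons x y := fun x y => Fin.insertNth_zero' x y
    have hge : Measurable fun z => g (e z) := hg.comp e.measurable
    rw [← he.integral_comp', ← he.integral_comp' (f := e)]
    refine (integral_exp_centered_prod_le (D := D) (s := n * (t ^ 2 * D ^ 2 / 2)) _ _ hge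
      (fun z => hK _) (fun x x' y => ?_) fun x => ?_).trans_eq ?_
    · simpa only [hcons, Fin.update_cons_zero] using hD (e (x, y)) 0 x'
    · refine ih _ (fun y => g (e (x, y))) (hge.comp measurable_prodMk_left) (fun y => hK _)
        fun y i a => ?_
      simpa only [hcons, Fin.cons_update] using hD (e (x, y)) i.succ a
    · push_cast
      ring_nf

/-- The exponential moment bound behind McDiarmid's inequality. -/
theorem integral_exp_centered_pi_le {ι : Type*} [Fintype ι] [DecidableEq ι] {D K : ℝ} (t : ℝ)
    (μ : ι → Measure X) [∀ i, IsProbabilityMeasure (μ i)] {g : (ι → X) → ℝ} (hg : Measurable g)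
    (hK : ∀ c, |g c| ≤ K) (hD : ∀ c i a, |g c - g (Function.update c i a)| ≤ D) :
    ∫ c, Real.exp (t * ((∫ c', g c' ∂Measure.pi μ) - g c)) ∂Measure.pi μ ≤
      Real.exp (Fintype.card ι * (t ^ 2 * D ^ 2 / 2)) := by
  let f : Fin (Fintype.card ι) ≃ ι := (Fintype.equivFin ι).symm
  let e := MeasurableEquiv.piCongrLeft (fun _ : ι => X) f
  have he : MeasurePreserving e (Measure.pi fun i => μ (f i)) (Measure.pi μ) :=
    measurePreserving_piCongrLeft μ f
  have hupdate : ∀ y i a, e (Function.update y i a) = Function.update (e y) (f i) a :=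
    fun y i a => by
      funext j
      obtain ⟨k, rfl⟩ := f.surjective j
      rcases eq_or_ne k i with rfl | hk
      · simp [e, MeasurableEquiv.piCongrLeft_apply_apply]
      · simp [e, MeasurableEquiv.piCongrLeft_apply_apply, hk]
  rw [← he.integral_comp', ← he.integral_comp' g]
  refine integral_exp_centered_pi_fin_le t _ (fun i => μ (f i)) (fun y => g (e y))
    (hg.comp e.measurable) (fun y => hK _) fun y i a => ?_
  rw [hupdate]
  exact hD _ _ _

end BoundedDifferences

/-! ### Sampling paths from a flow -/

section Chernoff

variable {Z : Type*} [Fintype Z] {n : ℕ}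

lemma sum_prod_eq_pow {R : Type*} [CommSemiring R] (u : Z → R) :
    ∑ y : Fin n → Z, ∏ i, u (y i) = (∑ z, u z) ^ n := by
  classical
  rw [← Fintype.prod_sum fun (_ : Fin n) z => u z]
  simp

lemma sum_prod_mul_apply {R : Type*} [CommSemiring R] (u φ : Z → R) (hu : ∑ z, u z = 1)
    (k : Fin n) : ∑ y : Fin n → Z, (∏ i, u (y i)) * φ (y k) = ∑ z, u z * φ z := by
  classical
  have hfactor : ∀ y : Fin n → Z, (∏ i, u (y i)) * φ (y k) =
      ∏ i, u (y i) * if i = k then φ (y i) else 1 := fun y => by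
    rw [Finset.prod_mul_distrib]
    congr 1
    simp
  simp only [hfactor]
  rw [← Fintype.prod_sum fun (i : Fin n) z => u z * if i = k then φ z else 1,
    Fintype.prod_eq_single k fun i hi => by simp [hi, hu]]
  simp

variable {u a : Z → ℝ}

lemma sum_mul_exp_le (hu0 : ∀ z, 0 ≤ u z) (hu : ∑ z, u z = 1) (ha : ∀ z, a z ∈ Set.Icc 0 1)
    (l : ℝ) :
    ∑ z, u z * Real.exp (l * a z) ≤ Real.exp ((∑ z, u z * a z) * (Real.exp l - 1)) := by
  have hconvex : ∀ z, Real.exp (l * a z) ≤ 1 + a z * (Real.exp l - 1) := fun z => by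
    have := convexOn_exp.2 (Set.mem_univ 0) (Set.mem_univ l) (sub_nonneg.2 (ha z).2) (ha z).1
      (sub_add_cancel _ _)
    simp only [smul_eq_mul, mul_zero, zero_add, Real.exp_zero, mul_one] at this
    rw [mul_comm l]
    linarith
  calc ∑ z, u z * Real.exp (l * a z) ≤ ∑ z, u z * (1 + a z * (Real.exp l - 1)) :=
        Finset.sum_le_sum fun z _ => mul_le_mul_of_nonneg_left (hconvex z) (hu0 z)
    _ = (∑ z, u z * a z) * (Real.exp l - 1) + 1 := by
        simp only [mul_add, mul_one, ← mul_assoc, Finset.sum_add_distrib, hu, ← Finset.sum_mul]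
        ring
    _ ≤ _ := Real.add_one_le_exp _

lemma sum_prod_le_exp (hu0 : ∀ z, 0 ≤ u z) (hu : ∑ z, u z = 1) (ha : ∀ z, a z ∈ Set.Icc 0 1)
    {l : ℝ} (hl : 0 ≤ l) (A : ℝ) :
    ∑ y : Fin n → Z with A ≤ ∑ i, a (y i), ∏ i, u (y i) ≤
      Real.exp (n * (∑ z, u z * a z) * (Real.exp l - 1) - l * A) := by
  have hprod : ∀ y : Fin n → Z, 0 ≤ ∏ i, u (y i) := fun y => Finset.prod_nonneg fun i _ => hu0 _
  calc ∑ y : Fin n → Z with A ≤ ∑ i, a (y i), ∏ i, u (y i)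
      ≤ ∑ y : Fin n → Z with A ≤ ∑ i, a (y i),
          (∏ i, u (y i) * Real.exp (l * a (y i))) * Real.exp (-(l * A)) := by
        refine Finset.sum_le_sum fun y hy => ?_
        rw [Finset.prod_mul_distrib, ← Real.exp_sum, mul_assoc, ← Real.exp_add, ← Finset.mul_sum]
        refine le_mul_of_one_le_right (hprod y) (Real.one_le_exp ?_)
        rw [← sub_eq_add_neg, ← mul_sub]
        exact mul_nonneg hl (sub_nonneg.2 (Finset.mem_filter.1 hy).2)
    _ ≤ ∑ y : Fin n → Z, (∏ i, u (y i) * Real.exp (l * a (y i))) * Real.exp (-(l * A)) :=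
        Finset.sum_le_univ_sum_of_nonneg fun y => mul_nonneg
          (Finset.prod_nonneg fun i _ => mul_nonneg (hu0 _) (Real.exp_nonneg _)) (Real.exp_nonneg _)
    _ = (∑ z, u z * Real.exp (l * a z)) ^ n * Real.exp (-(l * A)) := by
        rw [← Finset.sum_mul, ← sum_prod_eq_pow]
    _ ≤ Real.exp ((∑ z, u z * a z) * (Real.exp l - 1)) ^ n * Real.exp (-(l * A)) := by
        gcongr
        · exact Finset.sum_nonneg fun z _ => mul_nonneg (hu0 z) (Real.exp_nonneg _)
        · exact sum_mul_exp_le hu0 hu ha l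
    _ = _ := by
        rw [← Real.exp_nat_mul, ← Real.exp_add]
        ring_nf

theorem chernoff_bound (hu0 : ∀ z, 0 ≤ u z) (hu : ∑ z, u z = 1) (ha : ∀ z, a z ∈ Set.Icc 0 1)
    {b t : ℝ} (hb : 0 < b) (hmean : n * ∑ z, u z * a z ≤ b) (ht : 0 ≤ t) (htb : t ≤ 2 * b) :
    ∑ y : Fin n → Z with n * ∑ z, u z * a z + t ≤ ∑ i, a (y i), ∏ i, u (y i) ≤
      Real.exp (-(t ^ 2 / (4 * b))) := by
  set f := n * ∑ z, u z * a z
  set l := t / (2 * b) with hl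
  have hl0 : 0 ≤ l := by positivity
  have hf0 : 0 ≤ f := mul_nonneg (Nat.cast_nonneg _)
    (Finset.sum_nonneg fun z _ => mul_nonneg (hu0 z) (ha z).1)
  have hexp : Real.exp l - 1 ≤ l + l ^ 2 := by
    have hl1 : |l| ≤ 1 := by
      rw [abs_of_nonneg hl0, hl]
      exact (div_le_one (by positivity)).2 htb
    linarith [(abs_le.1 (Real.abs_exp_sub_one_sub_id_le hl1)).2]
  refine (sum_prod_le_exp hu0 hu ha hl0 _).trans (Real.exp_le_exp.2 ?_)
  calc f * (Real.exp l - 1) - l * (f + t) ≤ f * (l + l ^ 2) - l * (f + t) := by gcongr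
    _ = f * l ^ 2 - l * t := by ring
    _ ≤ b * l ^ 2 - l * t := by gcongr
    _ = -(t ^ 2 / (4 * b)) := by
        rw [hl]
        field_simp
        ring

end Chernoff

section Sampling

variable {V : Type*} {G : SimpleGraph V}

/-- The flow that gives the mass `θ` to each of the `n` paths drawn; a draw may be empty. -/
def sampleFlow (θ : ℝ≥0) {n : ℕ} (y : Fin n → Option (SimplePath G)) : SimpleFlow G :=
  fun σ => ∑ i, if y i = some σ then θ else 0

/-- The end points of the path drawn. -/
def drawEnds (z : Option (SimplePath G)) : Option (V × V) := z.map fun σ => (σ.1.ent, σ.1.exi)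

/-- The transportation measure that gives the mass `θ` to each pair of end points drawn. -/
def sampleTrans [DecidableEq V] (θ : ℝ≥0) {n : ℕ} (τ : Fin n → Option (V × V)) (v w : V) : ℝ≥0 :=
  ∑ i, if τ i = some (v, w) then θ else 0

lemma elim_crossings_le_one [DecidableEq V] (e : G.edgeSet) (z : Option (SimplePath G)) :
    z.elim 0 (fun σ => (σ.1.crossings e : ℝ≥0)) ≤ 1 := by
  cases z with
  | none => simp
  | some σ => simpa using σ.crossings_le_one e

variable [Finite V]

/-- The probability of drawing a given path from the flow `x` of total mass at most `m`, or no path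
at all. -/
def drawWeight (m : ℝ≥0) (x : SimpleFlow G) : Option (SimplePath G) → ℝ≥0
  | some σ => x σ / m
  | none => 1 - (∑ σ, x σ) / m

lemma sum_drawWeight {m : ℝ≥0} (hm : 0 < m) {x : SimpleFlow G} (hx : ∑ σ, x σ ≤ m) :
    ∑ z, drawWeight m x z = 1 := by
  rw [Fintype.sum_option]
  simp only [drawWeight]
  rw [← Finset.sum_div]
  exact tsub_add_cancel_of_le ((div_le_one hm).2 hx)

@[fun_prop]
lemma measurable_drawWeight (m : ℝ≥0) (z : Option (SimplePath G)) :
    Measurable fun x : SimpleFlow G => drawWeight m x z := by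
  cases z <;> simp only [drawWeight] <;> fun_prop

lemma sum_drawWeight_mul_elim (m : ℝ≥0) (x : SimpleFlow G) (φ : SimplePath G → ℝ≥0) :
    ∑ z, drawWeight m x z * z.elim 0 φ = (∑ σ, x σ * φ σ) / m := by
  simp only [Fintype.sum_option, drawWeight, Option.elim, mul_zero, zero_add, Finset.sum_div,
    div_mul_eq_mul_div]

lemma sum_sampleFlow_mul (θ : ℝ≥0) {n : ℕ} (y : Fin n → Option (SimplePath G))
    (φ : SimplePath G → ℝ≥0) :
    ∑ σ, sampleFlow θ y σ * φ σ = θ * ∑ i, (y i).elim 0 φ := by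
  simp only [sampleFlow, Finset.sum_mul, Finset.mul_sum]
  rw [Finset.sum_comm]
  refine Finset.sum_congr rfl fun i _ => ?_
  cases y i <;> simp

lemma sum_prod_drawWeight_mul_sampleFlow {m : ℝ≥0} (hm : 0 < m) {x : SimpleFlow G}
    (hx : ∑ σ, x σ ≤ m) {θ : ℝ≥0} {n : ℕ} (hθ : θ * n = m) (σ : SimplePath G) :
    ∑ y : Fin n → Option (SimplePath G), (∏ i, drawWeight m x (y i)) * sampleFlow θ y σ = x σ := by
  have hdraw : ∀ k : Fin n, ∑ y : Fin n → Option (SimplePath G), (∏ i, drawWeight m x (y i)) *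
      (if y k = some σ then θ else 0) = x σ / m * θ := fun k => by
    rw [sum_prod_mul_apply (drawWeight m x) (fun z => if z = some σ then θ else 0)
      (sum_drawWeight hm hx)]
    simp [drawWeight]
  simp only [sampleFlow, Finset.mul_sum]
  rw [Finset.sum_comm]
  simp only [hdraw]
  rw [Finset.sum_const, Finset.card_univ, Fintype.card_fin, nsmul_eq_mul]
  calc (n : ℝ≥0) * (x σ / m * θ) = x σ / m * (θ * n) := by ring
    _ = x σ := by rw [hθ, div_mul_cancel₀ _ hm.ne']

variable [DecidableEq V]

lemma trans_sampleFlow (θ : ℝ≥0) {n : ℕ} (y : Fin n → Option (SimplePath G)) (v w : V) :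
    (sampleFlow θ y).trans v w = sampleTrans θ (fun i => drawEnds (y i)) v w := by
  rw [SimpleFlow.trans_eq_sum_mul, sum_sampleFlow_mul, sampleTrans, Finset.mul_sum]
  refine Finset.sum_congr rfl fun i _ => ?_
  cases y i <;> simp [drawEnds]

lemma vol_sampleFlow (θ : ℝ≥0) {n : ℕ} (y : Fin n → Option (SimplePath G)) (e : G.edgeSet) :
    (sampleFlow θ y).vol e = θ * ∑ i, (y i).elim 0 fun σ => (σ.1.crossings e : ℝ≥0) :=
  sum_sampleFlow_mul θ y _

lemma vol_sampleFlow_le (θ : ℝ≥0) {n : ℕ} (y : Fin n → Option (SimplePath G)) (e : G.edgeSet) :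
    (sampleFlow θ y).vol e ≤ θ * n := by
  rw [vol_sampleFlow]
  gcongr
  simpa using Finset.sum_le_card_nsmul Finset.univ _ 1 fun i _ => elim_crossings_le_one e (y i)

lemma sum_prod_drawWeight_of_lt_vol_le {m B ξ : ℝ≥0} {x : SimpleFlow G} (hx : ∑ σ, x σ ≤ m)
    {e : G.edgeSet} (hB : 0 < B) (hvol : x.vol e ≤ B) (hξB : ξ ≤ 2 * B) {θ : ℝ≥0} {n : ℕ}
    (hm : 0 < m) (hθ : θ * n = m) :
    ∑ y : Fin n → Option (SimplePath G) with x.vol e + ξ < (sampleFlow θ y).vol e,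
        ∏ i, (drawWeight m x (y i) : ℝ) ≤ Real.exp (-((ξ : ℝ) ^ 2 * n / (4 * B * m))) := by
  have hθ0 : 0 < θ := pos_of_mul_pos_left (hθ ▸ hm) zero_le
  have hn : (n : ℝ≥0) = m / θ := by rw [← hθ, mul_div_cancel_left₀ _ hθ0.ne']
  have hmean : (n : ℝ≥0) * ∑ z, drawWeight m x z * z.elim 0 (fun σ => (σ.1.crossings e : ℝ≥0)) =
      x.vol e / θ := by
    rw [sum_drawWeight_mul_elim, hn, SimpleFlow.vol]
    field_simp
  have hcast : (n : ℝ) * ∑ z, (drawWeight m x z : ℝ) *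
      (z.elim 0 fun σ => (σ.1.crossings e : ℝ≥0) : ℝ≥0) = x.vol e / θ := by exact_mod_cast hmean
  have hchernoff := chernoff_bound (n := n) (u := fun z => (drawWeight m x z : ℝ))
    (a := fun z => (z.elim 0 fun σ => (σ.1.crossings e : ℝ≥0) : ℝ≥0)) (b := B / θ) (t := ξ / θ)
    (fun z => NNReal.coe_nonneg _) (by exact_mod_cast sum_drawWeight hm hx)
    (fun z => ⟨NNReal.coe_nonneg _, by exact_mod_cast elim_crossings_le_one e z⟩) (by positivity)
    (by rw [hcast]; gcongr) (by positivity)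
    (by rw [mul_div_assoc']; gcongr; exact_mod_cast hξB)
  rw [hcast] at hchernoff
  refine (Finset.sum_le_sum_of_subset_of_nonneg (fun y hy => ?_) fun _ _ _ =>
    Finset.prod_nonneg fun _ _ => NNReal.coe_nonneg _).trans (hchernoff.trans_eq ?_)
  · simp only [Finset.mem_filter_univ, vol_sampleFlow] at hy ⊢
    rw [← add_div, div_le_iff₀' (by exact_mod_cast hθ0)]
    exact_mod_cast hy.le
  · have hn' : (n : ℝ) = m / θ := by exact_mod_cast hn
    rw [hn']
    congr 2
    field_simp

theorem sum_prod_drawWeight_of_exists_lt_vol_le [Fintype G.edgeSet] {m B ξ : ℝ≥0}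
    {x : SimpleFlow G} (hx : ∑ σ, x σ ≤ m) (hB : 0 < B) (hvol : ∀ e, x.vol e ≤ B)
    (hξB : ξ ≤ 2 * B) {θ : ℝ≥0} {n : ℕ} (hm : 0 < m) (hθ : θ * n = m) :
    ∑ y : Fin n → Option (SimplePath G) with ∃ e, x.vol e + ξ < (sampleFlow θ y).vol e,
        ∏ i, (drawWeight m x (y i) : ℝ) ≤
      Fintype.card G.edgeSet * Real.exp (-((ξ : ℝ) ^ 2 * n / (4 * B * m))) := by
  have hnonneg : ∀ y : Fin n → Option (SimplePath G), 0 ≤ ∏ i, (drawWeight m x (y i) : ℝ) :=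
    fun y => Finset.prod_nonneg fun _ _ => NNReal.coe_nonneg _
  calc _ ≤ ∑ e, ∑ y : Fin n → Option (SimplePath G) with x.vol e + ξ < (sampleFlow θ y).vol e,
          ∏ i, (drawWeight m x (y i) : ℝ) := by
        simp only [Finset.sum_filter]
        rw [Finset.sum_comm]
        refine Finset.sum_le_sum fun y _ => ?_
        have hterm : ∀ e ∈ Finset.univ, 0 ≤ if x.vol e + ξ < (sampleFlow θ y).vol e then
            ∏ i, (drawWeight m x (y i) : ℝ) else 0 := fun e _ => by
          split_ifs <;> simp [hnonneg]
        split_ifs with hbad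
        · obtain ⟨e, he⟩ := hbad
          exact (if_pos he).symm.le.trans (Finset.single_le_sum hterm (Finset.mem_univ e))
        · exact Finset.sum_nonneg hterm
    _ ≤ ∑ _e : G.edgeSet, Real.exp (-((ξ : ℝ) ^ 2 * n / (4 * B * m))) :=
        Finset.sum_le_sum fun e _ => sum_prod_drawWeight_of_lt_vol_le hx hB (hvol e) hξB hm hθ
    _ = _ := by simp

end Sampling

/-! ### Replacing an environment-dependent flow by its expectation -/

section Deviation

lemma exists_uniform_deviation {Ω : Type*} [MeasurableSpace Ω] (ρ : Measure Ω) {ι : Type*}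
    [Fintype ι] [Nonempty ι] {g : ι → Ω → ℝ} (hg : ∀ i, Measurable (g i)) {l s : ℝ} (hl : 0 < l)
    (hint : ∀ i, Integrable (fun c => Real.exp (l * ((∫ c', g i c' ∂ρ) - g i c))) ρ)
    (hexp : ∀ i, ∫ c, Real.exp (l * ((∫ c', g i c' ∂ρ) - g i c)) ∂ρ ≤ Real.exp s) :
    ∃ W : Ω → ℝ≥0∞, Measurable W ∧ ∫⁻ c, W c ∂ρ ≤ ENNReal.ofReal (1 / l) ∧ ∀ i c,
      ENNReal.ofReal ((∫ c', g i c' ∂ρ) - g i c - (Real.log (Fintype.card ι) + s) / l) ≤ W c := by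
  have hcard : (0 : ℝ) < Fintype.card ι := by exact_mod_cast Fintype.card_pos
  let C := 1 / l * (Real.exp (-s) / Fintype.card ι)
  let u : ι → Ω → ℝ := fun i c => C * Real.exp (l * ((∫ c', g i c' ∂ρ) - g i c))
  have hu : ∀ i, Measurable fun c => ENNReal.ofReal (u i c) := fun i => by fun_prop
  refine ⟨fun c => ∑ i, ENNReal.ofReal (u i c), by fun_prop, ?_, fun i c => ?_⟩
  · rw [lintegral_finsetSum _ fun i _ => hu i]
    have hterm : ∀ i, ∫⁻ c, ENNReal.ofReal (u i c) ∂ρ ≤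
        ENNReal.ofReal (1 / l / Fintype.card ι) := fun i => by
      rw [← ofReal_integral_eq_lintegral_ofReal ((hint i).const_mul C)
        (.of_forall fun c => by positivity), integral_const_mul]
      refine ENNReal.ofReal_le_ofReal ?_
      calc C * ∫ c, Real.exp (l * ((∫ c', g i c' ∂ρ) - g i c)) ∂ρ ≤ C * Real.exp s := by
            gcongr
            exact hexp i
        _ = 1 / l / Fintype.card ι * (Real.exp (-s) * Real.exp s) := by ring
        _ = _ := by rw [← Real.exp_add, neg_add_cancel, Real.exp_zero, mul_one]
    refine (Finset.sum_le_sum fun i _ => hterm i).trans_eq ?_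
    rw [Finset.sum_const, Finset.card_univ, ← ENNReal.ofReal_nsmul, nsmul_eq_mul,
      mul_div_cancel₀ _ hcard.ne']
  · refine le_trans (ENNReal.ofReal_le_ofReal ?_)
      (Finset.single_le_sum (f := fun i => ENNReal.ofReal (u i c)) (by simp) (Finset.mem_univ i))
    set d := (∫ c', g i c' ∂ρ) - g i c
    calc d - (Real.log (Fintype.card ι) + s) / l
        = 1 / l * (l * d - s - Real.log (Fintype.card ι)) := by
          field_simp
          ring
      _ ≤ 1 / l * Real.exp (l * d - s - Real.log (Fintype.card ι)) := by
          gcongr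
          linarith [Real.add_one_le_exp (l * d - s - Real.log (Fintype.card ι))]
      _ = C * Real.exp (l * d) := by
          rw [Real.exp_sub, Real.exp_log hcard, sub_eq_add_neg, Real.exp_add]
          ring

lemma ae_pi_forall_le {ι : Type*} [Fintype ι] {μ : ι → Measure ℝ≥0}
    [∀ e, IsProbabilityMeasure (μ e)] {cs : ℝ≥0} (hμ : ∀ e, ∀ᵐ t ∂μ e, t ≤ cs) :
    ∀ᵐ c ∂Measure.pi μ, ∀ e, c e ≤ cs :=
  ae_all_iff.2 fun e => (Measure.quasiMeasurePreserving_eval μ e).ae (hμ e)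

variable {V : Type*} {G : SimpleGraph V} [DecidableEq V] [Finite V] [Fintype G.edgeSet]

/-- Only the logarithm of the number of transportation problems enters. -/
theorem exists_deviation_bound {ι : Type*} [Fintype ι] [Nonempty ι] (T : ι → V → V → ℝ≥0∞)
    (B cs : ℝ≥0) (μ : G.edgeSet → Measure ℝ≥0) [∀ e, IsProbabilityMeasure (μ e)]
    (hμ : ∀ e, ∀ᵐ t ∂μ e, t ≤ cs) {l : ℝ} (hl : 0 < l) :
    ∃ W : Environment G → ℝ≥0∞, Measurable W ∧
      ∫⁻ c, W c ∂Measure.pi μ ≤ ENNReal.ofReal (1 / l) ∧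
      ∀ᵐ c ∂Measure.pi μ, ∀ i, ∫⁻ c', minCost (T i) B c' ∂Measure.pi μ ≤ minCost (T i) B c +
        ENNReal.ofReal ((Real.log (Fintype.card ι) +
          Fintype.card G.edgeSet * (l ^ 2 * (cs * B ^ 2 : ℝ) ^ 2 / 2)) / l) + W c := by
  classical
  let tr : Environment G → Environment G := fun c e => min (c e) cs
  have htr : Measurable tr := by fun_prop
  let g : ι → Environment G → ℝ := fun i c => (minCost (T i) B (tr c)).toReal
  have hg : ∀ i, Measurable (g i) := fun i =>
    ((measurable_minCost (T i) B).comp htr).ennreal_toReal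
  have hgK : ∀ i c, |g i c| ≤ (cs * Fintype.card G.edgeSet * B ^ 2 : ℝ≥0) := fun i c => by
    rw [abs_of_nonneg ENNReal.toReal_nonneg]
    exact toReal_minCost_le _ _ fun e => min_le_right _ _
  have hgD : ∀ i c e t, |g i c - g i (Function.update c e t)| ≤ cs * B ^ 2 := fun i c e t => by
    have hne : ∀ e', e' ≠ e → tr (Function.update c e t) e' = tr c e' := fun e' he' => by
      simp [tr, Function.update_of_ne he']
    rw [abs_sub_le_iff, sub_le_iff_le_add', sub_le_iff_le_add']
    exact ⟨toReal_minCost_le_add _ _ e (fun e' he' => (hne e' he').symm) (min_le_right _ _),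
      toReal_minCost_le_add _ _ e hne (min_le_right _ _)⟩
  obtain ⟨W, hW, hWint, hWle⟩ := exists_uniform_deviation (Measure.pi μ) hg hl
    (fun i => integrable_of_measurable_of_abs_le _ (by fun_prop) fun c =>
      abs_exp_mul_sub_le l (abs_integral_le_of_forall_abs_le _ (hgK i)) (hgK i c))
    fun i => integral_exp_centered_pi_le l μ (hg i) (hgK i) (hgD i)
  refine ⟨W, hW, hWint, ?_⟩
  filter_upwards [ae_pi_forall_le hμ] with c hc i
  by_cases hi : minCost (T i) B c = ∞
  · simp [hi]
  have hae : ∀ᵐ c' ∂Measure.pi μ, minCost (T i) B c' = ENNReal.ofReal (g i c') := by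
    filter_upwards [ae_pi_forall_le hμ] with c' hc'
    have htc : tr c' = c' := funext fun e => min_eq_left (hc' e)
    simp only [g, htc, ENNReal.ofReal_toReal (minCost_ne_top_of_ne_top hi)]
  have hgc : (minCost (T i) B c).toReal = g i c := by
    simp only [g, tr, min_eq_left (hc _)]
  rw [lintegral_congr_ae hae, ← ofReal_integral_eq_lintegral_ofReal
    (integrable_of_measurable_of_abs_le _ (hg i) (hgK i))
    (.of_forall fun c' => ENNReal.toReal_nonneg), ← ENNReal.ofReal_toReal hi, hgc]
  refine le_trans (le_of_eq (congrArg ENNReal.ofReal ?_)) (ENNReal.ofReal_add_le.trans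
    (add_le_add ENNReal.ofReal_add_le (hWle i c)))
  ring

end Deviation

section Decoupling

variable {V : Type*} {G : SimpleGraph V}

lemma nncost_le_of_le_add [Fintype G.edgeSet] {f f' : G.edgeSet → ℝ≥0} {B ξ cs : ℝ≥0}
    {c : Environment G} (hf : ∀ e, f e ≤ B) (hf' : ∀ e, f' e ≤ f e + ξ) (hc : ∀ e, c e ≤ cs) :
    nncost f' c ≤ nncost f c + cs * Fintype.card G.edgeSet * (2 * B * ξ + ξ ^ 2) := by
  calc nncost f' c ≤ ∑ e, (c e * f e ^ 2 + cs * (2 * B * ξ + ξ ^ 2)) := by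
        refine Finset.sum_le_sum fun e _ => ?_
        calc c e * f' e ^ 2 ≤ c e * (f e + ξ) ^ 2 := by gcongr; exact hf' e
          _ = c e * f e ^ 2 + c e * (2 * f e * ξ + ξ ^ 2) := by ring
          _ ≤ _ := by
              gcongr
              exacts [hc e, hf e]
    _ = _ := by
        rw [Finset.sum_add_distrib, Finset.sum_const, Finset.card_univ, nsmul_eq_mul, nncost]
        ring

variable [DecidableEq V] [Finite V]

@[fun_prop]
lemma measurable_vol (e : G.edgeSet) : Measurable fun x : SimpleFlow G => x.vol e := by
  simp only [SimpleFlow.vol]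
  fun_prop

@[fun_prop]
lemma measurable_trans (v w : V) : Measurable fun x : SimpleFlow G => x.trans v w := by
  simp only [SimpleFlow.trans_eq_sum_mul]
  fun_prop

lemma sum_prod_drawWeight_mul_sampleTrans {m θ : ℝ≥0} {n : ℕ} {x : SimpleFlow G}
    (hx : ∑ σ, x σ ≤ m) (hm : 0 < m) (hθ : θ * n = m) (v w : V) :
    ∑ y : Fin n → Option (SimplePath G),
      (∏ i, drawWeight m x (y i)) * sampleTrans θ (fun i => drawEnds (y i)) v w = x.trans v w := by
  simp only [← trans_sampleFlow]
  rw [← SimpleFlow.trans_sum_mul]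
  simp only [sum_prod_drawWeight_mul_sampleFlow hm hx hθ]

variable [Fintype G.edgeSet]

lemma lintegral_minCost_mixture_le {Ω ι : Type*} [MeasurableSpace Ω] [Fintype ι] (P : Measure Ω)
    [IsProbabilityMeasure P] (ρ : Measure (Environment G)) {q : Ω → ι → ℝ≥0} (hq : Measurable q)
    (hq1 : ∀ ω, ∑ i, q ω i ≤ 1) (T : ι → V → V → ℝ≥0∞) (B : ι → ℝ≥0) {T₀ : V → V → ℝ≥0∞}
    (hT₀ : ∀ u v, T₀ u v = ∫⁻ ω, ∑ i, q ω i * T i u v ∂P) {B₂ : ℝ≥0}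
    (hB₂ : ∀ ω, ∑ i, q ω i * B i ≤ B₂) :
    ∫⁻ c, minCost T₀ B₂ c ∂ρ ≤
      ∫⁻ ω, ∑ i, (q ω i : ℝ≥0∞) * ∫⁻ c, minCost (T i) (B i) c ∂ρ ∂P := by
  have hqi : ∀ i, Measurable fun ω => (q ω i : ℝ≥0∞) := fun i => by fun_prop
  have hsum : ∀ a : ι → ℝ≥0∞,
      ∫⁻ ω, ∑ i, q ω i * a i ∂P = ∑ i, (∫⁻ ω, (q ω i : ℝ≥0∞) ∂P) * a i := fun a => by
    rw [lintegral_finsetSum _ fun i _ => (hqi i).mul_const _]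
    exact Finset.sum_congr rfl fun i _ => lintegral_mul_const _ (hqi i)
  have hle : ∀ ω i, q ω i ≤ 1 := fun ω i =>
    (Finset.single_le_sum (f := q ω) (by simp) (Finset.mem_univ i)).trans (hq1 ω)
  obtain ⟨w, hw⟩ : ∃ w : ι → ℝ≥0, ∀ i, ∫⁻ ω, (q ω i : ℝ≥0∞) ∂P = w i :=
    ⟨fun i => (∫⁻ ω, (q ω i : ℝ≥0∞) ∂P).toNNReal, fun i => (ENNReal.coe_toNNReal <|
      ne_top_of_le_ne_top ENNReal.one_ne_top <| (lintegral_mono fun ω =>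
        ENNReal.coe_le_one_iff.2 (hle ω i)).trans (by simp)).symm⟩
  have hmean : ∀ (a : ι → ℝ≥0) (b : ℝ≥0), (∀ ω, ∑ i, q ω i * a i ≤ b) → ∑ i, w i * a i ≤ b :=
    fun a b hab => by
      rw [← ENNReal.coe_le_coe]
      push_cast
      simp only [← hw]
      rw [← hsum]
      exact (lintegral_mono fun ω => (by exact_mod_cast hab ω :
        ∑ i, (q ω i : ℝ≥0∞) * a i ≤ b)).trans (by simp)
  have hw1 : ∑ i, w i ≤ 1 := by simpa using hmean 1 1 (by simpa using hq1)
  have hTw : T₀ = fun u v => ∑ i, w i * T i u v := by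
    funext u v
    rw [hT₀, hsum]
    simp only [hw]
  rw [hsum]
  simp only [hw]
  calc ∫⁻ c, minCost T₀ B₂ c ∂ρ ≤ ∫⁻ c, ∑ i, w i * minCost (T i) (B i) c ∂ρ :=
        lintegral_mono fun c => (minCost_anti T₀ c (hmean B B₂ hB₂)).trans
          (hTw ▸ minCost_sum_mul_le w hw1 T B c)
    _ = ∑ i, w i * ∫⁻ c, minCost (T i) (B i) c ∂ρ := by
        rw [lintegral_finsetSum _ fun i _ => (measurable_minCost _ _).const_mul _]
        exact Finset.sum_congr rfl fun i _ => lintegral_const_mul _ (measurable_minCost _ _)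

/-- The capacity granted to a sampled flow: `b` if it respects it, and else its total mass `m`. -/
def sampleCapacity (θ m b : ℝ≥0) {n : ℕ} (y : Fin n → Option (SimplePath G)) : ℝ≥0 :=
  open Classical in if ∀ e, (sampleFlow θ y).vol e ≤ b then b else m

lemma sampleFlow_feasible {θ m : ℝ≥0} {n : ℕ} (hθ : θ * n = m) (b : ℝ≥0)
    (y : Fin n → Option (SimplePath G)) : (sampleFlow θ y).Feasible
      (fun v w => sampleTrans θ (fun i => drawEnds (y i)) v w) (sampleCapacity θ m b y) where
  trans_eq v w := by rw [trans_sampleFlow]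
  vol_le e := by
    rw [sampleCapacity]
    split_ifs with h
    exacts [h e, (vol_sampleFlow_le θ y e).trans hθ.le]

lemma lintegral_minCost_sampleTrans_le {θ m : ℝ≥0} {n : ℕ} (hθ : θ * n = m) (b : ℝ≥0)
    (y : Fin n → Option (SimplePath G)) {cs : ℝ≥0} {μ : G.edgeSet → Measure ℝ≥0}
    [∀ e, IsProbabilityMeasure (μ e)] (hμ : ∀ e, ∀ᵐ t ∂μ e, t ≤ cs) :
    ∫⁻ c, minCost (fun v w => sampleTrans θ (fun i => drawEnds (y i)) v w)
        (sampleCapacity θ m b y) c ∂Measure.pi μ ≤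
      (cs * Fintype.card G.edgeSet * m ^ 2 : ℝ≥0) := by
  refine (lintegral_mono_ae (g := fun _ => ((cs * Fintype.card G.edgeSet * m ^ 2 : ℝ≥0) : ℝ≥0∞))
    ?_).trans (by simp)
  filter_upwards [ae_pi_forall_le hμ] with c hc
  exact ((sampleFlow_feasible hθ b y).minCost_le c).trans <| ENNReal.coe_le_coe.2 <|
    nncost_le_mul_card (fun e => (vol_sampleFlow_le θ y e).trans hθ.le) hc

variable {m B ξ θ : ℝ≥0} {n : ℕ} {x : SimpleFlow G}

lemma sum_prod_drawWeight_mul_le (hx : ∑ σ, x σ ≤ m) (hB : 0 < B) (hvol : ∀ e, x.vol e ≤ B)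
    (hξB : ξ ≤ 2 * B) (hm : 0 < m) (hθ : θ * n = m) {f : (Fin n → Option (SimplePath G)) → ℝ≥0∞}
    {R : ℝ≥0∞} {b : ℝ≥0} (hgood : ∀ y, (∀ e, (sampleFlow θ y).vol e ≤ x.vol e + ξ) → f y ≤ R)
    (hbad : ∀ y, f y ≤ R + b) :
    ∑ y, ((∏ i, drawWeight m x (y i) : ℝ≥0) : ℝ≥0∞) * f y ≤ R + ENNReal.ofReal
      (Fintype.card G.edgeSet * Real.exp (-((ξ : ℝ) ^ 2 * n / (4 * B * m))) * b) := by
  classical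
  let pr : (Fin n → Option (SimplePath G)) → ℝ≥0 := fun y => ∏ i, drawWeight m x (y i)
  let Bad : (Fin n → Option (SimplePath G)) → Prop :=
    fun y => ∃ e, x.vol e + ξ < (sampleFlow θ y).vol e
  have hpr : ∑ y, pr y = 1 := by
    simp only [pr]
    rw [sum_prod_eq_pow, sum_drawWeight hm hx, one_pow]
  have hBad : ((∑ y with Bad y, pr y : ℝ≥0) : ℝ≥0∞) ≤ ENNReal.ofReal
      (Fintype.card G.edgeSet * Real.exp (-((ξ : ℝ) ^ 2 * n / (4 * B * m)))) := by
    rw [← ENNReal.ofReal_coe_nnreal]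
    refine ENNReal.ofReal_le_ofReal ?_
    simpa only [Bad, pr, NNReal.coe_sum, NNReal.coe_prod] using
      sum_prod_drawWeight_of_exists_lt_vol_le hx hB hvol hξB hm hθ
  have hf : ∀ y, f y ≤ R + if Bad y then (b : ℝ≥0∞) else 0 := fun y => by
    split_ifs with hy
    · exact hbad y
    · simpa using hgood y fun e => not_lt.1 fun he => hy ⟨e, he⟩
  calc ∑ y, (pr y : ℝ≥0∞) * f y
      ≤ ∑ y, ((pr y : ℝ≥0∞) * R + if Bad y then (pr y : ℝ≥0∞) * b else 0) :=
        Finset.sum_le_sum fun y _ => (mul_le_mul_right (hf y) _).trans_eq (by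
          rw [mul_add, mul_ite, mul_zero])
    _ = (∑ y, pr y : ℝ≥0) * R + (∑ y with Bad y, pr y : ℝ≥0) * b := by
        push_cast
        rw [Finset.sum_add_distrib, ← Finset.sum_filter, Finset.sum_mul, Finset.sum_mul]
    _ ≤ _ := by
        rw [hpr, ENNReal.coe_one, one_mul, ENNReal.ofReal_mul (by positivity),
          ENNReal.ofReal_coe_nnreal]
        gcongr

lemma sum_prod_drawWeight_mul_sampleCapacity_le (hx : ∑ σ, x σ ≤ m) (hB : 0 < B)
    (hvol : ∀ e, x.vol e ≤ B) (hξB : ξ ≤ 2 * B) (hm : 0 < m) (hθ : θ * n = m) {B₂ : ℝ≥0}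
    (hB₂ : (B + ξ : ℝ) +
      Fintype.card G.edgeSet * Real.exp (-((ξ : ℝ) ^ 2 * n / (4 * B * m))) * m ≤ B₂) :
    ∑ y : Fin n → Option (SimplePath G),
      (∏ i, drawWeight m x (y i)) * sampleCapacity θ m (B + ξ) y ≤ B₂ := by
  rw [← ENNReal.coe_le_coe]
  push_cast
  have hmean := sum_prod_drawWeight_mul_le hx hB hvol hξB hm hθ (R := ((B + ξ : ℝ≥0) : ℝ≥0∞))
    (b := m) (f := fun y => sampleCapacity θ m (B + ξ) y)
    (fun y hy => by
      rw [sampleCapacity, if_pos fun e => (hy e).trans (add_le_add_left (hvol e) ξ)])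
    (fun y => by
      rw [sampleCapacity]
      split_ifs
      exacts [le_self_add, le_add_self])
  push_cast at hmean
  refine hmean.trans ?_
  rw [← ENNReal.coe_add, ← ENNReal.ofReal_coe_nnreal, ← ENNReal.ofReal_coe_nnreal (p := B₂),
    ← ENNReal.ofReal_add (by positivity) (by positivity)]
  exact ENNReal.ofReal_le_ofReal (by exact_mod_cast hB₂)

lemma sum_prod_drawWeight_mul_lintegral_minCost_le (hx : ∑ σ, x σ ≤ m) (hB : 0 < B)
    (hvol : ∀ e, x.vol e ≤ B) (hξB : ξ ≤ 2 * B) (hm : 0 < m) (hθ : θ * n = m) {cs : ℝ≥0}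
    {μ : G.edgeSet → Measure ℝ≥0} [∀ e, IsProbabilityMeasure (μ e)]
    (hμ : ∀ e, ∀ᵐ t ∂μ e, t ≤ cs) {c : Environment G} (hc : ∀ e, c e ≤ cs) {d : ℝ≥0∞}
    (hd : ∀ τ : Fin n → Option (V × V),
      ∫⁻ c', minCost (fun v w => sampleTrans θ τ v w) (B + ξ) c' ∂Measure.pi μ ≤
        minCost (fun v w => sampleTrans θ τ v w) (B + ξ) c + d) :
    ∑ y : Fin n → Option (SimplePath G), ((∏ i, drawWeight m x (y i) : ℝ≥0) : ℝ≥0∞) *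
        ∫⁻ c', minCost (fun v w => sampleTrans θ (fun i => drawEnds (y i)) v w)
          (sampleCapacity θ m (B + ξ) y) c' ∂Measure.pi μ ≤
      nncost x.vol c + (cs * Fintype.card G.edgeSet * (2 * B * ξ + ξ ^ 2) : ℝ≥0) + d +
        ENNReal.ofReal (Fintype.card G.edgeSet * Real.exp (-((ξ : ℝ) ^ 2 * n / (4 * B * m))) *
          (cs * Fintype.card G.edgeSet * m ^ 2 : ℝ≥0)) := by
  refine sum_prod_drawWeight_mul_le hx hB hvol hξB hm hθ (fun y hy => ?_) fun y =>
    (lintegral_minCost_sampleTrans_le hθ _ y hμ).trans le_add_self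
  have hcap : sampleCapacity θ m (B + ξ) y = B + ξ :=
    if_pos fun e => (hy e).trans (add_le_add_left (hvol e) ξ)
  have hcost := (sampleFlow_feasible hθ (B + ξ) y).minCost_le c
  rw [hcap] at hcost ⊢
  refine (hd _).trans (add_le_add_left (hcost.trans ?_) d)
  exact_mod_cast nncost_le_of_le_add hvol hy hc

end Decoupling

section DecoupledCost

variable {V : Type*} {G : SimpleGraph V} [DecidableEq V] [Fintype V] [Fintype G.edgeSet]

/-- The error made in replacing an environment-dependent flow by its expectation: `E` and `v` are
the numbers of edges and vertices, `m` bounds the total mass, `B` the flow-volumes; `n` paths are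
drawn, the flow-volumes deviate by at most `ξ`, and `l` is the parameter of the exponential moment
bound. -/
def decoupleError (cs B m ξ E v l : ℝ) (n : ℕ) : ℝ :=
  cs * E * (2 * B * ξ + ξ ^ 2) +
    (Real.log ((v ^ 2 + 1) ^ n) + E * (l ^ 2 * (cs * (B + ξ) ^ 2) ^ 2 / 2)) / l + 1 / l +
    E * Real.exp (-(ξ ^ 2 * n / (4 * B * m))) * (cs * E * m ^ 2)

/-- A flow `x` may depend on the environment `S`. Sampling finitely many paths from `x` leaves few
possible transportation measures, so that the minimal costs of all of them are close to their
expectations simultaneously. -/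
theorem lintegral_minCost_expectation_le {Ω : Type*} [MeasurableSpace Ω] (P : Measure Ω)
    [IsProbabilityMeasure P] (cs : ℝ≥0) (μ : G.edgeSet → Measure ℝ≥0)
    [∀ e, IsProbabilityMeasure (μ e)] (hμ : ∀ e, ∀ᵐ t ∂μ e, t ≤ cs) {S : Ω → Environment G}
    (hS : Measurable S) (hlaw : P.map S = Measure.pi μ) {x : Ω → SimpleFlow G}
    (hx : Measurable x) {m B ξ B₂ : ℝ≥0} (hm : 0 < m) (hB : 0 < B)
    (hmass : ∀ ω, ∑ σ, x ω σ ≤ m) (hvol : ∀ ω e, (x ω).vol e ≤ B) (hξB : ξ ≤ 2 * B)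
    {n : ℕ} (hn : 0 < n) {l : ℝ} (hl : 0 < l) {T₀ : V → V → ℝ≥0∞}
    (hT₀ : ∀ v w, T₀ v w = ∫⁻ ω, (x ω).trans v w ∂P)
    (hB₂ : (B + ξ : ℝ) +
      Fintype.card G.edgeSet * Real.exp (-((ξ : ℝ) ^ 2 * n / (4 * B * m))) * m ≤ B₂) :
    ∫⁻ c, minCost T₀ B₂ c ∂Measure.pi μ ≤ ∫⁻ ω, nncost (x ω).vol (S ω) ∂P +
      ENNReal.ofReal (decoupleError cs B m ξ (Fintype.card G.edgeSet) (Fintype.card V) l n) := by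
  have hθ : m / n * n = m := div_mul_cancel₀ _ (by exact_mod_cast hn.ne')
  obtain ⟨W, hW, hWint, hWle⟩ := exists_deviation_bound
    (fun (τ : Fin n → Option (V × V)) v w => (sampleTrans (m / n) τ v w : ℝ≥0∞)) (B + ξ) cs μ hμ hl
  have hSae : ∀ {r : Environment G → Prop}, (∀ᵐ c ∂Measure.pi μ, r c) → ∀ᵐ ω ∂P, r (S ω) :=
    fun h => ae_of_ae_map hS.aemeasurable (by rwa [hlaw])
  refine (lintegral_minCost_mixture_le P (Measure.pi μ)
    (q := fun ω (y : Fin n → Option (SimplePath G)) => ∏ i, drawWeight m (x ω) (y i))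
    (by fun_prop) (fun ω => by
      rw [sum_prod_eq_pow, sum_drawWeight hm (hmass ω), one_pow])
    (fun y v w => sampleTrans (m / n) (fun i => drawEnds (y i)) v w)
    (sampleCapacity (m / n) m (B + ξ))
    (fun v w => (hT₀ v w).trans (lintegral_congr fun ω => by
      rw [← sum_prod_drawWeight_mul_sampleTrans (hmass ω) hm hθ]
      push_cast
      rfl))
    fun ω => sum_prod_drawWeight_mul_sampleCapacity_le (hmass ω) hB (hvol ω) hξB hm hθ hB₂).trans ?_
  have hWS : Measurable fun ω => W (S ω) := hW.comp hS
  have hpointwise := (hSae (ae_pi_forall_le hμ)).and (hSae hWle) |>.mono fun ω h =>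
    sum_prod_drawWeight_mul_lintegral_minCost_le (hmass ω) hB (hvol ω) hξB hm hθ hμ h.1
      fun τ => (h.2 τ).trans_eq (add_assoc _ _ _)
  refine (lintegral_mono_ae hpointwise).trans ?_
  rw [lintegral_add_right _ measurable_const, lintegral_add_right _ (by fun_prop),
    lintegral_add_right _ measurable_const, lintegral_add_right _ hWS, ← lintegral_map hW hS, hlaw]
  simp only [lintegral_const, measure_univ, mul_one, add_assoc]
  have := Real.log_natCast_nonneg (Fintype.card (Fin n → Option (V × V)))
  gcongr
  refine (add_le_add_right (add_le_add_right (add_le_add_left hWint _) _) _).trans_eq ?_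
  rw [← ENNReal.ofReal_coe_nnreal, ← ENNReal.ofReal_add (by positivity) (by positivity),
    ← ENNReal.ofReal_add (by positivity) (by positivity),
    ← ENNReal.ofReal_add (by positivity) (by positivity), decoupleError]
  simp only [Fintype.card_fun, Fintype.card_option, Fintype.card_prod, Fintype.card_fin]
  push_cast
  ring_nf

end DecoupledCost

/-! ### Cutting walks along the boundary of a subgraph -/

lemma ite_mk_eq_le_ite_map_eq {α β : Type*} [DecidableEq α] [DecidableEq β] (a b : α)
    (e : Sym2 α) (f : α → β) :
    (if s(a, b) = e then 1 else 0) ≤ if s(f a, f b) = Sym2.map f e then 1 else 0 := by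
  split_ifs with h h'
  · exact le_rfl
  · exact absurd (by rw [← h, Sym2.map_mk]) h'
  · exact Nat.zero_le _
  · exact le_rfl

section Cutting

variable {V I D : Type*} {G : SimpleGraph V} {H : SimpleGraph (I ⊕ D)}

/-- `H` is realized in `G` by `ι` such that every edge of `G` at an internal vertex `inl q` comes
from `H`, and each boundary vertex `inr b` is joined in `H` to the internal vertex `att b` only. -/
structure Realization (H : SimpleGraph (I ⊕ D)) (G : SimpleGraph V) where
  ι : I ⊕ D → V
  inj : Function.Injective ι
  hom : ∀ {a b}, H.Adj a b → G.Adj (ι a) (ι b)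
  full : ∀ {q v}, G.Adj (ι (.inl q)) v → ∃ z, v = ι z ∧ H.Adj (.inl q) z
  att : D → I
  adj_att : ∀ b, H.Adj (.inr b) (.inl (att b))
  att_eq : ∀ {b z}, H.Adj (.inr b) z → z = .inl (att b)

namespace Realization

variable (R : Realization H G)

open Classical in
/-- Indicator of the internal vertices. -/
def inside (v : V) : ℕ := if ∃ q, v = R.ι (.inl q) then 1 else 0

lemma inside_inl (q : I) : R.inside (R.ι (.inl q)) = 1 := if_pos ⟨q, rfl⟩

lemma inside_of_forall_ne {v : V} (hv : ∀ q, v ≠ R.ι (.inl q)) : R.inside v = 0 :=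
  if_neg fun ⟨q, hq⟩ => hv q hq

lemma inr_ne_inl (b : D) (q : I) : R.ι (.inr b) ≠ R.ι (.inl q) :=
  fun h => Sum.inr_ne_inl (R.inj h)

variable [DecidableEq V]

/-- The number of entrances of `w` through `b`. -/
def entries {u v : V} (w : G.Walk u v) (b : D) : ℕ :=
  w.darts.countP fun d => d.fst = R.ι (.inr b) ∧ d.snd = R.ι (.inl (R.att b))

/-- The number of exits of `w` through `b`. -/
def exits {u v : V} (w : G.Walk u v) (b : D) : ℕ :=
  w.darts.countP fun d => d.fst = R.ι (.inl (R.att b)) ∧ d.snd = R.ι (.inr b)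

lemma entries_cons {u u' v : V} (h : G.Adj u u') (w : G.Walk u' v) (b : D) :
    R.entries (.cons h w) b = R.entries w b +
      if u = R.ι (.inr b) ∧ u' = R.ι (.inl (R.att b)) then 1 else 0 := by
  simp [entries, List.countP_cons]

lemma exits_cons {u u' v : V} (h : G.Adj u u') (w : G.Walk u' v) (b : D) :
    R.exits (.cons h w) b = R.exits w b +
      if u = R.ι (.inl (R.att b)) ∧ u' = R.ι (.inr b) then 1 else 0 := by
  simp [exits, List.countP_cons]

end Realization

variable [DecidableEq V] [DecidableEq I] [DecidableEq D]

/-- `L` consists of the pieces of `w`, if the paths that come before `w` have their entrances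
counted by `a` and their crossings counted by `k`; the last piece leads to `b₀`. -/
structure IsCut (R : Realization H G) (b₀ : D) {u v : V} (w : G.Walk u v) (L : List (FinPath H))
    (a : D → ℕ) (k : H.edgeSet → ℕ) : Prop where
  boundary : ∀ σ ∈ L, (∃ b, σ.ent = .inr b) ∧ ∃ b, σ.exi = .inr b
  ent : ∀ b, L.countP (fun σ => σ.ent = .inr b) = a b + R.entries w b
  exi : ∀ b, L.countP (fun σ => σ.exi = .inr b) =
    R.exits w b + if b = b₀ then R.inside v else 0
  cross : ∀ e, (L.map fun σ => σ.crossings e).sum ≤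
    k e + w.edges.count (Sym2.map R.ι e) + R.inside v

namespace IsCut

variable {R : Realization H G} {b₀ : D}

lemma nil_of_outside {u : V} (hu : ∀ q, u ≠ R.ι (.inl q)) :
    IsCut R b₀ (.nil : G.Walk u u) [] 0 0 where
  boundary := by simp
  ent := by simp [Realization.entries]
  exi := by simp [Realization.exits, R.inside_of_forall_ne hu]
  cross := by simp

lemma nil_of_inside {q : I} {b₁ : D} (pre : H.Walk (.inr b₁) (.inl q))
    {post : H.Walk (.inl q) (.inr b₀)} (hpost : post.IsPath) :
    IsCut R b₀ (.nil : G.Walk (R.ι (.inl q)) _) [⟨_, _, pre.append post⟩] (Pi.single b₁ 1)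
      (fun e => pre.edges.count (e : Sym2 (I ⊕ D))) where
  boundary := by simp
  ent b := by simp [Realization.entries, Pi.single_apply, eq_comm]
  exi b := by simp [Realization.exits, R.inside_inl, eq_comm]
  cross e := by
    have := List.nodup_iff_count_le_one.1 hpost.isTrail.edges_nodup (e : Sym2 (I ⊕ D))
    simpa [FinPath.crossings, R.inside_inl] using this

variable {v : V} {L : List (FinPath H)}

lemma cons_outside {u u' : V} {w : G.Walk u' v} (hL : IsCut R b₀ w L 0 0) (h : G.Adj u u')
    (hu : ∀ q, u ≠ R.ι (.inl q)) (hu' : ∀ q, u' ≠ R.ι (.inl q)) :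
    IsCut R b₀ (.cons h w) L 0 0 where
  boundary := hL.boundary
  ent b := by simp [hL.ent, R.entries_cons, hu']
  exi b := by simp [hL.exi, R.exits_cons, hu]
  cross e := (hL.cross e).trans (by
    rw [Walk.edges_cons]
    gcongr
    exact List.count_le_count_cons)

lemma cons_enter {b : D} {w : G.Walk (R.ι (.inl (R.att b))) v}
    (hL : IsCut R b₀ w L (Pi.single b 1)
      fun e => (Walk.cons (R.adj_att b) .nil).edges.count (e : Sym2 (I ⊕ D)))
    (h : G.Adj (R.ι (.inr b)) (R.ι (.inl (R.att b)))) : IsCut R b₀ (.cons h w) L 0 0 where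
  boundary := hL.boundary
  ent b' := by
    rw [hL.ent, R.entries_cons]
    by_cases hb : b' = b
    · subst hb
      simp [add_comm]
    · simp [R.inj.eq_iff, hb, Ne.symm hb]
  exi b' := by simp [hL.exi, R.exits_cons, R.inj.eq_iff]
  cross e := by
    have hedge := ite_mk_eq_le_ite_map_eq (.inr b) (.inl (R.att b)) (e : Sym2 (I ⊕ D)) R.ι
    have hcross := hL.cross e
    simp only [Walk.edges_cons, Walk.edges_nil, List.count_cons, List.count_nil, beq_iff_eq,
      Pi.zero_apply] at hcross ⊢
    omega

lemma cons_inside {q q' : I} {b₁ : D} {pre : H.Walk (.inr b₁) (.inl q)}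
    {hadj : H.Adj (.inl q) (.inl q')} {w : G.Walk (R.ι (.inl q')) v}
    (hL : IsCut R b₀ w L (Pi.single b₁ 1) fun e =>
      (pre.concat hadj).edges.count (e : Sym2 (I ⊕ D)))
    (h : G.Adj (R.ι (.inl q)) (R.ι (.inl q'))) :
    IsCut R b₀ (.cons h w) L (Pi.single b₁ 1)
      fun e => pre.edges.count (e : Sym2 (I ⊕ D)) where
  boundary := hL.boundary
  ent b' := by simp [hL.ent, R.entries_cons, R.inj.eq_iff]
  exi b' := by simp [hL.exi, R.exits_cons, R.inj.eq_iff]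
  cross e := by
    have hedge := ite_mk_eq_le_ite_map_eq (.inl q) (.inl q') (e : Sym2 (I ⊕ D)) R.ι
    have hcross := hL.cross e
    simp only [Walk.edges_concat, Walk.edges_cons, List.concat_eq_append, List.count_append,
      List.count_cons, List.count_nil, zero_add, beq_iff_eq] at hcross ⊢
    omega

lemma cons_exit {b b₁ : D} {pre : H.Walk (.inr b₁) (.inl (R.att b))} {w : G.Walk (R.ι (.inr b)) v}
    (hL : IsCut R b₀ w L 0 0) (h : G.Adj (R.ι (.inl (R.att b))) (R.ι (.inr b))) :
    IsCut R b₀ (.cons h w) (⟨_, _, pre.concat (R.adj_att b).symm⟩ :: L) (Pi.single b₁ 1)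
      fun e => pre.edges.count (e : Sym2 (I ⊕ D)) where
  boundary := List.forall_mem_cons.2 ⟨⟨⟨_, rfl⟩, _, rfl⟩, hL.boundary⟩
  ent b' := by
    rw [List.countP_cons, hL.ent, R.entries_cons]
    by_cases hb : b' = b₁
    · subst hb
      simp [R.inj.eq_iff, add_comm]
    · simp [R.inj.eq_iff, hb, Ne.symm hb]
  exi b' := by
    rw [List.countP_cons, hL.exi, R.exits_cons]
    by_cases hb : b' = b
    · subst hb
      simp [add_right_comm]
    · simp [R.inj.eq_iff, Ne.symm hb]
  cross e := by
    have hedge := ite_mk_eq_le_ite_map_eq (.inl (R.att b)) (.inr b) (e : Sym2 (I ⊕ D)) R.ι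
    have hcross := hL.cross e
    simp only [List.map_cons, List.sum_cons, FinPath.crossings, Walk.edges_concat,
      Walk.edges_cons, List.concat_eq_append, List.count_append, List.count_cons, List.count_nil,
      zero_add, beq_iff_eq, Pi.zero_apply] at hcross ⊢
    omega

end IsCut

lemma exists_isCut_extending (R : Realization H G) {b₀ : D}
    (hcon : ∀ q, H.Reachable (.inl q) (.inr b₀)) {u v : V} (w : G.Walk u v) :
    ((∀ q, u ≠ R.ι (.inl q)) → ∃ L, IsCut R b₀ w L 0 0) ∧
    ∀ q, u = R.ι (.inl q) → ∀ b₁ (pre : H.Walk (.inr b₁) (.inl q)),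
      ∃ L, IsCut R b₀ w L (Pi.single b₁ 1) fun e => pre.edges.count (e : Sym2 (I ⊕ D)) := by
  induction w with
  | nil =>
    refine ⟨fun hu => ⟨[], .nil_of_outside hu⟩, ?_⟩
    rintro q rfl b₁ pre
    obtain ⟨post⟩ := hcon q
    exact ⟨_, .nil_of_inside pre post.bypass_isPath⟩
  | @cons u u' v h w ih =>
    refine ⟨fun hu => ?_, ?_⟩
    · by_cases hu' : ∃ q', u' = R.ι (.inl q')
      · obtain ⟨q', rfl⟩ := hu'
        obtain ⟨q | b, rfl, hadj⟩ := R.full h.symm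
        · exact absurd rfl (hu q)
        · obtain rfl : q' = R.att b := Sum.inl_injective (R.att_eq hadj.symm)
          obtain ⟨L, hL⟩ := ih.2 _ rfl b (.cons hadj.symm .nil)
          exact ⟨L, hL.cons_enter h⟩
      · push Not at hu'
        obtain ⟨L, hL⟩ := ih.1 hu'
        exact ⟨L, hL.cons_outside h hu hu'⟩
    · rintro q rfl b₁ pre
      obtain ⟨q' | b, rfl, hadj⟩ := R.full h
      · obtain ⟨L, hL⟩ := ih.2 q' rfl b₁ (pre.concat hadj)
        exact ⟨L, hL.cons_inside h⟩
      · obtain rfl : q = R.att b := Sum.inl_injective (R.att_eq hadj.symm)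
        obtain ⟨L, hL⟩ := ih.1 (R.inr_ne_inl b)
        exact ⟨_, hL.cons_exit (pre := pre) h⟩

/-- The first and the last piece are completed by paths from and to `b₀`. -/
theorem exists_isCut (R : Realization H G) (b₀ : D) (hcon : ∀ q, H.Reachable (.inl q) (.inr b₀))
    {u v : V} (w : G.Walk u v) :
    ∃ L, IsCut R b₀ w L (Pi.single b₀ (R.inside u)) (fun _ => R.inside u) := by
  by_cases hu : ∃ q, u = R.ι (.inl q)
  · obtain ⟨q, rfl⟩ := hu
    obtain ⟨c⟩ := (hcon q).symm
    obtain ⟨L, hL⟩ := (exists_isCut_extending R hcon w).2 q rfl b₀ c.bypass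
    rw [R.inside_inl]
    refine ⟨L, hL.boundary, hL.ent, hL.exi, fun e => (hL.cross e).trans ?_⟩
    gcongr
    exact List.nodup_iff_count_le_one.1 c.bypass_isPath.isTrail.edges_nodup _
  · push Not at hu
    rw [R.inside_of_forall_ne hu, Pi.single_zero]
    exact (exists_isCut_extending R hcon w).1 hu

end Cutting

/-! ### The extended square as a part of the torus -/

section Torus

variable {N : ℕ} [NeZero N]

/-- The direction in which a square is entered through a side. -/
def Side.inward : Side → ℤ × ℤ
  | .left => (1, 0)
  | .right => (-1, 0)
  | .bottom => (0, 1)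
  | .top => (0, -1)

/-- The opposite side. -/
def Side.opp : Side → Side
  | .left => .right
  | .right => .left
  | .bottom => .top
  | .top => .bottom

lemma Side.opp_opp (s : Side) : s.opp.opp = s := by cases s <;> rfl

lemma Side.inward_opp (s : Side) : s.opp.inward = -s.inward := by cases s <;> rfl

lemma Side.inward_injective : Function.Injective Side.inward := by
  rintro (_ | _ | _ | _) (_ | _ | _ | _) <;> decide

/-- The projection of the lattice onto the torus. -/
def latticeProj (N : ℕ) [NeZero N] : ℤ × ℤ →+ Fin N × Fin N :=
  (zmultiplesHom (Fin N) 1).prodMap (zmultiplesHom (Fin N) 1)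

lemma zsmul_one_eq_zero_iff_dvd (k : ℤ) : k • (1 : Fin N) = 0 ↔ (N : ℤ) ∣ k := by
  obtain ⟨n, rfl⟩ := Nat.exists_eq_succ_of_ne_zero (NeZero.ne N)
  rw [← ZMod.intCast_zmod_eq_zero_iff_dvd, ← zsmul_one]
  exact Iff.rfl

lemma latticeProj_eq_zero_iff_dvd (a : ℤ × ℤ) :
    latticeProj N a = 0 ↔ (N : ℤ) ∣ a.1 ∧ (N : ℤ) ∣ a.2 := by
  simp [latticeProj, Prod.ext_iff, zsmul_one_eq_zero_iff_dvd]

lemma eq_of_latticeProj_eq {a b : ℤ × ℤ} (h₁ : |a.1 - b.1| < N) (h₂ : |a.2 - b.2| < N)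
    (h : latticeProj N a = latticeProj N b) : a = b := by
  rw [← sub_eq_zero, ← map_sub, latticeProj_eq_zero_iff_dvd] at h
  exact Prod.ext (sub_eq_zero.1 (Int.eq_zero_of_abs_lt_dvd h.1 h₁))
    (sub_eq_zero.1 (Int.eq_zero_of_abs_lt_dvd h.2 h₂))

lemma cycleGraph_adj_iff (hN : 2 ≤ N) {u v : Fin N} :
    (cycleGraph N).Adj u v ↔ v = u + 1 ∨ v = u - 1 := by
  obtain ⟨n, rfl⟩ := Nat.exists_eq_add_of_le' hN
  rw [cycleGraph_adj, sub_eq_iff_eq_add', sub_eq_iff_eq_add', or_comm, eq_comm (a := u),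
    ← eq_sub_iff_add_eq]

lemma torus_adj_iff_exists_inward (hN : 2 ≤ N) {u v : Fin N × Fin N} :
    (torus N).Adj u v ↔ ∃ s : Side, v = u + latticeProj N s.inward := by
  obtain ⟨a, b⟩ := u
  obtain ⟨c, d⟩ := v
  simp only [boxProd_adj, cycleGraph_adj_iff hN]
  constructor
  · rintro (⟨rfl | rfl, rfl⟩ | ⟨rfl | rfl, rfl⟩)
    · exact ⟨.left, by simp [latticeProj, Side.inward]⟩
    · exact ⟨.right, by simp [latticeProj, Side.inward, sub_eq_add_neg]⟩
    · exact ⟨.bottom, by simp [latticeProj, Side.inward]⟩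
    · exact ⟨.top, by simp [latticeProj, Side.inward, sub_eq_add_neg]⟩
  · rintro ⟨s, h⟩
    cases s <;> simp [latticeProj, Side.inward, ← sub_eq_add_neg] at h <;> simp [h]

lemma latticeProj_inward_injective (hN : 3 ≤ N) :
    Function.Injective fun s : Side => latticeProj N s.inward := by
  intro s s' h
  refine Side.inward_injective ?_
  apply eq_of_latticeProj_eq _ _ h <;> cases s <;> cases s' <;>
    simp only [Side.inward, abs_lt] <;> omega

end Torus

section Embedding

variable {M N : ℕ}

/-- The position of the vertices of the extended square in the lattice, with the boundary points
moved outwards to the next lattice points. -/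
def offset : SqVertex M → ℤ × ℤ
  | .inl p => (p.1, p.2)
  | .inr (.left, j) => (-1, j)
  | .inr (.right, j) => (M, j)
  | .inr (.bottom, i) => (i, -1)
  | .inr (.top, i) => (i, M)

lemma offset_mem (z : SqVertex M) :
    (-1 ≤ (offset z).1 ∧ (offset z).1 ≤ M) ∧ -1 ≤ (offset z).2 ∧ (offset z).2 ≤ M := by
  rcases z with ⟨x, y⟩ | ⟨_ | _ | _ | _, j⟩ <;> simp only [offset] <;> omega

lemma offset_injective : Function.Injective (offset (M := M)) := by
  intro z z' h
  rcases z with ⟨x, y⟩ | ⟨_ | _ | _ | _, j⟩ <;>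
    rcases z' with ⟨x', y'⟩ | ⟨_ | _ | _ | _, j'⟩ <;>
    simp only [offset, Prod.mk.injEq] at h <;>
    first
    | (exfalso; omega)
    | (simp only [Sum.inl.injEq, Sum.inr.injEq, Prod.mk.injEq, true_and, Fin.ext_iff]; omega)

/-- The internal vertex at a boundary point. -/
def attach : Bou M → Fin M × Fin M
  | (.left, j) => (⟨0, j.pos⟩, j)
  | (.right, j) => (⟨M - 1, Nat.sub_one_lt_of_lt j.pos⟩, j)
  | (.bottom, i) => (i, ⟨0, i.pos⟩)
  | (.top, i) => (i, ⟨M - 1, Nat.sub_one_lt_of_lt i.pos⟩)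

lemma attached_iff_eq_attach {q : Fin M × Fin M} {b : Bou M} : Attached q b ↔ q = attach b := by
  obtain ⟨x, y⟩ := q
  obtain ⟨_ | _ | _ | _, j⟩ := b <;> simp only [Attached, attach, Prod.mk.injEq, Fin.ext_iff] <;>
    omega

lemma extSquare_adj_attach (b : Bou M) : (extSquare M).Adj (.inr b) (.inl (attach b)) :=
  attached_iff_eq_attach.2 rfl

lemma eq_attach_of_adj {b : Bou M} {z : SqVertex M} (h : (extSquare M).Adj (.inr b) z) :
    z = .inl (attach b) := by
  rcases z with q | b'
  · rw [attached_iff_eq_attach.1 h]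
  · exact h.elim

lemma offset_attach (b : Bou M) :
    offset (.inl (attach b)) = offset (.inr b) + b.1.inward := by
  obtain ⟨_ | _ | _ | _, j⟩ := b
  · simp [offset, attach, Side.inward]
  · have := j.pos
    simp only [offset, attach, Side.inward, Prod.mk_add_mk, Prod.mk.injEq]
    omega
  · simp [offset, attach, Side.inward]
  · have := j.pos
    simp only [offset, attach, Side.inward, Prod.mk_add_mk, Prod.mk.injEq]
    omega

lemma exists_offset_eq_of_adj {z z' : SqVertex M} (h : (extSquare M).Adj z z') :
    ∃ s : Side, offset z' = offset z + s.inward := by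
  rcases z with ⟨x, y⟩ | b
  · rcases z' with ⟨x', y'⟩ | b
    · change ((pathGraph M).boxProd (pathGraph M)).Adj _ _ at h
      simp only [boxProd_adj, pathGraph_adj] at h
      rcases h with ⟨h | h, rfl⟩ | ⟨h | h, rfl⟩
      · exact ⟨.left, by simp [offset, Side.inward, ← h]⟩
      · exact ⟨.right, by simp [offset, Side.inward, ← h]⟩
      · exact ⟨.bottom, by simp [offset, Side.inward, ← h]⟩
      · exact ⟨.top, by simp [offset, Side.inward, ← h]⟩
    · rw [Sum.inl_injective (eq_attach_of_adj h.symm)]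
      exact ⟨b.1.opp, by rw [offset_attach, Side.inward_opp, add_neg_cancel_right]⟩
  · rw [eq_attach_of_adj h]
    exact ⟨b.1, offset_attach b⟩

lemma exists_adj_offset_eq (q : Fin M × Fin M) (s : Side) :
    ∃ z, (extSquare M).Adj (.inl q) z ∧ offset z = offset (.inl q) + s.inward := by
  obtain ⟨x, y⟩ := q
  have adj_of {z : SqVertex M} (h : SqAdj (.inl (x, y)) z) : (extSquare M).Adj (.inl (x, y)) z := h
  cases s
  · by_cases hx : (x : ℕ) + 1 < M
    · exact ⟨.inl (⟨x + 1, hx⟩, y), adj_of (by simp [SqAdj, boxProd_adj, pathGraph_adj]),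
        by simp [offset, Side.inward]⟩
    · exact ⟨.inr (.right, y), adj_of (by simp only [SqAdj, Attached, and_true]; omega),
        by simp only [offset, Side.inward, Prod.mk_add_mk, Prod.mk.injEq]; omega⟩
  · by_cases hx : (x : ℕ) = 0
    · exact ⟨.inr (.left, y), adj_of (by simp [SqAdj, Attached, hx]),
        by simp [offset, Side.inward, hx]⟩
    · exact ⟨.inl (⟨x - 1, by omega⟩, y),
        adj_of (by simp only [SqAdj, boxProd_adj, pathGraph_adj, and_true]; omega),
        by simp only [offset, Side.inward, Prod.mk_add_mk, Prod.mk.injEq]; omega⟩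
  · by_cases hy : (y : ℕ) + 1 < M
    · exact ⟨.inl (x, ⟨y + 1, hy⟩), adj_of (by simp [SqAdj, boxProd_adj, pathGraph_adj]),
        by simp [offset, Side.inward]⟩
    · exact ⟨.inr (.top, x), adj_of (by simp only [SqAdj, Attached, and_true]; omega),
        by simp only [offset, Side.inward, Prod.mk_add_mk, Prod.mk.injEq]; omega⟩
  · by_cases hy : (y : ℕ) = 0
    · exact ⟨.inr (.bottom, x), adj_of (by simp [SqAdj, Attached, hy]),
        by simp [offset, Side.inward, hy]⟩
    · exact ⟨.inl (x, ⟨y - 1, by omega⟩),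
        adj_of (by simp only [SqAdj, boxProd_adj, pathGraph_adj, and_true]; omega),
        by simp only [offset, Side.inward, Prod.mk_add_mk, Prod.mk.injEq]; omega⟩

variable [NeZero N]

/-- The position in the torus of the vertices of the extended square with lower left corner
`p`. -/
def place (p : Fin N × Fin N) (z : SqVertex M) : Fin N × Fin N := p + latticeProj N (offset z)

lemma place_injective (hMN : M + 2 ≤ N) (p : Fin N × Fin N) :
    Function.Injective (place (M := M) p) := by
  intro z z' h
  obtain ⟨⟨_, _⟩, _, _⟩ := offset_mem z
  obtain ⟨⟨_, _⟩, _, _⟩ := offset_mem z'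
  refine offset_injective (eq_of_latticeProj_eq ?_ ?_ (add_left_cancel h)) <;> rw [abs_lt] <;>
    omega

lemma place_of_offset_eq {p : Fin N × Fin N} {z z' : SqVertex M} {s : Side}
    (h : offset z' = offset z + s.inward) : place p z' = place p z + latticeProj N s.inward := by
  rw [place, h, map_add, ← add_assoc, place]

/-- The extended square at the position `p` of the torus. -/
def squareAt (hMN : M + 2 ≤ N) (p : Fin N × Fin N) : Realization (extSquare M) (torus N) where
  ι := place p
  inj := place_injective hMN p
  hom h := by
    obtain ⟨s, hs⟩ := exists_offset_eq_of_adj h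
    exact (torus_adj_iff_exists_inward (by omega)).2 ⟨s, place_of_offset_eq hs⟩
  full {q _} h := by
    obtain ⟨s, rfl⟩ := (torus_adj_iff_exists_inward (by omega)).1 h
    obtain ⟨z, hz, hs⟩ := exists_adj_offset_eq q s
    exact ⟨z, (place_of_offset_eq hs).symm, hz⟩
  att := attach
  adj_att := extSquare_adj_attach
  att_eq := eq_attach_of_adj

/-- The number of steps of a walk in the torus in the direction that enters squares through the
side `s`. -/
def steps {u v : Fin N × Fin N} (w : (torus N).Walk u v) (s : Side) : ℕ :=
  w.darts.countP fun d => d.snd = d.fst + latticeProj N s.inward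

lemma steps_cons (hN : 3 ≤ N) {u u' v : Fin N × Fin N} (h : (torus N).Adj u u')
    (w : (torus N).Walk u' v) {s : Side} (hs : u' = u + latticeProj N s.inward) :
    steps (.cons h w) = steps w + Pi.single s 1 := by
  subst hs
  ext s'
  simp [steps, List.countP_cons, (latticeProj_inward_injective hN).eq_iff, Pi.single_apply,
    eq_comm]

/-- The displacement of the lift of a walk in the torus to the lattice. -/
def winding {u v : Fin N × Fin N} (w : (torus N).Walk u v) : ℤ × ℤ :=
  ∑ s, steps w s • s.inward

theorem latticeProj_winding (hN : 3 ≤ N) {u v : Fin N × Fin N} (w : (torus N).Walk u v) :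
    latticeProj N (winding w) = v - u := by
  induction w with
  | nil => simp [winding, steps]
  | @cons u u' v h w ih =>
    obtain ⟨s, hs⟩ := (torus_adj_iff_exists_inward (by omega)).1 h
    have hwinding : winding (.cons h w) = winding w + s.inward := by
      simp [winding, steps_cons hN h w hs, add_smul, Finset.sum_add_distrib, Pi.single_apply]
    rw [hwinding, map_add, ih, hs]
    abel

lemma sum_countP_eq_countP {α β : Type*} [Fintype α] (l : List β) (P : α → β → Prop)
    [∀ a b, Decidable (P a b)] (Q : β → Prop) [DecidablePred Q]
    (h : ∀ b ∈ l, ∑ a, (if P a b then 1 else 0) = if Q b then 1 else 0) :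
    ∑ a, l.countP (fun b => P a b) = l.countP (fun b => Q b) := by
  induction l with
  | nil => simp
  | cons b l ih =>
    simp only [List.countP_cons, decide_eq_true_eq]
    rw [Finset.sum_add_distrib, ih fun b hb => h b (List.mem_cons_of_mem _ hb),
      h b List.mem_cons_self]

lemma place_attach (p : Fin N × Fin N) (b : Bou M) :
    place p (.inl (attach b)) = place p (.inr b) + latticeProj N b.1.inward :=
  place_of_offset_eq (offset_attach b)

lemma sum_entries (hMN : M + 2 ≤ N) {u v : Fin N × Fin N} (w : (torus N).Walk u v) (b : Bou M) :
    ∑ p, (squareAt hMN p).entries w b = steps w b.1 := by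
  refine sum_countP_eq_countP _ (fun p (d : (torus N).Dart) =>
    d.fst = place p (.inr b) ∧ d.snd = place p (.inl (attach b))) _ fun d _ => ?_
  have hpos : ∀ p, (d.fst = place p (.inr b) ∧ d.snd = place p (.inl (attach b))) ↔
      p = d.fst - latticeProj N (offset (.inr b)) ∧ d.snd = d.fst + latticeProj N b.1.inward := by
    intro p
    rw [place_attach, eq_sub_iff_add_eq, eq_comm (a := d.fst)]
    exact and_congr_right fun h => by rw [h]
  simp only [hpos, ite_and, Finset.sum_ite_eq', Finset.mem_univ, if_true]

lemma sum_exits (hMN : M + 2 ≤ N) {u v : Fin N × Fin N} (w : (torus N).Walk u v) (b : Bou M) :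
    ∑ p, (squareAt hMN p).exits w b = steps w b.1.opp := by
  refine sum_countP_eq_countP _ (fun p (d : (torus N).Dart) =>
    d.fst = place p (.inl (attach b)) ∧ d.snd = place p (.inr b)) _ fun d _ => ?_
  have hpos : ∀ p, (d.fst = place p (.inl (attach b)) ∧ d.snd = place p (.inr b)) ↔
      p = d.snd - latticeProj N (offset (.inr b)) ∧
        d.snd = d.fst + latticeProj N b.1.opp.inward := by
    intro p
    rw [place_attach, Side.inward_opp, map_neg, ← sub_eq_add_neg, eq_sub_iff_add_eq,
      eq_sub_iff_add_eq, and_comm, eq_comm (a := d.snd)]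
    exact and_congr_right fun h => by rw [← h, eq_comm]
  simp only [hpos, ite_and, Finset.sum_ite_eq', Finset.mem_univ, if_true]

lemma sum_inside (hMN : M + 2 ≤ N) (u : Fin N × Fin N) :
    ∑ p, (squareAt (M := M) hMN p).inside u = M ^ 2 := by
  classical
  have hpos : (Finset.univ.filter fun p => ∃ q, u = (squareAt (M := M) hMN p).ι (.inl q)) =
      Finset.univ.image fun q : Fin M × Fin M => u - latticeProj N (offset (.inl q)) := by
    ext p
    simp only [Finset.mem_filter, Finset.mem_univ, true_and, Finset.mem_image]
    exact exists_congr fun q => by rw [sub_eq_iff_eq_add]; rfl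
  have hinj : Function.Injective fun q : Fin M × Fin M => u - latticeProj N (offset (.inl q)) :=
    fun q q' h => Sum.inl_injective
      (place_injective hMN 0 (congrArg (0 + ·) (sub_right_injective (b := u) h)))
  calc ∑ p, (squareAt (M := M) hMN p).inside u
      = (Finset.univ.filter fun p => ∃ q, u = (squareAt (M := M) hMN p).ι (.inl q)).card := by
        rw [Finset.card_filter]
        exact Finset.sum_congr rfl fun p _ => by unfold Realization.inside; congr
    _ = M ^ 2 := by
        rw [hpos, Finset.card_image_of_injective _ hinj]
        simp [sq]

end Embedding

/-! ### Transport by the pieces of a path -/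

section Transport

variable {M : ℕ}

namespace Transport

lemma ent_add (Q Q' : Transport M) (b : Bou M) : (Q + Q').ent b = Q.ent b + Q'.ent b := by
  simp [Transport.ent, Finset.sum_add_distrib]

lemma exi_add (Q Q' : Transport M) (b : Bou M) : (Q + Q').exi b = Q.exi b + Q'.exi b := by
  simp [Transport.exi, Finset.sum_add_distrib]

lemma ent_single (b b' c : Bou M) (t : ℝ≥0) :
    Transport.ent (Pi.single (b, b') t) c = (Pi.single b t : Bou M → ℝ≥0) c := by
  simp [Transport.ent, Pi.single_apply, ite_and]

lemma exi_single (b b' c : Bou M) (t : ℝ≥0) :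
    Transport.exi (Pi.single (b, b') t) c = (Pi.single b' t : Bou M → ℝ≥0) c := by
  simp [Transport.exi, Pi.single_apply, ite_and]

lemma drift_eq_sum (Q : Transport M) :
    Q.drift = (1 / (M : ℝ) ^ 2) • ∑ b, ((Q.exi b : ℝ) - Q.ent b) • b.pos := by
  rw [Transport.drift]
  simp only [Transport.ent, Transport.exi, NNReal.coe_sum, smul_sub, sub_smul, Finset.sum_smul,
    Finset.sum_sub_distrib]
  rw [Finset.sum_comm]

lemma drift_add (Q Q' : Transport M) : (Q + Q').drift = Q.drift + Q'.drift := by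
  simp [Transport.drift, add_smul, Finset.sum_add_distrib]

end Transport

lemma Bou.reflect_eq (b : Bou M) : b.reflect = (b.1.opp, b.2) := by
  obtain ⟨_ | _ | _ | _, j⟩ := b <;> rfl

lemma Bou.reflect_reflect (b : Bou M) : b.reflect.reflect = b := by
  simp only [Bou.reflect_eq, Side.opp_opp]

lemma mem_compatible_iff (Q : Transport M) :
    Q ∈ compatible M ↔ ∀ b : Bou M, Q.exi b.reflect = Q.ent b := by
  refine forall_congr' fun b => ?_
  have hfiber : (Finset.univ.filter fun b' : Bou M => b'.reflect = b) = {b.reflect} := by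
    ext b'
    simp only [Finset.mem_filter, Finset.mem_univ, true_and, Finset.mem_singleton]
    exact Function.Involutive.eq_iff Bou.reflect_reflect
  rw [hfiber, Finset.sum_singleton]

lemma add_mem_compatible {Q Q' : Transport M} (hQ : Q ∈ compatible M) (hQ' : Q' ∈ compatible M) :
    Q + Q' ∈ compatible M := by
  rw [mem_compatible_iff] at *
  exact fun b => by rw [Transport.exi_add, Transport.ent_add, hQ, hQ']

lemma Side.sum_eq {A : Type*} [AddCommMonoid A] (f : Side → A) :
    ∑ s, f s = f .left + (f .right + (f .bottom + f .top)) := by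
  change ∑ s ∈ {.left, .right, .bottom, .top}, f s = _
  rw [Finset.sum_insert (by simp), Finset.sum_insert (by simp), Finset.sum_insert (by simp),
    Finset.sum_singleton]

lemma reachable_extSquare (z z' : SqVertex M) : (extSquare M).Reachable z z' := by
  have hgrid := (pathGraph_preconnected M).boxProd (pathGraph_preconnected M)
  let inl : ((pathGraph M).boxProd (pathGraph M)) →g extSquare M := ⟨Sum.inl, fun h => h⟩
  have reachable_inl : ∀ z : SqVertex M, ∃ q, (extSquare M).Reachable z (.inl q) := by
    rintro (q | b)
    · exact ⟨q, .refl _⟩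
    · exact ⟨attach b, (extSquare_adj_attach b).reachable⟩
  obtain ⟨q, hq⟩ := reachable_inl z
  obtain ⟨q', hq'⟩ := reachable_inl z'
  exact hq.trans (((hgrid q q').map inl).trans hq'.symm)

variable [NeZero M]

/-- The first boundary point of a side. -/
def corner (s : Side) : Bou M := (s, 0)

lemma single_corner_reflect (s : Side) (t : ℝ≥0) (b : Bou M) :
    (Pi.single (corner s) t : Bou M → ℝ≥0) b.reflect =
      (Pi.single (corner s.opp) t : Bou M → ℝ≥0) b := by
  obtain ⟨s', j⟩ := b
  simp only [Bou.reflect_eq, Pi.single_apply, corner, Prod.mk.injEq]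
  cases s <;> cases s' <;> simp [Side.opp]

/-- A transportation measure with drift `(t₁, t₂)` and little mass. -/
def driftMass (t₁ t₂ : ℝ≥0) : Transport M :=
  Pi.single (corner .left, corner .right) (t₁ * M) +
    Pi.single (corner .bottom, corner .top) (t₂ * M)

lemma driftMass_mem_compatible (t₁ t₂ : ℝ≥0) : (driftMass t₁ t₂ : Transport M) ∈ compatible M :=
  (mem_compatible_iff _).2 fun b => by
    simp only [driftMass, Transport.exi_add, Transport.ent_add, Transport.exi_single,
      Transport.ent_single, single_corner_reflect]
    rfl

lemma drift_driftMass (t₁ t₂ : ℝ≥0) :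
    (driftMass t₁ t₂ : Transport M).drift = ((t₁ : ℝ), (t₂ : ℝ)) := by
  have hM : (M : ℝ) ≠ 0 := NeZero.ne _
  have coe_single (b c : Bou M) (t : ℝ≥0) :
      (((Pi.single b t : Bou M → ℝ≥0) c : ℝ≥0) : ℝ) = if c = b then (t : ℝ) else 0 := by
    rw [Pi.single_apply, apply_ite NNReal.toReal, NNReal.coe_zero]
  simp only [Transport.drift_eq_sum, driftMass, Transport.exi_add, Transport.ent_add,
    Transport.exi_single, Transport.ent_single, NNReal.coe_add, coe_single, sub_smul, add_smul,
    Finset.sum_sub_distrib, Finset.sum_add_distrib, ite_smul, zero_smul, Finset.sum_ite_eq',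
    Finset.mem_univ, if_true, corner, Bou.pos]
  ext <;> simp <;> field_simp <;> ring

end Transport

section Pieces

variable {M N : ℕ} [NeZero M] [NeZero N]

lemma exists_pieces (hMN : M + 2 ≤ N) (p : Fin N × Fin N) (σ : FinPath (torus N)) :
    ∃ L : List (FinPath (extSquare M)), IsCut (squareAt hMN p) (corner .left) σ.walk L
      (Pi.single (corner .left) ((squareAt (M := M) hMN p).inside σ.ent))
      (fun _ => (squareAt (M := M) hMN p).inside σ.ent) :=
  exists_isCut _ _ (fun _ => reachable_extSquare _ _) _

/-- The pieces of the path `σ` in the extended square at the position `p`. -/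
def pieces (hMN : M + 2 ≤ N) (p : Fin N × Fin N) (σ : FinPath (torus N)) :
    List (FinPath (extSquare M)) := (exists_pieces hMN p σ).choose

lemma isCut_pieces (hMN : M + 2 ≤ N) (p : Fin N × Fin N) (σ : FinPath (torus N)) :
    IsCut (squareAt hMN p) (corner .left) σ.walk (pieces hMN p σ)
      (Pi.single (corner .left) ((squareAt (M := M) hMN p).inside σ.ent))
      (fun _ => (squareAt (M := M) hMN p).inside σ.ent) := (exists_pieces hMN p σ).choose_spec

/-- The number of pieces with given end points. -/
def pieceTrans (hMN : M + 2 ≤ N) (p : Fin N × Fin N) (σ : FinPath (torus N))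
    (b b' : Bou M) : ℕ := (pieces hMN p σ).countP fun τ => τ.ent = .inr b ∧ τ.exi = .inr b'

lemma sum_pieceTrans_right (hMN : M + 2 ≤ N) (p : Fin N × Fin N) (σ : FinPath (torus N))
    (b : Bou M) : ∑ b', pieceTrans hMN p σ b b' =
      (Pi.single (corner .left) ((squareAt (M := M) hMN p).inside σ.ent) : Bou M → ℕ) b +
        (squareAt hMN p).entries σ.walk b := by
  rw [← (isCut_pieces hMN p σ).ent b]
  refine sum_countP_eq_countP _
    (fun b' (τ : FinPath (extSquare M)) => τ.ent = .inr b ∧ τ.exi = .inr b') _ fun τ hτ => ?_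
  obtain ⟨c, hc⟩ := ((isCut_pieces hMN p σ).boundary τ hτ).2
  simp [hc, ite_and]

lemma sum_pieceTrans_left (hMN : M + 2 ≤ N) (p : Fin N × Fin N) (σ : FinPath (torus N))
    (b : Bou M) : ∑ b', pieceTrans hMN p σ b' b =
      (squareAt hMN p).exits σ.walk b +
        if b = corner .left then (squareAt (M := M) hMN p).inside σ.exi else 0 := by
  rw [← (isCut_pieces hMN p σ).exi b]
  refine sum_countP_eq_countP _
    (fun b' (τ : FinPath (extSquare M)) => τ.ent = .inr b' ∧ τ.exi = .inr b) _ fun τ hτ => ?_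
  obtain ⟨c, hc⟩ := ((isCut_pieces hMN p σ).boundary τ hτ).1
  simp [hc, ite_and]

/-- The transport by the pieces of `σ`, averaged over the positions of the square for a total mass
`N` of paths. The second term compensates for the completion of the first and the last piece. -/
def pathTransport (hMN : M + 2 ≤ N) (σ : FinPath (torus N)) : Transport M :=
  (fun r => (∑ p, (pieceTrans hMN p σ r.1 r.2 : ℝ≥0)) / N) +
    Pi.single (corner .right, corner .right) ((M : ℝ≥0) ^ 2 / N)

lemma ent_pathTransport (hMN : M + 2 ≤ N) (σ : FinPath (torus N)) (b : Bou M) :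
    (pathTransport hMN σ).ent b = steps σ.walk b.1 / N +
      (Pi.single (corner .left) ((M : ℝ≥0) ^ 2 / N) : Bou M → ℝ≥0) b +
      (Pi.single (corner .right) ((M : ℝ≥0) ^ 2 / N) : Bou M → ℝ≥0) b := by
  have hsum : ∑ b', ∑ p, pieceTrans hMN p σ b b' =
      steps σ.walk b.1 + if b = corner .left then M ^ 2 else 0 := by
    rw [Finset.sum_comm]
    simp only [sum_pieceTrans_right, Finset.sum_add_distrib, sum_entries, Pi.single_apply]
    split_ifs <;> simp [sum_inside, add_comm]
  rw [pathTransport, Transport.ent_add, Transport.ent_single, Transport.ent, ← Finset.sum_div]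
  congr 1
  rw [Pi.single_apply, ← zero_div (N : ℝ≥0), ← ite_div, ← add_div]
  congr 1
  exact_mod_cast hsum

lemma exi_pathTransport (hMN : M + 2 ≤ N) (σ : FinPath (torus N)) (b : Bou M) :
    (pathTransport hMN σ).exi b = steps σ.walk b.1.opp / N +
      (Pi.single (corner .left) ((M : ℝ≥0) ^ 2 / N) : Bou M → ℝ≥0) b +
      (Pi.single (corner .right) ((M : ℝ≥0) ^ 2 / N) : Bou M → ℝ≥0) b := by
  have hsum : ∑ b', ∑ p, pieceTrans hMN p σ b' b =
      steps σ.walk b.1.opp + if b = corner .left then M ^ 2 else 0 := by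
    rw [Finset.sum_comm]
    simp only [sum_pieceTrans_left, Finset.sum_add_distrib, sum_exits]
    split_ifs <;> simp [sum_inside]
  rw [pathTransport, Transport.exi_add, Transport.exi_single, Transport.exi, ← Finset.sum_div]
  congr 1
  rw [Pi.single_apply, ← zero_div (N : ℝ≥0), ← ite_div, ← add_div]
  congr 1
  exact_mod_cast hsum

lemma pathTransport_mem_compatible (hMN : M + 2 ≤ N) (σ : FinPath (torus N)) :
    pathTransport hMN σ ∈ compatible M :=
  (mem_compatible_iff _).2 fun b => by
    rw [exi_pathTransport, ent_pathTransport, single_corner_reflect, single_corner_reflect,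
      Bou.reflect_eq, Side.opp_opp]
    exact add_right_comm _ _ _

theorem drift_pathTransport (hMN : M + 2 ≤ N) (σ : FinPath (torus N)) :
    (pathTransport hMN σ).drift =
      (((winding σ.walk).1 : ℝ) / N, ((winding σ.walk).2 : ℝ) / N) := by
  have hM : (M : ℝ) ≠ 0 := NeZero.ne _
  have hflux : ∀ b : Bou M, ((pathTransport hMN σ).exi b : ℝ) - (pathTransport hMN σ).ent b =
      ((steps σ.walk b.1.opp : ℝ) - steps σ.walk b.1) / N := by
    intro b
    rw [exi_pathTransport, ent_pathTransport]
    push_cast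
    ring
  rw [Transport.drift_eq_sum]
  simp only [hflux, Fintype.sum_prod_type, Side.sum_eq, winding, Side.opp, Side.inward, Bou.pos]
  ext <;> simp [Prod.fst_sum, Prod.snd_sum, ← Finset.mul_sum] <;> field_simp <;> ring

end Pieces

/-! ### Isotropy of the flow across a square in a random position -/

section Cells

variable {N : ℕ}

/-- The `k`-th of the `N` subintervals of `[0, 1)` of length `N⁻¹`. -/
def subinterval (k : Fin N) : Set ℝ := Set.Ico ((k : ℝ) / N) ((k + 1) / N)

/-- The square of side length `N⁻¹` with lower left corner `d / N`. -/
def cell (d : Fin N × Fin N) : Set (ℝ × ℝ) := subinterval d.1 ×ˢ subinterval d.2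

/-- The distance by which `a` exceeds `k / N`. -/
def excess (k : Fin N) (a : ℝ) : ℝ≥0 := (a - k / N).toNNReal

lemma measurableSet_cell (d : Fin N × Fin N) : MeasurableSet (cell d) :=
  measurableSet_Ico.prod measurableSet_Ico

lemma measurable_excess (k : Fin N) : Measurable (excess k) := by
  unfold excess
  fun_prop

lemma volume_subinterval (k : Fin N) : volume (subinterval k) = ((N : ℝ≥0)⁻¹ : ℝ≥0) := by
  rw [subinterval, Real.volume_Ico, ← sub_div, add_sub_cancel_left, one_div,
    ← ENNReal.ofReal_coe_nnreal]
  push_cast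
  rfl

lemma volume_cell (d : Fin N × Fin N) : volume (cell d) = (((N : ℝ≥0) ^ 2)⁻¹ : ℝ≥0) := by
  rw [cell, Measure.volume_eq_prod, Measure.prod_prod, volume_subinterval, volume_subinterval,
    ← ENNReal.coe_mul, sq, mul_inv]

variable [NeZero N]

lemma mem_subinterval_iff {k : Fin N} {a : ℝ} : a ∈ subinterval k ↔ ⌊a * N⌋ = (k : ℕ) := by
  have hN : (0 : ℝ) < N := Nat.cast_pos.2 (NeZero.pos N)
  rw [Int.floor_eq_iff, subinterval, Set.mem_Ico, div_le_iff₀ hN, lt_div_iff₀ hN, Int.cast_natCast]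

lemma iUnion_subinterval : ⋃ k : Fin N, subinterval k = Set.Ico (0 : ℝ) 1 := by
  have hN : (0 : ℝ) < N := Nat.cast_pos.2 (NeZero.pos N)
  ext a
  simp only [Set.mem_iUnion, mem_subinterval_iff, Set.mem_Ico]
  constructor
  · rintro ⟨k, hk⟩
    obtain ⟨hle, hlt⟩ := Int.floor_eq_iff.1 hk
    have hkN : ((k : ℕ) : ℝ) + 1 ≤ N := mod_cast k.2
    rw [Int.cast_natCast] at hle hlt
    exact ⟨nonneg_of_mul_nonneg_left ((Nat.cast_nonneg _).trans hle) hN,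
      (mul_lt_iff_lt_one_left hN).1 (hlt.trans_le hkN)⟩
  · rintro ⟨hnonneg, hlt⟩
    have hfloor : (0 : ℤ) ≤ ⌊a * N⌋ := Int.floor_nonneg.2 (by positivity)
    have hfloor_lt : ⌊a * N⌋ < N := Int.floor_lt.2 (by simpa using mul_lt_of_lt_one_left hN hlt)
    exact ⟨⟨⌊a * N⌋.toNat, by omega⟩, by simp [hfloor]⟩

lemma iUnion_cell : ⋃ d : Fin N × Fin N, cell d = Set.Ico (0 : ℝ) 1 ×ˢ Set.Ico (0 : ℝ) 1 := by
  rw [← iUnion_subinterval (N := N)]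
  ext a
  simp [cell, Set.mem_prod]

lemma pairwise_disjoint_cell : Pairwise (Function.onFun Disjoint (cell (N := N))) := by
  refine fun d d' hd => Set.disjoint_left.2 fun a ha ha' => hd ?_
  simp only [cell, Set.mem_prod, mem_subinterval_iff] at ha ha'
  exact Prod.ext (Fin.ext (by omega)) (Fin.ext (by omega))

lemma sum_restrict_cell : ∑ d : Fin N × Fin N, (volume : Measure (ℝ × ℝ)).restrict (cell d) =
    volume.restrict (Set.Ico (0 : ℝ) 1 ×ˢ Set.Ico (0 : ℝ) 1) := by
  rw [← iUnion_cell (N := N), Measure.restrict_iUnion pairwise_disjoint_cell measurableSet_cell,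
    Measure.sum_fintype]

lemma lintegral_excess (k : Fin N) :
    ∫⁻ a in subinterval k, excess k a = ((2 * (N : ℝ≥0) ^ 2)⁻¹ : ℝ≥0) := by
  have hN : (0 : ℝ) < N := Nat.cast_pos.2 (NeZero.pos N)
  have hle : (k : ℝ) / N ≤ (k + 1) / N := by gcongr; simp
  have hint : ∫ a in subinterval k, (a - k / N) = (2 * (N : ℝ) ^ 2)⁻¹ := by
    rw [subinterval, integral_Ico_eq_integral_Ioc, ← intervalIntegral.integral_of_le hle,
      intervalIntegral.integral_comp_sub_right fun a => a]
    rw [integral_id]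
    field_simp
    ring
  have hintegrable : IntegrableOn (fun a : ℝ => a - k / N) (subinterval k) :=
    (continuous_id.sub continuous_const).continuousOn.integrableOn_Icc.mono_set
      Set.Ico_subset_Icc_self
  have hnonneg : 0 ≤ᵐ[volume.restrict (subinterval k)] fun a : ℝ => a - k / N :=
    ae_restrict_of_forall_mem measurableSet_Ico fun a ha => sub_nonneg.2 ha.1
  rw [← ENNReal.ofReal_coe_nnreal]
  push_cast
  rw [← hint, ofReal_integral_eq_lintegral_ofReal hintegrable hnonneg]
  rfl

lemma lintegral_excess_fst (d : Fin N × Fin N) :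
    ∫⁻ a in cell d, excess d.1 a.1 = ((2 * (N : ℝ≥0) ^ 3)⁻¹ : ℝ≥0) := by
  have hm := (measurable_excess d.1).coe_nnreal_ennreal
  rw [cell, Measure.volume_eq_prod, ← Measure.prod_restrict,
    ← lintegral_map (f := fun t => (excess d.1 t : ℝ≥0∞)) hm measurable_fst, Measure.map_fst_prod,
    lintegral_smul_measure, lintegral_excess, Measure.restrict_apply_univ, volume_subinterval,
    smul_eq_mul, ← ENNReal.coe_mul, ← mul_inv]
  congr 2
  ring

lemma lintegral_excess_snd (d : Fin N × Fin N) :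
    ∫⁻ a in cell d, excess d.2 a.2 = ((2 * (N : ℝ≥0) ^ 3)⁻¹ : ℝ≥0) := by
  have hm := (measurable_excess d.2).coe_nnreal_ennreal
  rw [cell, Measure.volume_eq_prod, ← Measure.prod_restrict,
    ← lintegral_map (f := fun t => (excess d.2 t : ℝ≥0∞)) hm measurable_snd, Measure.map_snd_prod,
    lintegral_smul_measure, lintegral_excess, Measure.restrict_apply_univ, volume_subinterval,
    smul_eq_mul, ← ENNReal.coe_mul, ← mul_inv]
  congr 2
  ring

end Cells

section Displacement

variable {N : ℕ} [NeZero N]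

/-- The displacement of a path in the torus. -/
def displacement (σ : FinPath (torus N)) : Fin N × Fin N := σ.exi - σ.ent

lemma displacement_eq_iff (σ : FinPath (torus N)) (d : Fin N × Fin N) :
    displacement σ = d ↔ σ.exi = σ.ent + d := by
  rw [displacement, sub_eq_iff_eq_add']

/-- The simple flow `x` moves the mass `N⁻³` between any two vertices of the torus. -/
def IsGlobal (x : SimpleFlow (torus N)) : Prop := ∀ v w, x.trans v w = ((N : ℝ≥0) ^ 3)⁻¹

namespace IsGlobal

variable {x : SimpleFlow (torus N)} (hx : IsGlobal x)

include hx

lemma sum_displacement_eq (d : Fin N × Fin N) :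
    ∑ σ, (if displacement σ.1 = d then x σ else 0) = (N : ℝ≥0)⁻¹ := by
  have hN : (N : ℝ≥0) ≠ 0 := NeZero.ne _
  calc ∑ σ, (if displacement σ.1 = d then x σ else 0)
      = ∑ v, x.trans v (v + d) := by
        simp only [SimpleFlow.trans]
        rw [Finset.sum_comm]
        simp [displacement_eq_iff, ite_and]
    _ = (N : ℝ≥0)⁻¹ := by
        simp only [hx _ _, Finset.sum_const, Finset.card_univ, Fintype.card_prod, Fintype.card_fin,
          nsmul_eq_mul, Nat.cast_mul]
        field_simp

lemma sum_smul_displacement {A : Type*} [AddCommMonoid A] [Module ℝ≥0 A]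
    (f : Fin N × Fin N → A) : ∑ σ, (x σ * N) • f (displacement σ.1) = ∑ d, f d := by
  have hN : (N : ℝ≥0) ≠ 0 := NeZero.ne _
  calc ∑ σ, (x σ * N) • f (displacement σ.1)
      = ∑ d, ((∑ σ, if displacement σ.1 = d then x σ else 0) * N) • f d := by
        simp only [Finset.sum_mul, Finset.sum_smul]
        rw [Finset.sum_comm]
        simp [ite_mul, ite_smul]
    _ = ∑ d, f d := by simp [hx.sum_displacement_eq, inv_mul_cancel₀ hN]

lemma sum_eq : ∑ σ, x σ = N := by
  have hN : (N : ℝ≥0) ≠ 0 := NeZero.ne _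
  have hsum := hx.sum_smul_displacement fun _ => (1 : ℝ≥0)
  simp only [smul_eq_mul, mul_one, ← Finset.sum_mul, Finset.sum_const, Finset.card_univ,
    Fintype.card_prod, Fintype.card_fin, nsmul_eq_mul, Nat.cast_mul] at hsum
  exact mul_right_cancel₀ hN hsum

end IsGlobal

end Displacement

section Isotropy

variable {M N : ℕ}

lemma measurable_driftMod : Measurable (Transport.driftMod (M := M)) := by
  have hdrift : Measurable (Transport.drift (M := M)) := by
    unfold Transport.drift
    fun_prop
  exact (measurable_fract.comp hdrift.fst).prodMk (measurable_fract.comp hdrift.snd)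

lemma measurableSet_compatible : MeasurableSet (compatible M) := by
  simp only [compatible, Set.ofPred_forall, Transport.exi, Transport.ent]
  exact MeasurableSet.iInter fun b => measurableSet_eq_fun (by fun_prop) (by fun_prop)

variable [NeZero M]

lemma driftMass_apply (t₁ t₂ : ℝ≥0) (r : Bou M × Bou M) : (driftMass t₁ t₂ : Transport M) r =
    t₁ * (driftMass 1 0 : Transport M) r + t₂ * (driftMass 0 1 : Transport M) r := by
  simp [driftMass, Pi.single_apply]

variable [NeZero N]

/-- The transport by the pieces of `σ`, with its drift corrected to `a` modulo `(1, 1)`. -/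
def correctedTransport (hMN : M + 2 ≤ N) (σ : FinPath (torus N)) (a : ℝ × ℝ) : Transport M :=
  pathTransport hMN σ + driftMass (excess (displacement σ).1 a.1) (excess (displacement σ).2 a.2)

variable (hMN : M + 2 ≤ N) (σ : FinPath (torus N))

lemma measurable_correctedTransport : Measurable (correctedTransport (M := M) hMN σ) := by
  refine measurable_pi_lambda _ fun r => ?_
  simp only [correctedTransport, Pi.add_apply, driftMass_apply (excess _ _)]
  exact measurable_const.add (((measurable_excess _).comp measurable_fst).mul_const _ |>.add
    (((measurable_excess _).comp measurable_snd).mul_const _))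

lemma val_zsmul_one (a : Fin N) : ((a : ℕ) : ℤ) • (1 : Fin N) = a := by
  obtain ⟨n, rfl⟩ := Nat.exists_eq_succ_of_ne_zero (NeZero.ne N)
  rw [natCast_zsmul]
  exact (nsmul_one (A := ZMod (n + 1)) _).trans (ZMod.natCast_zmod_val (n := n + 1) a)

lemma exists_winding_eq (hN : 3 ≤ N) : ∃ k l : ℤ, winding σ.walk =
    (((displacement σ).1 : ℕ) + N * k, ((displacement σ).2 : ℕ) + N * l) := by
  have hproj : latticeProj N (winding σ.walk -
      ((((displacement σ).1 : ℕ) : ℤ), (((displacement σ).2 : ℕ) : ℤ))) = 0 := by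
    rw [map_sub, latticeProj_winding hN, sub_eq_zero]
    simp only [latticeProj, AddMonoidHom.coe_prodMap, Prod.map_apply, zmultiplesHom_apply,
      val_zsmul_one]
    rfl
  obtain ⟨⟨k, hk⟩, l, hl⟩ := (latticeProj_eq_zero_iff_dvd _).1 hproj
  exact ⟨k, l, Prod.ext (sub_eq_iff_eq_add'.1 hk) (sub_eq_iff_eq_add'.1 hl)⟩

lemma fract_add_excess {d : Fin N} {a : ℝ} (ha : a ∈ subinterval d) (k : ℤ) :
    Int.fract (((d : ℕ) + N * k : ℤ) / (N : ℝ) + excess d a) = a := by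
  have hN : (N : ℝ) ≠ 0 := NeZero.ne _
  have hunit : a ∈ Set.Ico (0 : ℝ) 1 := iUnion_subinterval (N := N) ▸ Set.mem_iUnion_of_mem d ha
  have heq : ((d : ℕ) + N * k : ℤ) / (N : ℝ) + excess d a = a + k := by
    rw [excess, Real.coe_toNNReal _ (sub_nonneg.2 ha.1)]
    push_cast
    field_simp
    ring
  rw [heq, Int.fract_add_intCast, Int.fract_eq_self.2 hunit]

lemma driftMod_correctedTransport {a : ℝ × ℝ} (ha : a ∈ cell (displacement σ)) :
    (correctedTransport (M := M) hMN σ a).driftMod = a := by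
  obtain ⟨k, l, hwinding⟩ := exists_winding_eq σ (by have := NeZero.pos M; omega)
  rw [Transport.driftMod, correctedTransport, Transport.drift_add, drift_pathTransport,
    drift_driftMass, hwinding]
  exact Prod.ext (fract_add_excess ha.1 k) (fract_add_excess ha.2 l)

lemma correctedTransport_mem_compatible (a : ℝ × ℝ) :
    correctedTransport hMN σ a ∈ compatible M :=
  add_mem_compatible (pathTransport_mem_compatible hMN σ) (driftMass_mem_compatible _ _)

lemma setLIntegral_correctedTransport (r : Bou M × Bou M) :
    ∫⁻ a in cell (displacement σ), correctedTransport hMN σ a r =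
      (((N : ℝ≥0) ^ 2)⁻¹ * (pathTransport hMN σ r +
        (driftMass (2 * (N : ℝ≥0))⁻¹ (2 * (N : ℝ≥0))⁻¹ : Transport M) r) : ℝ≥0) := by
  have hN : (N : ℝ≥0) ≠ 0 := NeZero.ne _
  have hfst : Measurable fun a : ℝ × ℝ => (excess (displacement σ).1 a.1 : ℝ≥0∞) :=
    ((measurable_excess _).comp measurable_fst).coe_nnreal_ennreal
  have hsnd : Measurable fun a : ℝ × ℝ => (excess (displacement σ).2 a.2 : ℝ≥0∞) :=
    ((measurable_excess _).comp measurable_snd).coe_nnreal_ennreal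
  simp only [correctedTransport, Pi.add_apply, driftMass_apply (excess _ _), ENNReal.coe_add,
    ENNReal.coe_mul]
  rw [lintegral_add_left measurable_const, lintegral_add_left (hfst.mul_const _),
    lintegral_mul_const _ hfst, lintegral_mul_const _ hsnd, setLIntegral_const, volume_cell,
    lintegral_excess_fst, lintegral_excess_snd, driftMass_apply (2 * (N : ℝ≥0))⁻¹]
  norm_cast
  push_cast
  field_simp

/-- The law of the corrected transport by the pieces of a random path of the flow `x`, for a random
point `a` of the cell of its displacement. -/
def mixture (x : SimpleFlow (torus N)) : Measure (Transport M) :=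
  ∑ σ, (x σ * N) • (volume.restrict (cell (displacement σ.1))).map (correctedTransport hMN σ.1)

lemma ae_mixture_mem_compatible (x : SimpleFlow (torus N)) :
    ∀ᵐ Q ∂(mixture (M := M) hMN x), Q ∈ compatible M := by
  rw [mixture, ← Measure.sum_fintype, Measure.ae_sum_iff]
  refine fun σ => Measure.ae_smul_measure ?_ _
  exact (ae_map_iff (p := (· ∈ compatible M)) (measurable_correctedTransport hMN σ.1).aemeasurable
    measurableSet_compatible).2 (.of_forall (correctedTransport_mem_compatible hMN σ.1))

/-- The transport in a square that is completed by the corrections of `pathTransport` and of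
`correctedTransport`. -/
def correction (M N : ℕ) [NeZero M] : Transport M :=
  Pi.single (corner .right, corner .right) ((M : ℝ≥0) ^ 2 / N) +
    driftMass (2 * (N : ℝ≥0))⁻¹ (2 * (N : ℝ≥0))⁻¹

/-- The expected corrected transport by the pieces of the flow `x` in a square in a uniformly random
position. -/
def meanTransport (x : SimpleFlow (torus N)) : Transport M :=
  (fun r => (∑ p, ∑ σ, x σ * (pieceTrans hMN p σ.1 r.1 r.2 : ℝ≥0)) / (N : ℝ≥0) ^ 2) +
    correction M N

namespace IsGlobal

variable {x : SimpleFlow (torus N)} (hx : IsGlobal x)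

include hx

lemma map_mixture : (mixture (M := M) hMN x).map Transport.driftMod =
    volume.restrict (Set.Ico (0 : ℝ) 1 ×ˢ Set.Ico (0 : ℝ) 1) := by
  have hmap (σ : FinPath (torus N)) : ((volume.restrict (cell (displacement σ))).map
      (correctedTransport (M := M) hMN σ)).map Transport.driftMod =
        volume.restrict (cell (displacement σ)) := by
    rw [Measure.map_map measurable_driftMod (measurable_correctedTransport hMN σ)]
    refine (Measure.map_congr ?_).trans Measure.map_id
    exact ae_restrict_of_forall_mem (measurableSet_cell _) fun a ha =>
      driftMod_correctedTransport hMN σ ha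
  rw [mixture, Measure.map_finset_sum measurable_driftMod.aemeasurable]
  simp only [Measure.map_smul, hmap]
  rw [hx.sum_smul_displacement fun d => (volume : Measure (ℝ × ℝ)).restrict (cell d),
    sum_restrict_cell]

lemma isProbabilityMeasure_mixture : IsProbabilityMeasure (mixture (M := M) hMN x) := by
  have : IsProbabilityMeasure ((mixture (M := M) hMN x).map Transport.driftMod) := by
    rw [hx.map_mixture]
    exact ⟨by simp [Measure.volume_eq_prod]⟩
  exact Measure.isProbabilityMeasure_of_map Transport.driftMod

lemma lintegral_mixture (r : Bou M × Bou M) :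
    ∫⁻ Q, (Q r : ℝ≥0∞) ∂mixture (M := M) hMN x = meanTransport hMN x r := by
  have hN : (N : ℝ≥0) ≠ 0 := NeZero.ne _
  have hr : Measurable fun Q : Transport M => (Q r : ℝ≥0∞) :=
    (measurable_pi_apply r).coe_nnreal_ennreal
  rw [mixture, lintegral_finsetSum_measure]
  simp only [lintegral_smul_measure, lintegral_map hr (measurable_correctedTransport hMN _),
    setLIntegral_correctedTransport, ENNReal.smul_def, smul_eq_mul, ← ENNReal.coe_mul,
    ← ENNReal.ofNNReal_finsetSum]
  rw [ENNReal.coe_inj]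
  calc ∑ σ, x σ * N * (((N : ℝ≥0) ^ 2)⁻¹ * (pathTransport hMN σ.1 r +
        (driftMass (2 * (N : ℝ≥0))⁻¹ (2 * (N : ℝ≥0))⁻¹ : Transport M) r))
      = ∑ σ, (x σ * (∑ p, (pieceTrans hMN p σ.1 r.1 r.2 : ℝ≥0)) / (N : ℝ≥0) ^ 2 +
          x σ * ((correction M N r) / N)) := by
        refine Finset.sum_congr rfl fun σ _ => ?_
        simp only [pathTransport, correction, Pi.add_apply]
        field_simp
        ring
    _ = meanTransport hMN x r := by
        rw [Finset.sum_add_distrib, ← Finset.sum_mul, hx.sum_eq, mul_div_cancel₀ _ hN,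
          meanTransport, Pi.add_apply, ← Finset.sum_div]
        simp only [Finset.mul_sum]
        rw [Finset.sum_comm]

theorem isIsotropic_meanTransport : IsIsotropic (meanTransport (M := M) hMN x) :=
  ⟨mixture hMN x, hx.isProbabilityMeasure_mixture hMN, ae_mixture_mem_compatible hMN x,
    fun r => (hx.lintegral_mixture hMN r).symm, hx.map_mixture hMN⟩

end IsGlobal

end Isotropy

/-! ### The environment of a square in a torus -/

section Edges

variable {M N : ℕ}

/-- The neighbour of an internal vertex `q` in the direction that enters squares through the side
`s`. -/
def neighbour (q : Fin M × Fin M) (s : Side) : SqVertex M := (exists_adj_offset_eq q s).choose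

lemma adj_neighbour (q : Fin M × Fin M) (s : Side) :
    (extSquare M).Adj (.inl q) (neighbour q s) := (exists_adj_offset_eq q s).choose_spec.1

lemma offset_neighbour (q : Fin M × Fin M) (s : Side) :
    offset (neighbour q s) = offset (.inl q) + s.inward := (exists_adj_offset_eq q s).choose_spec.2

lemma eq_neighbour {q : Fin M × Fin M} {z : SqVertex M} {s : Side}
    (h : offset z = offset (.inl q) + s.inward) : z = neighbour q s :=
  offset_injective (h.trans (offset_neighbour q s).symm)

/-- The edge from an internal vertex to its neighbour in the direction of `s`. -/
def edgeAt (q : Fin M × Fin M) (s : Side) : (extSquare M).edgeSet :=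
  ⟨s(.inl q, neighbour q s), adj_neighbour q s⟩

lemma exists_edgeAt_eq (e : (extSquare M).edgeSet) : ∃ q s, edgeAt q s = e := by
  obtain ⟨e, he⟩ := e
  induction e using Sym2.ind with | _ z z'
  have hadj : (extSquare M).Adj z z' := he
  rcases z with q | b
  · obtain ⟨s, hs⟩ := exists_offset_eq_of_adj hadj
    exact ⟨q, s, Subtype.ext (congrArg (fun z => s(Sum.inl q, z)) (eq_neighbour hs).symm)⟩
  · obtain rfl := eq_attach_of_adj hadj
    obtain ⟨s, hs⟩ := exists_offset_eq_of_adj hadj.symm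
    exact ⟨attach b, s, Subtype.ext
      ((congrArg (fun z => s(Sum.inl (attach b), z)) (eq_neighbour hs).symm).trans Sym2.eq_swap)⟩

lemma card_edgeSet_le (M : ℕ) : Fintype.card (extSquare M).edgeSet ≤ 4 * M ^ 2 := by
  have hsurj : Function.Surjective fun i : (Fin M × Fin M) × Side => edgeAt i.1 i.2 := fun e =>
    let ⟨q, s, h⟩ := exists_edgeAt_eq e
    ⟨(q, s), h⟩
  refine (Fintype.card_le_of_surjective _ hsurj).trans_eq ?_
  rw [Fintype.card_prod, Fintype.card_prod, Fintype.card_fin, mul_comm, ← sq]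
  rfl

/-- The directions of the steps to the left and downwards. -/
def lowerDirections : Finset Side := {.right, .top}

lemma mem_lowerDirections {s : Side} : s ∈ lowerDirections ↔ s = .right ∨ s = .top := by
  simp [lowerDirections]

lemma opp_mem_lowerDirections {s : Side} : s.opp ∈ lowerDirections ↔ s ∉ lowerDirections := by
  cases s <;> simp [lowerDirections, Side.opp]

lemma isRightTop_of_mem {b : Bou M} (hb : b.1 ∈ lowerDirections) {e : (extSquare M).edgeSet}
    (he : .inr b ∈ (e : Sym2 (SqVertex M))) : IsRightTop e := by
  obtain ⟨s, j⟩ := b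
  rcases mem_lowerDirections.1 hb with rfl | rfl
  · exact ⟨j, .inl he⟩
  · exact ⟨j, .inr he⟩

lemma exists_edgeAt_eq_of_not_isRightTop {e : (extSquare M).edgeSet} (he : ¬ IsRightTop e) :
    ∃ q, ∃ s ∈ lowerDirections, edgeAt q s = e := by
  obtain ⟨q, s, rfl⟩ := exists_edgeAt_eq e
  by_cases hs : s ∈ lowerDirections
  · exact ⟨q, s, hs, rfl⟩
  have hoffset : offset (.inl q) = offset (neighbour q s) + s.opp.inward := by
    rw [offset_neighbour, Side.inward_opp, add_neg_cancel_right]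
  rcases hz : neighbour q s with q' | b
  · rw [hz] at hoffset
    refine ⟨q', s.opp, opp_mem_lowerDirections.2 hs, Subtype.ext ?_⟩
    simp only [edgeAt, ← eq_neighbour hoffset, hz, Sym2.eq_swap]
  · refine absurd (isRightTop_of_mem (b := b) ?_ (hz ▸ Sym2.mem_mk_right _ _)) he
    obtain rfl : q = attach b :=
      Sum.inl_injective (eq_attach_of_adj ((hz ▸ adj_neighbour q s :
        (extSquare M).Adj (.inl q) (.inr b)).symm))
    rw [hz, offset_attach, add_right_inj] at hoffset
    rw [Side.inward_injective hoffset]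
    exact opp_mem_lowerDirections.2 hs

open Classical in
lemma sum_not_isRightTop_le (F : (extSquare M).edgeSet → ℝ≥0) :
    ∑ e, (if IsRightTop e then 0 else F e) ≤ ∑ s ∈ lowerDirections, ∑ q, F (edgeAt q s) := by
  calc ∑ e, (if IsRightTop e then 0 else F e)
      = ∑ e with ¬ IsRightTop e, F e := by
        rw [Finset.sum_filter]
        exact Finset.sum_congr rfl fun e _ => (ite_not _ _ _).symm
    _ ≤ ∑ e ∈ (lowerDirections ×ˢ Finset.univ).image fun i => edgeAt i.2 i.1, F e := by
        refine Finset.sum_le_sum_of_subset fun e he => Finset.mem_image.2 ?_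
        obtain ⟨q, s, hs, rfl⟩ := exists_edgeAt_eq_of_not_isRightTop (Finset.mem_filter.1 he).2
        exact ⟨(s, q), by simp [hs], rfl⟩
    _ ≤ ∑ i ∈ lowerDirections ×ˢ Finset.univ, F (edgeAt i.2 i.1) :=
        Finset.sum_image_le_of_nonneg fun _ _ => zero_le
    _ = ∑ s ∈ lowerDirections, ∑ q, F (edgeAt q s) := Finset.sum_product _ _ _

variable [NeZero N]

/-- The edge of the torus that corresponds to an edge of the square at the position `p`. -/
def placeEdge (hMN : M + 2 ≤ N) (p : Fin N × Fin N) (e : (extSquare M).edgeSet) :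
    (torus N).edgeSet :=
  ⟨Sym2.map (place p) (e : Sym2 (SqVertex M)), by
    obtain ⟨e, he⟩ := e
    induction e using Sym2.ind with | _ z z'
    exact (squareAt hMN p).hom he⟩

lemma placeEdge_injective (hMN : M + 2 ≤ N) (p : Fin N × Fin N) :
    Function.Injective (placeEdge (M := M) hMN p) := fun _ _ h =>
  Subtype.ext (Sym2.map.injective (place_injective hMN p) (congrArg Subtype.val h))

/-- The edge of the torus from `u` in the direction of `s`. -/
def torusEdgeAt (hN : 2 ≤ N) (s : Side) (u : Fin N × Fin N) : (torus N).edgeSet :=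
  ⟨s(u, u + latticeProj N s.inward), (torus_adj_iff_exists_inward hN).2 ⟨s, rfl⟩⟩

lemma placeEdge_edgeAt (hMN : M + 2 ≤ N) (p : Fin N × Fin N) (q : Fin M × Fin M) (s : Side) :
    placeEdge hMN p (edgeAt q s) =
      torusEdgeAt (by omega) s (p + latticeProj N (offset (.inl q))) :=
  Subtype.ext (congrArg (fun u => s(place p (.inl q), u))
    (place_of_offset_eq (offset_neighbour q s)))

lemma torusEdgeAt_injOn (hN : 3 ≤ N) : Set.InjOn
    (fun i : Side × (Fin N × Fin N) => torusEdgeAt (by omega) i.1 i.2)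
      ((lowerDirections ×ˢ Finset.univ : Finset (Side × (Fin N × Fin N))) : Set _) := by
  rintro ⟨s, u⟩ hs ⟨s', u'⟩ hs' heq
  simp only [Finset.coe_product, Set.mem_prod, Finset.mem_coe] at hs hs'
  rcases Sym2.eq_iff.1 (congrArg Subtype.val heq) with ⟨rfl, hstep⟩ | ⟨rfl, hstep⟩
  · exact Prod.ext (latticeProj_inward_injective hN (add_left_cancel hstep)) rfl
  · have hopp : s = s'.opp := by
      refine latticeProj_inward_injective hN ?_
      rw [add_assoc, add_eq_left] at hstep
      simpa only [Side.inward_opp, map_neg] using eq_neg_of_add_eq_zero_right hstep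
    exact absurd hs'.1 (opp_mem_lowerDirections.1 (hopp ▸ hs.1))

open Classical in
lemma sum_placeEdge_le (hN : 3 ≤ N) (hMN : M + 2 ≤ N) (F : (torus N).edgeSet → ℝ≥0) :
    ∑ p, ∑ e : (extSquare M).edgeSet, (if IsRightTop e then 0 else F (placeEdge hMN p e)) ≤
      M ^ 2 * ∑ e, F e := by
  calc ∑ p, ∑ e : (extSquare M).edgeSet, (if IsRightTop e then 0 else F (placeEdge hMN p e))
      ≤ ∑ p, ∑ s ∈ lowerDirections, ∑ q, F (placeEdge hMN p (edgeAt q s)) :=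
        Finset.sum_le_sum fun p _ => sum_not_isRightTop_le fun e => F (placeEdge hMN p e)
    _ = ∑ s ∈ lowerDirections, ∑ q : Fin M × Fin M,
          ∑ p, F (torusEdgeAt (by omega) s (p + latticeProj N (offset (.inl q)))) := by
        rw [Finset.sum_comm]
        refine Finset.sum_congr rfl fun s _ => ?_
        rw [Finset.sum_comm]
        simp only [placeEdge_edgeAt]
    _ = ∑ s ∈ lowerDirections, ∑ _q : Fin M × Fin M, ∑ u, F (torusEdgeAt (by omega) s u) :=
        Finset.sum_congr rfl fun s _ => Finset.sum_congr rfl fun q _ =>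
          Equiv.sum_comp (Equiv.addRight (latticeProj N (offset (.inl q))))
            fun u => F (torusEdgeAt (by omega) s u)
    _ = M ^ 2 * ∑ i ∈ lowerDirections ×ˢ Finset.univ, F (torusEdgeAt (by omega) i.1 i.2) := by
        simp only [Finset.sum_product, Finset.mul_sum, Finset.sum_const, Finset.card_univ,
          Fintype.card_prod, Fintype.card_fin, nsmul_eq_mul, Nat.cast_mul, sq]
    _ = M ^ 2 * ∑ e ∈ (lowerDirections ×ˢ Finset.univ).image
          fun i => torusEdgeAt (by omega) i.1 i.2, F e := by
        rw [Finset.sum_image (torusEdgeAt_injOn hN)]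
    _ ≤ M ^ 2 * ∑ e, F e := by
        gcongr
        exact Finset.subset_univ _

end Edges

lemma map_pi_comp_injective {ι ι' E E' : Type*} [Fintype ι] [Fintype ι'] [MeasurableSpace E]
    [MeasurableSpace E'] (μ : ι → Measure E) [∀ i, IsProbabilityMeasure (μ i)] {g : ι' → ι}
    (hg : Function.Injective g) {φ : ι' → E → E'} (hφ : ∀ i, Measurable (φ i)) :
    (Measure.pi μ).map (fun c i => φ i (c (g i))) = Measure.pi fun i => (μ (g i)).map (φ i) := by
  have hindep := ((ProbabilityTheory.iIndepFun_pi (μ := μ) (X := fun _ t => t)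
    fun _ => aemeasurable_id).precomp hg).comp φ hφ
  have hmap (i : ι') : (Measure.pi μ).map (φ i ∘ fun c => c (g i)) = (μ (g i)).map (φ i) := by
    rw [← Measure.map_map (hφ i) (measurable_pi_apply (g i)),
      (measurePreserving_eval μ (g i)).map_eq]
  simp only [← hmap]
  exact (ProbabilityTheory.iIndepFun_iff_map_fun_eq_pi_map fun i =>
    ((hφ i).comp (measurable_pi_apply (g i))).aemeasurable).1 hindep

section SquareEnv

variable {M N : ℕ} [NeZero N]

open Classical in
/-- The environment on the extended square at the position `p`. -/
def squareEnv (hMN : M + 2 ≤ N) (p : Fin N × Fin N) (c : Environment (torus N)) :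
    Environment (extSquare M) := fun e => if IsRightTop e then 0 else c (placeEdge hMN p e)

lemma measurable_squareEnv (hMN : M + 2 ≤ N) (p : Fin N × Fin N) :
    Measurable (squareEnv (M := M) hMN p) := by
  refine measurable_pi_lambda _ fun e => ?_
  unfold squareEnv
  split_ifs <;> fun_prop

instance (κ : Measure ℝ≥0) [IsProbabilityMeasure κ] : IsProbabilityMeasure (torusLaw κ N) := by
  unfold torusLaw
  infer_instance

lemma map_squareEnv (κ : Measure ℝ≥0) [IsProbabilityMeasure κ] (hMN : M + 2 ≤ N)
    (p : Fin N × Fin N) : (torusLaw κ N).map (squareEnv (M := M) hMN p) = squareLaw κ M := by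
  classical
  have hm (e : (extSquare M).edgeSet) :
      Measurable fun t : ℝ≥0 => if IsRightTop e then 0 else t := by
    split_ifs <;> fun_prop
  refine (map_pi_comp_injective (fun _ => κ) (placeEdge_injective (M := M) hMN p) hm).trans ?_
  rw [squareLaw]
  congr 1
  funext e
  split_ifs
  · rw [Measure.map_const, measure_univ, one_smul]
  · exact Measure.map_id

end SquareEnv

/-! ### The flow across a square that is induced by a flow in the torus -/

namespace SimpleFlow

section OfList

variable {V : Type*} [DecidableEq V] [Finite V] {G : SimpleGraph V}

/-- The flow along the paths of a list, after loop deletion. -/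
def ofList (L : List (FinPath G)) : SimpleFlow G := fun τ => (L.map FinPath.simplify).count τ

lemma sum_ofList_mul (L : List (FinPath G)) (φ : SimplePath G → ℝ≥0) :
    ∑ τ, ofList L τ * φ τ = (L.map fun ρ => φ ρ.simplify).sum := by
  simp only [ofList, ← nsmul_eq_mul]
  rw [← Function.comp_def φ, ← List.map_map, Finset.sum_list_map_count]
  refine (Finset.sum_subset (Finset.subset_univ _) fun τ _ hτ => ?_).symm
  rw [List.count_eq_zero.2 fun h => hτ (List.mem_toFinset.2 h), zero_smul]

lemma sum_ofList (L : List (FinPath G)) : ∑ τ, ofList L τ = L.length := by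
  simpa using sum_ofList_mul L fun _ => 1

lemma trans_ofList (L : List (FinPath G)) (v w : V) :
    (ofList L).trans v w = (L.countP fun ρ => ρ.ent = v ∧ ρ.exi = w : ℕ) := by
  rw [trans_eq_sum_mul, sum_ofList_mul]
  simp only [FinPath.simplify_ent, FinPath.simplify_exi]
  induction L with
  | nil => simp
  | cons ρ L ih =>
    rw [List.map_cons, List.sum_cons, ih, List.countP_cons]
    by_cases h : ρ.ent = v ∧ ρ.exi = w
    · simp only [h, and_self, if_true, decide_true, Nat.cast_add, Nat.cast_one, add_comm]
    · simp only [h, if_false, decide_false, Bool.false_eq_true, add_zero, zero_add]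

lemma vol_ofList_le (L : List (FinPath G)) (e : G.edgeSet) :
    (ofList L).vol e ≤ ((L.map fun ρ => ρ.crossings e).sum : ℕ) := by
  rw [vol, sum_ofList_mul, Nat.cast_list_sum, List.map_map]
  exact List.sum_le_sum fun ρ _ => Nat.cast_le.2 (ρ.crossings_simplify_le e)

lemma vol_le_sum (x : SimpleFlow G) (e : G.edgeSet) : x.vol e ≤ ∑ σ, x σ :=
  Finset.sum_le_sum fun σ _ =>
    mul_le_of_le_one_right zero_le (by exact_mod_cast σ.crossings_le_one e)

lemma trans_add (x y : SimpleFlow G) (v w : V) :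
    trans (x + y) v w = x.trans v w + y.trans v w := by
  simp only [trans_eq_sum_mul, Pi.add_apply, add_mul, Finset.sum_add_distrib]

lemma vol_add (x y : SimpleFlow G) (e : G.edgeSet) : vol (x + y) e = x.vol e + y.vol e := by
  simp only [vol, Pi.add_apply, add_mul, Finset.sum_add_distrib]

lemma sum_mul_ent_exi [Fintype V] (x : SimpleFlow G) (f : V → V → ℝ≥0) :
    ∑ σ, x σ * f σ.1.ent σ.1.exi = ∑ v, ∑ w, x.trans v w * f v w := by
  simp only [trans, Finset.sum_mul]
  simp_rw [Finset.sum_comm (t := (Finset.univ : Finset (SimplePath G)))]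
  simp [ite_and]

end OfList

end SimpleFlow

lemma Realization.sum_inside {V I D : Type*} [Fintype V] [Fintype I] {G : SimpleGraph V}
    {H : SimpleGraph (I ⊕ D)} (R : Realization H G) : ∑ v, R.inside v = Fintype.card I := by
  calc ∑ v, R.inside v = ∑ _q : I, 1 :=
        (Fintype.sum_of_injective (fun q => R.ι (.inl q)) (R.inj.comp Sum.inl_injective) _ _
          (fun v hv => R.inside_of_forall_ne fun q hq => hv ⟨q, hq.symm⟩)
          fun q => (R.inside_inl q).symm).symm
    _ = Fintype.card I := by rw [Finset.sum_const, smul_eq_mul, mul_one, Finset.card_univ]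

section Link

variable {M : ℕ}

/-- A path between two boundary points of the extended square. -/
def linkPath (b b' : Bou M) : FinPath (extSquare M) :=
  ⟨.inr b, .inr b', (reachable_extSquare (.inr b) (.inr b')).some⟩

/-- A flow with the transportation measure `Q`. -/
def linkFlow (Q : Transport M) : SimpleFlow (extSquare M) :=
  fun τ => ∑ r, Q r * SimpleFlow.ofList [linkPath r.1 r.2] τ

lemma trans_linkFlow (Q : Transport M) (v w : SqVertex M) :
    ((linkFlow Q).trans v w : ℝ≥0∞) = Q.onVertices v w := by
  have hsum : (linkFlow Q).trans v w =
      ∑ r, Q r * (SimpleFlow.ofList [linkPath r.1 r.2]).trans v w :=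
    SimpleFlow.trans_sum_mul _ _ _ _
  rw [hsum]
  rcases v with q | b <;> rcases w with q' | b' <;>
    simp [SimpleFlow.trans_ofList, linkPath, Transport.onVertices, List.countP_cons,
      ← Prod.ext_iff (y := (_, _))]

lemma sum_linkFlow (Q : Transport M) : ∑ τ, linkFlow Q τ = ∑ r, Q r := by
  simp only [linkFlow]
  rw [Finset.sum_comm]
  simp [← Finset.mul_sum, SimpleFlow.sum_ofList]

lemma sum_correction_le (M N : ℕ) [NeZero M] :
    ∑ r, correction M N r ≤ 2 * ((M : ℝ≥0) ^ 2 / N) := by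
  have hM : (1 : ℝ≥0) ≤ M := by exact_mod_cast NeZero.one_le
  calc ∑ r, correction M N r = (M : ℝ≥0) ^ 2 / N + M / N := by
        simp only [correction, driftMass, Pi.add_apply, Finset.sum_add_distrib,
          Finset.sum_pi_single', Finset.mem_univ, if_true]
        ring
    _ ≤ (M : ℝ≥0) ^ 2 / N + (M : ℝ≥0) ^ 2 / N := by
        gcongr
        exact le_self_pow hM two_ne_zero
    _ = 2 * ((M : ℝ≥0) ^ 2 / N) := (two_mul _).symm

end Link

section SquareFlow

variable {M N : ℕ} [NeZero N]

namespace IsGlobal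

variable {x : SimpleFlow (torus N)} (hx : IsGlobal x)

include hx

lemma sum_mul_ent (f : Fin N × Fin N → ℝ≥0) : ∑ σ, x σ * f σ.1.ent = (∑ u, f u) / N := by
  have hN : (N : ℝ≥0) ≠ 0 := NeZero.ne _
  rw [x.sum_mul_ent_exi fun v _ => f v]
  simp only [hx _ _, Finset.sum_const, Finset.card_univ, Fintype.card_prod, Fintype.card_fin,
    nsmul_eq_mul, ← Finset.mul_sum, Nat.cast_mul]
  field_simp

lemma sum_mul_exi (f : Fin N × Fin N → ℝ≥0) : ∑ σ, x σ * f σ.1.exi = (∑ u, f u) / N := by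
  have hN : (N : ℝ≥0) ≠ 0 := NeZero.ne _
  rw [x.sum_mul_ent_exi fun _ w => f w]
  simp only [hx _ _, Finset.sum_const, Finset.card_univ, Fintype.card_prod, Fintype.card_fin,
    nsmul_eq_mul, ← Finset.mul_sum, Nat.cast_mul]
  field_simp

lemma sum_mul_inside_ent (hMN : M + 2 ≤ N) (p : Fin N × Fin N) :
    ∑ σ, x σ * ((squareAt (M := M) hMN p).inside σ.1.ent : ℝ≥0) = (M : ℝ≥0) ^ 2 / N := by
  rw [hx.sum_mul_ent fun u => ((squareAt (M := M) hMN p).inside u : ℝ≥0), ← Nat.cast_sum,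
    Realization.sum_inside, Fintype.card_prod, Fintype.card_fin, Nat.cast_mul, sq]

lemma sum_mul_inside_exi (hMN : M + 2 ≤ N) (p : Fin N × Fin N) :
    ∑ σ, x σ * ((squareAt (M := M) hMN p).inside σ.1.exi : ℝ≥0) = (M : ℝ≥0) ^ 2 / N := by
  rw [hx.sum_mul_exi fun u => ((squareAt (M := M) hMN p).inside u : ℝ≥0), ← Nat.cast_sum,
    Realization.sum_inside, Fintype.card_prod, Fintype.card_fin, Nat.cast_mul, sq]

end IsGlobal

/-- The edge at a boundary point. -/
def halfEdge (b : Bou M) : (extSquare M).edgeSet :=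
  ⟨s(.inr b, .inl (attach b)), extSquare_adj_attach b⟩

lemma entries_le_crossings (hMN : M + 2 ≤ N) (p : Fin N × Fin N) (σ : FinPath (torus N))
    (b : Bou M) :
    (squareAt hMN p).entries σ.walk b ≤ σ.crossings (placeEdge hMN p (halfEdge b)) := by
  rw [Realization.entries, FinPath.crossings, Walk.edges, List.count, List.countP_map]
  refine List.countP_mono_left fun d _ hd => ?_
  obtain ⟨hfst, hsnd⟩ := of_decide_eq_true hd
  rw [Function.comp_apply, beq_iff_eq]
  exact congrArg₂ (fun u v => s(u, v)) hfst hsnd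

variable [NeZero M]

/-- The flow that consists of the pieces of the flow `x` in the square at the position `p` and of
the correction that makes the transport isotropic on average. -/
def squareFlow (hMN : M + 2 ≤ N) (p : Fin N × Fin N) (x : SimpleFlow (torus N)) :
    SimpleFlow (extSquare M) :=
  (fun τ => ∑ σ, x σ * SimpleFlow.ofList (pieces hMN p σ.1) τ) + linkFlow (correction M N)

lemma measurable_squareFlow (hMN : M + 2 ≤ N) (p : Fin N × Fin N) :
    Measurable (squareFlow (M := M) hMN p) := by
  refine measurable_pi_lambda _ fun τ => ?_
  simp only [squareFlow, Pi.add_apply]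
  fun_prop

variable (hMN : M + 2 ≤ N) (p : Fin N × Fin N)

lemma trans_squareFlow (x : SimpleFlow (torus N)) (v w : SqVertex M) :
    ((squareFlow hMN p x).trans v w : ℝ≥0∞) = Transport.onVertices
      ((fun r => ∑ σ, x σ * (pieceTrans hMN p σ.1 r.1 r.2 : ℝ≥0)) + correction M N) v w := by
  have hzero (hvw : ∀ b b', ¬ (Sum.inr b = v ∧ Sum.inr b' = w)) (σ : FinPath (torus N)) :
      (pieces hMN p σ).countP (fun ρ => ρ.ent = v ∧ ρ.exi = w) = 0 := by
    refine List.countP_eq_zero.2 fun ρ hρ => ?_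
    obtain ⟨⟨b, hb⟩, b', hb'⟩ := (isCut_pieces hMN p σ).boundary ρ hρ
    simpa [hb, hb'] using hvw b b'
  rw [squareFlow, SimpleFlow.trans_add, ENNReal.coe_add, trans_linkFlow, SimpleFlow.trans_sum_mul]
  simp only [SimpleFlow.trans_ofList]
  rcases v with q | b <;> rcases w with q' | b'
  case inr.inr => simp only [Transport.onVertices, Pi.add_apply, pieceTrans, ENNReal.coe_add]
  all_goals
    simp only [hzero (by simp), Transport.onVertices, Nat.cast_zero, mul_zero,
      Finset.sum_const_zero, ENNReal.coe_zero, add_zero]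

lemma vol_ofList_pieces_le (σ : FinPath (torus N)) (e : (extSquare M).edgeSet) :
    (SimpleFlow.ofList (pieces hMN p σ)).vol e ≤
      ((squareAt (M := M) hMN p).inside σ.ent : ℝ≥0) + σ.crossings (placeEdge hMN p e) +
        ((squareAt (M := M) hMN p).inside σ.exi : ℝ≥0) := by
  refine (SimpleFlow.vol_ofList_le _ e).trans ?_
  exact_mod_cast (isCut_pieces hMN p σ).cross e

variable {x : SimpleFlow (torus N)}

lemma IsGlobal.vol_squareFlow_le (hx : IsGlobal x) (e : (extSquare M).edgeSet) :
    (squareFlow hMN p x).vol e ≤ x.vol (placeEdge hMN p e) + 4 * ((M : ℝ≥0) ^ 2 / N) := by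
  rw [squareFlow, SimpleFlow.vol_add, SimpleFlow.vol_sum_mul]
  calc ∑ σ, x σ * (SimpleFlow.ofList (pieces hMN p σ.1)).vol e + (linkFlow (correction M N)).vol e
      ≤ ∑ σ, x σ * (((squareAt (M := M) hMN p).inside σ.1.ent : ℝ≥0) +
          σ.1.crossings (placeEdge hMN p e) + ((squareAt (M := M) hMN p).inside σ.1.exi : ℝ≥0)) +
          2 * ((M : ℝ≥0) ^ 2 / N) := by
        gcongr with σ
        · exact vol_ofList_pieces_le hMN p σ.1 e
        · exact (SimpleFlow.vol_le_sum _ e).trans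
            ((sum_linkFlow _).trans_le (sum_correction_le M N))
    _ = x.vol (placeEdge hMN p e) + 4 * ((M : ℝ≥0) ^ 2 / N) := by
        simp only [mul_add, Finset.sum_add_distrib, hx.sum_mul_inside_ent hMN p,
          hx.sum_mul_inside_exi hMN p, SimpleFlow.vol]
        ring

lemma length_pieces (σ : FinPath (torus N)) : (pieces (M := M) hMN p σ).length =
    (squareAt (M := M) hMN p).inside σ.ent + ∑ b, (squareAt (M := M) hMN p).entries σ.walk b := by
  have hsum := sum_countP_eq_countP (pieces (M := M) hMN p σ)
    (fun (b : Bou M) (ρ : FinPath (extSquare M)) => ρ.ent = .inr b) (fun _ => True) fun ρ hρ => by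
      obtain ⟨b, hb⟩ := ((isCut_pieces hMN p σ).boundary ρ hρ).1
      simp [hb]
  rw [decide_true, List.countP_true] at hsum
  simp only [← hsum, (isCut_pieces hMN p σ).ent, Finset.sum_add_distrib, Finset.sum_pi_single',
    Finset.mem_univ, if_true]

lemma IsGlobal.sum_squareFlow_le (hx : IsGlobal x) {B : ℝ≥0} (hB : ∀ e, x.vol e ≤ B) :
    ∑ τ, squareFlow (M := M) hMN p x τ ≤ (4 * B + 3) * M := by
  have hMN' : (M : ℝ≥0) ^ 2 / N ≤ M := by
    refine div_le_of_le_mul₀ zero_le zero_le ?_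
    rw [sq]
    gcongr
    omega
  calc ∑ τ, squareFlow (M := M) hMN p x τ
      = ∑ σ, x σ * ((pieces (M := M) hMN p σ.1).length : ℝ≥0) + ∑ r, correction M N r := by
        simp only [squareFlow, Pi.add_apply, Finset.sum_add_distrib, sum_linkFlow]
        rw [Finset.sum_comm]
        simp only [← Finset.mul_sum, SimpleFlow.sum_ofList]
    _ ≤ ∑ σ, x σ * (((squareAt (M := M) hMN p).inside σ.1.ent : ℝ≥0) +
          ∑ b : Bou M, (σ.1.crossings (placeEdge hMN p (halfEdge b)) : ℝ≥0)) +
          2 * ((M : ℝ≥0) ^ 2 / N) := by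
        gcongr with σ
        · rw [length_pieces]
          push_cast
          gcongr
          exact entries_le_crossings hMN p σ.1 _
        · exact sum_correction_le M N
    _ = ∑ b : Bou M, x.vol (placeEdge hMN p (halfEdge b)) + 3 * ((M : ℝ≥0) ^ 2 / N) := by
        simp only [mul_add, Finset.sum_add_distrib, hx.sum_mul_inside_ent hMN p, Finset.mul_sum]
        rw [Finset.sum_comm]
        simp only [SimpleFlow.vol]
        ring
    _ ≤ ∑ _b : Bou M, B + 3 * M := by
        gcongr
        exact hB _
    _ = (4 * B + 3) * M := by
        rw [Finset.sum_const, Finset.card_univ, Fintype.card_prod, Fintype.card_fin,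
          show Fintype.card Side = 4 from rfl, nsmul_eq_mul]
        push_cast
        ring

end SquareFlow

/-! ### Measurable choice of almost optimal flows -/

section Selection

lemma exists_measurable_nat_mul_approx {ι : Type*} {δ : ℝ≥0} (hδ : 0 < δ) :
    ∃ r : (ι → ℝ≥0) → ι → ℕ, Measurable r ∧
      ∀ c i, c i ≤ r c i * δ ∧ (r c i : ℝ≥0) * δ ≤ c i + δ := by
  refine ⟨fun c i => ⌈c i / δ⌉₊, measurable_pi_lambda _ fun i => Nat.measurable_ceil.comp
    (by fun_prop), fun c i => ⟨(div_le_iff₀ hδ).1 (Nat.le_ceil _), ?_⟩⟩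
  calc (⌈c i / δ⌉₊ : ℝ≥0) * δ ≤ (c i / δ + 1) * δ := by
        gcongr
        exact (Nat.ceil_lt_add_one zero_le).le
    _ = c i + δ := by rw [add_mul, div_mul_cancel₀ _ hδ.ne', one_mul]

lemma nncost_mono {V : Type*} {G : SimpleGraph V} [Fintype G.edgeSet] (f : G.edgeSet → ℝ≥0) :
    Monotone (nncost f) := fun _ _ h => Finset.sum_le_sum fun e _ => by gcongr; exact h e

variable {V : Type*} [DecidableEq V] [Finite V] {G : SimpleGraph V} [Fintype G.edgeSet]

-- After rounding, only countably many environments occur, so no measurable selection theorem is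
-- needed.
theorem exists_measurable_feasible {T : V → V → ℝ≥0∞} {B : ℝ≥0} {c₀ : Environment G}
    (hfin : minCost T B c₀ ≠ ∞) {η : ℝ≥0} (hη : 0 < η) :
    ∃ x : Environment G → SimpleFlow G, Measurable x ∧ ∀ c, (x c).Feasible T B ∧
      (nncost (x c).vol c : ℝ≥0∞) ≤ minCost T B c + η := by
  set K : ℝ≥0 := Fintype.card G.edgeSet * B ^ 2 + 1
  set δ : ℝ≥0 := η / 2 / K
  have hK : 0 < K := by positivity
  have hδK : (∑ _e : G.edgeSet, δ) * B ^ 2 ≤ η / 2 := by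
    calc (∑ _e : G.edgeSet, δ) * B ^ 2 = δ * (Fintype.card G.edgeSet * B ^ 2) := by
          rw [Finset.sum_const, Finset.card_univ, nsmul_eq_mul]
          ring
      _ ≤ δ * K := by gcongr; exact le_self_add
      _ = η / 2 := div_mul_cancel₀ _ hK.ne'
  have hδ : 0 < δ := by positivity
  obtain ⟨r, hr, hround⟩ := exists_measurable_nat_mul_approx (ι := G.edgeSet) hδ
  choose y hy hcost using fun k : G.edgeSet → ℕ => exists_feasible_nncost_le
    (minCost_ne_top_of_ne_top hfin (c' := fun e => (k e : ℝ≥0) * δ)) (half_pos hη)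
  refine ⟨fun c => y (r c), (Measurable.of_discrete (f := y)).comp hr, fun c => ⟨hy _, ?_⟩⟩
  calc (nncost (y (r c)).vol c : ℝ≥0∞)
      ≤ nncost (y (r c)).vol fun e => (r c e : ℝ≥0) * δ :=
        ENNReal.coe_le_coe.2 (nncost_mono _ fun e => (hround c e).1)
    _ ≤ minCost T B c + ((∑ _e : G.edgeSet, δ) * B ^ 2 : ℝ≥0) + (η / 2 : ℝ≥0) := by
        refine (hcost (r c)).trans ?_
        gcongr
        exact minCost_le_add T B fun e => (hround c e).2
    _ ≤ minCost T B c + (η / 2 : ℝ≥0) + (η / 2 : ℝ≥0) := by gcongr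
    _ = minCost T B c + η := by rw [add_assoc, ← ENNReal.coe_add, add_halves]

end Selection

/-! ### Expected flows -/

namespace SimpleFlow

variable {V Ω : Type*} [MeasurableSpace Ω] {G : SimpleGraph V}

/-- The expectation of a random flow. It is meant for flows of bounded mass; weights with infinite
expectation get the value `0`. -/
def mean (P : Measure Ω) (x : Ω → SimpleFlow G) : SimpleFlow G := fun σ => (∫⁻ ω, x ω σ ∂P).toNNReal

variable [Finite V] {P : Measure Ω} [IsProbabilityMeasure P] {x : Ω → SimpleFlow G}

lemma lintegral_sum_mul (hx : Measurable x) {m : ℝ≥0} (hmass : ∀ ω, ∑ σ, x ω σ ≤ m)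
    (a : SimplePath G → ℝ≥0) :
    ∫⁻ ω, (∑ σ, x ω σ * a σ : ℝ≥0) ∂P = (∑ σ, mean P x σ * a σ : ℝ≥0) := by
  have hcoe (σ : SimplePath G) : (mean P x σ : ℝ≥0∞) = ∫⁻ ω, x ω σ ∂P := by
    refine ENNReal.coe_toNNReal (ne_top_of_le_ne_top (ENNReal.coe_ne_top (r := m)) ?_)
    calc ∫⁻ ω, x ω σ ∂P ≤ ∫⁻ _, m ∂P := lintegral_mono fun ω => ENNReal.coe_le_coe.2
          ((Finset.single_le_sum (fun _ _ => zero_le) (Finset.mem_univ σ)).trans (hmass ω))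
      _ = m := by simp
  push_cast
  rw [lintegral_finsetSum _ fun σ _ => by fun_prop]
  refine Finset.sum_congr rfl fun σ _ => ?_
  rw [lintegral_mul_const _ (by fun_prop), hcoe]

end SimpleFlow

lemma IsGlobal.mean {Ω : Type*} [MeasurableSpace Ω] {P : Measure Ω} [IsProbabilityMeasure P] {N : ℕ}
    [NeZero N] {x : Ω → SimpleFlow (torus N)} (hx : Measurable x) (hglobal : ∀ ω, IsGlobal (x ω)) :
    IsGlobal (SimpleFlow.mean P x) := fun v w => by
  have hmean := SimpleFlow.lintegral_sum_mul (P := P) hx (fun ω => (hglobal ω).sum_eq.le)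
    fun σ => if σ.1.ent = v ∧ σ.1.exi = w then 1 else 0
  simp only [← SimpleFlow.trans_eq_sum_mul, hglobal _ v w, lintegral_const, measure_univ,
    mul_one] at hmean
  exact_mod_cast hmean.symm

/-! ### A square in a random position of the torus -/

section RandomPosition

variable {M N : ℕ} [NeZero N] (κ : Measure ℝ≥0)

/-- The law of the environment on the torus together with an independent uniform position. -/
def placedLaw (N : ℕ) [NeZero N] : Measure (Environment (torus N) × (Fin N × Fin N)) :=
  (torusLaw κ N).prod (PMF.uniformOfFintype (Fin N × Fin N)).toMeasure

variable [IsProbabilityMeasure κ]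

instance : IsProbabilityMeasure (placedLaw κ N) := by
  unfold placedLaw
  infer_instance

lemma lintegral_placedLaw {f : Environment (torus N) × (Fin N × Fin N) → ℝ≥0∞}
    (hf : Measurable f) :
    ∫⁻ ω, f ω ∂placedLaw κ N = (∑ p, ∫⁻ c, f (c, p) ∂torusLaw κ N) / (N : ℝ≥0∞) ^ 2 := by
  have hcard : ((Fintype.card (Fin N × Fin N) : ℕ) : ℝ≥0∞) = (N : ℝ≥0∞) ^ 2 := by simp [sq]
  rw [placedLaw, lintegral_prod_symm' _ hf, lintegral_fintype, div_eq_mul_inv, Finset.sum_mul]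
  refine Finset.sum_congr rfl fun p _ => ?_
  rw [PMF.toMeasure_apply_singleton _ _ (measurableSet_singleton p), PMF.uniformOfFintype_apply,
    hcard]

lemma measurable_squareEnv_prod (hMN : M + 2 ≤ N) : Measurable
    fun ω : Environment (torus N) × (Fin N × Fin N) => squareEnv (M := M) hMN ω.2 ω.1 :=
  measurable_from_prod_countable_left fun p => measurable_squareEnv hMN p

lemma map_placedLaw (hMN : M + 2 ≤ N) :
    (placedLaw κ N).map (fun ω => squareEnv (M := M) hMN ω.2 ω.1) = squareLaw κ M := by
  ext s hs
  have hslice (p : Fin N × Fin N) :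
      torusLaw κ N ((·, p) ⁻¹' ((fun ω => squareEnv (M := M) hMN ω.2 ω.1) ⁻¹' s)) =
        squareLaw κ M s := by
    rw [← map_squareEnv κ hMN p, Measure.map_apply (measurable_squareEnv hMN p) hs]
    rfl
  rw [Measure.map_apply (measurable_squareEnv_prod hMN) hs, placedLaw,
    Measure.prod_apply_symm (measurable_squareEnv_prod hMN hs)]
  simp only [hslice, lintegral_const, measure_univ, mul_one]

end RandomPosition

/-! ### Comparison of the square with the torus -/

section PlacedFlow

variable {M N : ℕ} [NeZero N]

lemma sum_nncost_squareEnv_le (hN : 3 ≤ N) (hMN : M + 2 ≤ N) (f : (torus N).edgeSet → ℝ≥0)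
    (c : Environment (torus N)) :
    ∑ p, nncost (fun e => f (placeEdge (M := M) hMN p e)) (squareEnv hMN p c) ≤
      M ^ 2 * nncost f c := by
  simpa only [nncost, squareEnv, ite_mul, zero_mul] using
    sum_placeEdge_le hN hMN fun e => c e * f e ^ 2

lemma measurable_nncost_squareEnv (hMN : M + 2 ≤ N) (p : Fin N × Fin N)
    {y : Environment (torus N) → SimpleFlow (torus N)} (hy : Measurable y) :
    Measurable fun c =>
      nncost (fun e => (y c).vol (placeEdge (M := M) hMN p e)) (squareEnv hMN p c) := by
  have := measurable_squareEnv (M := M) hMN p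
  unfold nncost
  fun_prop

lemma sum_lintegral_nncost_squareEnv_le {P : Measure (Environment (torus N))} (hN : 3 ≤ N)
    (hMN : M + 2 ≤ N) {y : Environment (torus N) → SimpleFlow (torus N)} (hy : Measurable y) :
    ∑ p, ∫⁻ c, nncost (fun e => (y c).vol (placeEdge (M := M) hMN p e)) (squareEnv hMN p c) ∂P ≤
      M ^ 2 * ∫⁻ c, nncost (y c).vol c ∂P := by
  rw [← lintegral_finsetSum _ fun p _ =>
      (measurable_nncost_squareEnv hMN p hy).coe_nnreal_ennreal,
    ← lintegral_const_mul' _ _ (by finiteness)]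
  refine lintegral_mono fun c => ?_
  have hsum := ENNReal.coe_le_coe.2 (sum_nncost_squareEnv_le hN hMN (y c).vol c)
  push_cast at hsum
  exact hsum

/-- A bound for the excess of the cost of the flow across a square at a fixed position over the
cost of the flow in the torus along the same edges. -/
def cutError (cs B : ℝ≥0) (M N : ℕ) : ℝ≥0 :=
  cs * Fintype.card (extSquare M).edgeSet *
    (2 * B * (4 * ((M : ℝ≥0) ^ 2 / N)) + (4 * ((M : ℝ≥0) ^ 2 / N)) ^ 2)

variable [NeZero M]

lemma IsGlobal.nncost_squareFlow_le {x : SimpleFlow (torus N)} (hx : IsGlobal x) (hMN : M + 2 ≤ N)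
    (p : Fin N × Fin N) {B cs : ℝ≥0} (hB : ∀ e, x.vol e ≤ B) {c : Environment (torus N)}
    (hc : ∀ e, c e ≤ cs) :
    nncost (squareFlow hMN p x).vol (squareEnv hMN p c) ≤
      nncost (fun e => x.vol (placeEdge (M := M) hMN p e)) (squareEnv hMN p c) +
        cutError cs B M N := by
  refine nncost_le_of_le_add (fun e => hB _) (hx.vol_squareFlow_le hMN p) fun e => ?_
  unfold squareEnv
  split_ifs
  exacts [zero_le, hc _]

/-- The flow across the square in a random position. -/
def placedFlow (hMN : M + 2 ≤ N) (y : Environment (torus N) → SimpleFlow (torus N))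
    (ω : Environment (torus N) × (Fin N × Fin N)) : SimpleFlow (extSquare M) :=
  squareFlow hMN ω.2 (y ω.1)

variable {κ : Measure ℝ≥0} [IsProbabilityMeasure κ] (hMN : M + 2 ≤ N)
  {y : Environment (torus N) → SimpleFlow (torus N)} (hy : Measurable y)
  (hglobal : ∀ c, IsGlobal (y c))

include hy

lemma measurable_placedFlow : Measurable (placedFlow (M := M) hMN y) :=
  measurable_from_prod_countable_left fun p => (measurable_squareFlow hMN p).comp hy

include hglobal

lemma lintegral_trans_placedFlow (v w : SqVertex M) :
    ∫⁻ ω, (placedFlow hMN y ω).trans v w ∂placedLaw κ N =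
      (meanTransport hMN (SimpleFlow.mean (torusLaw κ N) y)).onVertices v w := by
  simp only [placedFlow, trans_squareFlow]
  rcases v with q | b <;> rcases w with q' | b'
  case inr.inr =>
    have hm : Measurable fun ω : Environment (torus N) × (Fin N × Fin N) =>
        ((∑ σ, y ω.1 σ * (pieceTrans (M := M) hMN ω.2 σ.1 b b' : ℝ≥0) : ℝ≥0) : ℝ≥0∞) :=
      measurable_from_prod_countable_left fun p => by fun_prop
    simp only [Transport.onVertices, Pi.add_apply, ENNReal.coe_add, meanTransport]
    rw [lintegral_add_right _ measurable_const, lintegral_const, measure_univ, mul_one,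
      lintegral_placedLaw κ hm, ENNReal.coe_div (pow_ne_zero 2 (NeZero.ne _))]
    simp only [SimpleFlow.lintegral_sum_mul hy fun c => (hglobal c).sum_eq.le]
    push_cast
    rfl
  all_goals simp only [Transport.onVertices, lintegral_zero]

lemma lintegral_nncost_placedFlow_le (hN : 3 ≤ N) {B cs : ℝ≥0} (hκ : ∀ᵐ t ∂κ, t ≤ cs)
    (hB : ∀ c e, (y c).vol e ≤ B) :
    ∫⁻ ω, nncost (placedFlow (M := M) hMN y ω).vol (squareEnv hMN ω.2 ω.1) ∂placedLaw κ N ≤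
      M ^ 2 * (∫⁻ c, nncost (y c).vol c ∂torusLaw κ N) / (N : ℝ≥0∞) ^ 2 + cutError cs B M N := by
  have hae : ∀ᵐ ω ∂placedLaw κ N, ∀ e, ω.1 e ≤ cs :=
    Measure.quasiMeasurePreserving_fst.ae (ae_pi_forall_le fun _ => hκ)
  have hm : Measurable fun ω : Environment (torus N) × (Fin N × Fin N) =>
      (nncost (fun e => (y ω.1).vol (placeEdge (M := M) hMN ω.2 e))
        (squareEnv hMN ω.2 ω.1) : ℝ≥0∞) :=
    measurable_from_prod_countable_left fun p =>
      (measurable_nncost_squareEnv hMN p hy).coe_nnreal_ennreal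
  calc ∫⁻ ω, nncost (placedFlow (M := M) hMN y ω).vol (squareEnv hMN ω.2 ω.1) ∂placedLaw κ N
      ≤ ∫⁻ ω, nncost (fun e => (y ω.1).vol (placeEdge hMN ω.2 e)) (squareEnv hMN ω.2 ω.1) +
          cutError cs B M N ∂placedLaw κ N := by
        refine lintegral_mono_ae (hae.mono fun ω hω => ?_)
        exact_mod_cast (hglobal ω.1).nncost_squareFlow_le hMN ω.2 (hB ω.1) hω
    _ = (∑ p, ∫⁻ c, nncost (fun e => (y c).vol (placeEdge (M := M) hMN p e)) (squareEnv hMN p c)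
          ∂torusLaw κ N) / (N : ℝ≥0∞) ^ 2 + cutError cs B M N := by
        rw [lintegral_add_right _ measurable_const, lintegral_const, measure_univ, mul_one,
          lintegral_placedLaw κ hm]
    _ ≤ M ^ 2 * (∫⁻ c, nncost (y c).vol c ∂torusLaw κ N) / (N : ℝ≥0∞) ^ 2 +
          cutError cs B M N := by
        gcongr
        exact sum_lintegral_nncost_squareEnv_le hN hMN hy

end PlacedFlow

section Comparison

variable {M N : ℕ} [NeZero N] {κ : Measure ℝ≥0} [IsProbabilityMeasure κ]

lemma exists_isGlobal_lintegral_nncost_le {B : ℝ≥0} (hfin : expTorusCost κ N B ≠ ∞) :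
    ∃ y : Environment (torus N) → SimpleFlow (torus N), Measurable y ∧ (∀ c, IsGlobal (y c)) ∧
      (∀ c e, (y c).vol e ≤ B) ∧
      ∫⁻ c, nncost (y c).vol c ∂torusLaw κ N ≤ expTorusCost κ N B + 1 := by
  obtain ⟨c₀, hc₀⟩ : ∃ c : Environment (torus N), torusCost N B c ≠ ∞ := by
    by_contra! hinfeasible
    simp [expTorusCost, hinfeasible] at hfin
  obtain ⟨y, hy, hopt⟩ := exists_measurable_feasible hc₀ one_pos
  refine ⟨y, hy, fun c v w => ?_, fun c => (hopt c).1.vol_le, ?_⟩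
  · rw [← ENNReal.coe_inj, (hopt c).1.trans_eq, ENNReal.coe_inv (pow_ne_zero 3 (NeZero.ne _))]
    push_cast
    rfl
  · calc ∫⁻ c, nncost (y c).vol c ∂torusLaw κ N ≤ ∫⁻ c, (torusCost N B c + 1) ∂torusLaw κ N :=
          lintegral_mono fun c => (hopt c).2
      _ = expTorusCost κ N B + 1 := by
          rw [lintegral_add_right _ measurable_const, lintegral_one, measure_univ, expTorusCost]

lemma card_sqVertex (M : ℕ) : Fintype.card (SqVertex M) = M * M + 4 * M := by
  simp [show Fintype.card Side = 4 from rfl]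

theorem cInf_le_expTorusCost_add [NeZero M] (hN : 3 ≤ N) (hMN : M + 2 ≤ N) {B cs : ℝ≥0}
    (hκ : ∀ᵐ t ∂κ, t ≤ cs) {B₁ ξ B₂ : ℝ≥0} (hB₁ : B + 4 * ((M : ℝ≥0) ^ 2 / N) ≤ B₁)
    (hξB : ξ ≤ 2 * B₁) {n : ℕ} (hn : 0 < n) {l : ℝ} (hl : 0 < l)
    (hB₂ : (B₁ + ξ : ℝ) + Fintype.card (extSquare M).edgeSet *
      Real.exp (-((ξ : ℝ) ^ 2 * n / (4 * B₁ * ((4 * B + 3) * M : ℝ≥0)))) *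
        ((4 * B + 3) * M : ℝ≥0) ≤ B₂) :
    cInf κ M B₂ ≤ M ^ 2 * (expTorusCost κ N B + 1) / (N : ℝ≥0∞) ^ 2 + cutError cs B M N +
      ENNReal.ofReal (decoupleError cs B₁ ((4 * B + 3) * M : ℝ≥0) ξ
        (Fintype.card (extSquare M).edgeSet) (Fintype.card (SqVertex M)) l n) := by
  classical
  by_cases hfin : expTorusCost κ N B = ∞
  · simp [hfin, ENNReal.mul_top, ENNReal.top_div, NeZero.ne M]
  have hM : (0 : ℝ≥0) < M := by exact_mod_cast NeZero.pos M
  have : (0 : ℝ≥0) < N := by exact_mod_cast NeZero.pos N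
  obtain ⟨y, hy, hglobal, hyB, hcost⟩ := exists_isGlobal_lintegral_nncost_le hfin
  let edgeLaw (e : (extSquare M).edgeSet) : Measure ℝ≥0 :=
    if IsRightTop e then Measure.dirac 0 else κ
  have (e : (extSquare M).edgeSet) : IsProbabilityMeasure (edgeLaw e) := by
    simp only [edgeLaw]
    split_ifs <;> infer_instance
  have hedgeLaw (e : (extSquare M).edgeSet) : ∀ᵐ t ∂edgeLaw e, t ≤ cs := by
    simp only [edgeLaw]
    split_ifs
    · simp
    · exact hκ
  have hmean : IsGlobal (SimpleFlow.mean (torusLaw κ N) y) := IsGlobal.mean hy hglobal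
  refine (iInf₂_le _ (hmean.isIsotropic_meanTransport hMN)).trans ?_
  refine (lintegral_minCost_expectation_le (placedLaw κ N) cs edgeLaw hedgeLaw
    (measurable_squareEnv_prod hMN) (map_placedLaw κ hMN)
    (measurable_placedFlow hMN hy) (by positivity) (lt_of_lt_of_le (by positivity) hB₁)
    (fun ω => (hglobal ω.1).sum_squareFlow_le hMN ω.2 (hyB ω.1))
    (fun ω e => ((hglobal ω.1).vol_squareFlow_le hMN ω.2 e).trans <|
      (add_le_add_left (hyB ω.1 _) _).trans hB₁) hξB hn hl
    (fun v w => (lintegral_trans_placedFlow hMN hy hglobal v w).symm) hB₂).trans ?_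
  gcongr
  refine (lintegral_nncost_placedFlow_le hMN hy hglobal hN hκ hyB).trans ?_
  gcongr

end Comparison

/-! ### The decoupling error as the side of the square grows -/

section Asymptotics

open Filter Topology

lemma tendsto_pow_mul_exp_neg_mul_natSqrt (k : ℕ) {a : ℝ} (ha : 0 < a) :
    Tendsto (fun M : ℕ => (M : ℝ) ^ k * Real.exp (-(a * Nat.sqrt M))) atTop (𝓝 0) := by
  have hsqrt : Tendsto (fun M : ℕ => √(M : ℝ)) atTop atTop :=
    Real.tendsto_sqrt_atTop.comp tendsto_natCast_atTop_atTop
  have hreal : Tendsto (fun M : ℕ => Real.exp a * (√(M : ℝ) ^ (2 * k : ℝ) *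
      Real.exp (-a * √(M : ℝ)))) atTop (𝓝 0) := by
    simpa only [mul_zero, Function.comp_def] using
      ((tendsto_rpow_mul_exp_neg_mul_atTop_nhds_zero (2 * k) a ha).comp hsqrt).const_mul
        (Real.exp a)
  refine squeeze_zero (fun _ => by positivity) (fun M => ?_) hreal
  have hpow : √(M : ℝ) ^ (2 * k : ℝ) = (M : ℝ) ^ k := by
    rw [show (2 * k : ℝ) = ((2 * k : ℕ) : ℝ) by push_cast; rfl, Real.rpow_natCast, pow_mul,
      Real.sq_sqrt M.cast_nonneg]
  rw [hpow, mul_left_comm, ← Real.exp_add]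
  gcongr
  linarith [mul_le_mul_of_nonneg_left (Real.real_sqrt_le_nat_sqrt_succ (a := M)) ha.le]

lemma tendsto_log_mul_natSqrt_div :
    Tendsto (fun M : ℕ => Real.log ((5 * (M : ℝ) ^ 2) ^ 2 + 1) * Nat.sqrt M / M) atTop (𝓝 0) := by
  have hsqrt : Tendsto (fun M : ℕ => √(M : ℝ)) atTop atTop :=
    Real.tendsto_sqrt_atTop.comp tendsto_natCast_atTop_atTop
  have hlog : Tendsto (fun M : ℕ => Real.log 26 * (√(M : ℝ))⁻¹ +
      8 * (Real.log √(M : ℝ) / √(M : ℝ))) atTop (𝓝 0) := by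
    simpa only [mul_zero, add_zero, Function.comp_def, id_eq] using
      ((tendsto_inv_atTop_zero.comp hsqrt).const_mul (Real.log 26)).add
        ((Real.isLittleO_log_id_atTop.tendsto_div_nhds_zero.comp hsqrt).const_mul 8)
  refine squeeze_zero' (Eventually.of_forall fun M => ?_) ?_ hlog
  · have : 0 ≤ Real.log ((5 * (M : ℝ) ^ 2) ^ 2 + 1) :=
      Real.log_nonneg (by nlinarith [sq_nonneg (5 * (M : ℝ) ^ 2)])
    positivity
  filter_upwards [eventually_ge_atTop 1] with M hM
  have hM : (1 : ℝ) ≤ M := by exact_mod_cast hM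
  have hlogle : Real.log ((5 * (M : ℝ) ^ 2) ^ 2 + 1) ≤ Real.log 26 + 8 * Real.log √(M : ℝ) := by
    calc Real.log ((5 * (M : ℝ) ^ 2) ^ 2 + 1) ≤ Real.log (26 * (M : ℝ) ^ 4) :=
          Real.log_le_log (by positivity) (by nlinarith [one_le_pow₀ hM (n := 4)])
      _ = Real.log 26 + 8 * Real.log √(M : ℝ) := by
          rw [Real.log_mul (by norm_num) (by positivity), Real.log_pow,
            Real.log_sqrt (by positivity)]
          push_cast
          ring
  have : 0 ≤ Real.log √(M : ℝ) := Real.log_nonneg (Real.one_le_sqrt.2 hM)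
  calc Real.log ((5 * (M : ℝ) ^ 2) ^ 2 + 1) * Nat.sqrt M / M
      ≤ (Real.log 26 + 8 * Real.log √(M : ℝ)) * √(M : ℝ) / M := by
        gcongr
        exact Real.nat_sqrt_le_real_sqrt
    _ = Real.log 26 * (√(M : ℝ))⁻¹ + 8 * (Real.log √(M : ℝ) / √(M : ℝ)) := by
        rw [mul_div_assoc, Real.sqrt_div_self', one_div]
        ring

lemma decoupleError_mono {cs B m ξ E E' v v' l : ℝ} (n : ℕ) (hcs : 0 ≤ cs) (hB : 0 ≤ B)
    (hξ : 0 ≤ ξ) (hl : 0 < l) (hE : 0 ≤ E) (hEE' : E ≤ E') (hv : 0 ≤ v) (hvv' : v ≤ v') :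
    decoupleError cs B m ξ E v l n ≤ decoupleError cs B m ξ E' v' l n := by
  have : 0 ≤ E' := hE.trans hEE'
  unfold decoupleError
  gcongr

lemma sampling_exponent_eq (B C ξ : ℝ) {M : ℕ} (hM : M ≠ 0) :
    ξ ^ 2 * ((M * Nat.sqrt M : ℕ) : ℝ) / (4 * B * (C * M)) =
      ξ ^ 2 / (4 * B * C) * Nat.sqrt M := by
  push_cast
  field_simp

/-- The number of sampled paths, `M * Nat.sqrt M`, is negligible against the area `M ^ 2` of the
square up to logarithms, but large against the mass `C * M` of the flow. -/
lemma tendsto_decoupleError_div_sq {cs B C ξ l : ℝ} (hB : 0 < B) (hC : 0 < C) (hξ : 0 < ξ)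
    (hl : 0 < l) :
    Tendsto (fun M : ℕ => decoupleError cs B (C * M) ξ (4 * M ^ 2) (5 * M ^ 2) l
      (M * Nat.sqrt M) / (M : ℝ) ^ 2) atTop
      (𝓝 (4 * cs * (2 * B * ξ + ξ ^ 2) + 2 * l * (cs * (B + ξ) ^ 2) ^ 2)) := by
  have hlog := tendsto_log_mul_natSqrt_div.div_const l
  have hconst : Tendsto (fun M : ℕ => 1 / l / (M : ℝ) ^ 2) atTop (𝓝 0) :=
    tendsto_const_nhds.div_atTop <|
      (tendsto_pow_atTop two_ne_zero).comp tendsto_natCast_atTop_atTop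
  have hexp := (tendsto_pow_mul_exp_neg_mul_natSqrt 4
    (a := ξ ^ 2 / (4 * B * C)) (by positivity)).const_mul (16 * cs * C ^ 2)
  have hsum := ((hlog.add hconst).add hexp).const_add
    (4 * cs * (2 * B * ξ + ξ ^ 2) + 2 * l * (cs * (B + ξ) ^ 2) ^ 2)
  simp only [zero_div, mul_zero, add_zero] at hsum
  refine hsum.congr' ?_
  filter_upwards [eventually_ne_atTop 0] with M hM
  rw [decoupleError, sampling_exponent_eq B C ξ hM, Real.log_pow]
  push_cast
  field_simp
  ring

lemma tendsto_sampleCapacity_error {B C ξ : ℝ} (hB : 0 < B) (hC : 0 < C) (hξ : 0 < ξ) :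
    Tendsto (fun M : ℕ => 4 * (M : ℝ) ^ 2 * Real.exp (-(ξ ^ 2 * (M * Nat.sqrt M : ℕ) /
      (4 * B * (C * M)))) * (C * M)) atTop (𝓝 0) := by
  have hexp := (tendsto_pow_mul_exp_neg_mul_natSqrt 3
    (a := ξ ^ 2 / (4 * B * C)) (by positivity)).const_mul (4 * C)
  rw [mul_zero] at hexp
  refine hexp.congr' ?_
  filter_upwards [eventually_ne_atTop 0] with M hM
  rw [sampling_exponent_eq B C ξ hM]
  ring

lemma exists_decoupleError_limit_lt (cs B : ℝ) {b ε : ℝ} (hb : 0 < b) (hε : 0 < ε) :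
    ∃ ξ ∈ Set.Ioc 0 b, ∃ l > 0,
      4 * cs * (2 * B * ξ + ξ ^ 2) + 2 * l * (cs * (B + ξ) ^ 2) ^ 2 < ε := by
  have hcont : Continuous fun x : ℝ =>
      4 * cs * (2 * B * x + x ^ 2) + 2 * x * (cs * (B + x) ^ 2) ^ 2 := by fun_prop
  have hsmall : ∀ᶠ x in 𝓝[>] (0 : ℝ),
      4 * cs * (2 * B * x + x ^ 2) + 2 * x * (cs * (B + x) ^ 2) ^ 2 < ε :=
    nhdsWithin_le_nhds (hcont.continuousAt.eventually_lt continuousAt_const (by simpa using hε))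
  obtain ⟨x, hx, hxb⟩ := (hsmall.and (Ioc_mem_nhdsGT hb)).exists
  exact ⟨x, hxb, x, hxb.1, hx⟩

end Asymptotics

/-! ### The limit -/

section Limit

open Filter Topology

variable {κ : Measure ℝ≥0} [IsProbabilityMeasure κ] {cs : ℝ≥0}

lemma tendsto_sq_div_natCast (M : ℕ) :
    Tendsto (fun N : ℕ => 4 * ((M : ℝ≥0) ^ 2 / N)) atTop (𝓝 0) := by
  simpa using (tendsto_const_div_atTop_nhds_zero_nat ((M : ℝ≥0) ^ 2)).const_mul 4

lemma tendsto_cutError (cs B : ℝ≥0) (M : ℕ) : Tendsto (cutError cs B M) atTop (𝓝 0) := by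
  have hfrac := tendsto_sq_div_natCast M
  have hsum := ((hfrac.const_mul (2 * B)).add (hfrac.pow 2)).const_mul
    (cs * Fintype.card (extSquare M).edgeSet)
  rwa [zero_pow two_ne_zero, add_zero, mul_zero, mul_zero] at hsum

lemma cInf_le_liminf_expTorusCost {M : ℕ} [NeZero M] (hκ : ∀ᵐ t ∂κ, t ≤ cs) {B B₁ ξ B₂ : ℝ≥0}
    (hB₁ : B < B₁) (hξB : ξ ≤ 2 * B₁) {n : ℕ} (hn : 0 < n) {l : ℝ} (hl : 0 < l)
    (hB₂ : (B₁ + ξ : ℝ) + Fintype.card (extSquare M).edgeSet *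
      Real.exp (-((ξ : ℝ) ^ 2 * n / (4 * B₁ * ((4 * B + 3) * M : ℝ≥0)))) *
        ((4 * B + 3) * M : ℝ≥0) ≤ B₂) :
    cInf κ M B₂ ≤ M ^ 2 * liminf (fun N : ℕ => expTorusCost κ N B / (N : ℝ≥0∞) ^ 2) atTop +
      ENNReal.ofReal (decoupleError cs B₁ ((4 * B + 3) * M : ℝ≥0) ξ
        (Fintype.card (extSquare M).edgeSet) (Fintype.card (SqVertex M)) l n) := by
  set D := ENNReal.ofReal (decoupleError cs B₁ ((4 * B + 3) * M : ℝ≥0) ξ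
    (Fintype.card (extSquare M).edgeSet) (Fintype.card (SqVertex M)) l n)
  have hM : (M : ℝ≥0∞) ^ 2 ≠ ∞ := by finiteness
  have herror : Tendsto (fun N : ℕ => (M : ℝ≥0∞) ^ 2 * (N : ℝ≥0∞)⁻¹ ^ 2 + cutError cs B M N)
      atTop (𝓝 0) := by
    have hinv := ENNReal.Tendsto.const_mul (ENNReal.Tendsto.pow (n := 2)
      ENNReal.tendsto_inv_nat_nhds_zero) (.inr hM)
    simpa using hinv.add (ENNReal.tendsto_coe.2 (tendsto_cutError cs B M))
  have hle : ∀ᶠ N : ℕ in atTop, cInf κ M B₂ ≤ M ^ 2 * (expTorusCost κ N B / (N : ℝ≥0∞) ^ 2) +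
      (M ^ 2 * (N : ℝ≥0∞)⁻¹ ^ 2 + cutError cs B M N) + D := by
    filter_upwards [eventually_ge_atTop (M + 3),
      (tendsto_sq_div_natCast M).eventually_le_const (tsub_pos_of_lt hB₁)] with N hN hfrac
    have : NeZero N := ⟨by omega⟩
    have hcap : B + 4 * ((M : ℝ≥0) ^ 2 / N) ≤ B₁ :=
      (add_le_add_right hfrac B).trans_eq (add_tsub_cancel_of_le hB₁.le)
    refine (cInf_le_expTorusCost_add (by omega) (by omega) hκ hcap hξB hn hl hB₂).trans_eq ?_
    simp only [div_eq_mul_inv, ENNReal.inv_pow]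
    ring
  calc cInf κ M B₂
      ≤ liminf (fun N : ℕ => M ^ 2 * (expTorusCost κ N B / (N : ℝ≥0∞) ^ 2) +
          (M ^ 2 * (N : ℝ≥0∞)⁻¹ ^ 2 + cutError cs B M N) + D) atTop :=
        le_liminf_of_le (by isBoundedDefault) hle
    _ = M ^ 2 * liminf (fun N : ℕ => expTorusCost κ N B / (N : ℝ≥0∞) ^ 2) atTop + D := by
        rw [liminf_add_const _ _ _ (by isBoundedDefault) (by isBoundedDefault),
          ← ENNReal.liminf_const_mul_of_ne_top hM]
        congr 1
        exact ENNReal.liminf_add_of_right_tendsto_zero herror _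

lemma card_edgeSet_le_real (M : ℕ) :
    (Fintype.card (extSquare M).edgeSet : ℝ) ≤ 4 * (M : ℝ) ^ 2 := by
  exact_mod_cast card_edgeSet_le M

lemma ofReal_decoupleError_extSquare_le {cs B ξ ε : ℝ≥0} {m l : ℝ} {n M : ℕ} (hM : 0 < M)
    (hl : 0 < l)
    (hε : decoupleError cs B m ξ (4 * M ^ 2) (5 * M ^ 2) l n / (M : ℝ) ^ 2 ≤ ε) :
    ENNReal.ofReal (decoupleError cs B m ξ (Fintype.card (extSquare M).edgeSet)
      (Fintype.card (SqVertex M)) l n) ≤ ε * (M : ℝ≥0∞) ^ 2 := by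
  have hvertices : (Fintype.card (SqVertex M) : ℝ) ≤ 5 * (M : ℝ) ^ 2 := by
    rw [card_sqVertex]
    exact_mod_cast (by nlinarith : M * M + 4 * M ≤ 5 * M ^ 2)
  have hmono := decoupleError_mono (m := m) n cs.coe_nonneg B.coe_nonneg ξ.coe_nonneg hl
    (by positivity) (card_edgeSet_le_real M) (by positivity) hvertices
  calc _ ≤ ENNReal.ofReal (ε * (M : ℝ) ^ 2) :=
        ENNReal.ofReal_le_ofReal (hmono.trans ((div_le_iff₀ (by positivity)).1 hε))
    _ = ε * (M : ℝ≥0∞) ^ 2 := by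
        rw [ENNReal.ofReal_mul ε.coe_nonneg, ENNReal.ofReal_coe_nnreal,
          ENNReal.ofReal_pow M.cast_nonneg, ENNReal.ofReal_natCast]

lemma eventually_cInf_div_sq_le (hκ : ∀ᵐ t ∂κ, t ≤ cs) {B B'' : ℝ≥0} (hB'' : B < B'')
    {ε : ℝ≥0} (hε : 0 < ε) :
    ∀ᶠ M : ℕ in atTop, cInf κ M B'' / (M : ℝ≥0∞) ^ 2 ≤
      liminf (fun N : ℕ => expTorusCost κ N B / (N : ℝ≥0∞) ^ 2) atTop + ε := by
  -- The spare capacity is split evenly between the cutting of the torus paths, the fluctuations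
  -- of the samples and the exceptional samples.
  obtain ⟨δ, hδ, rfl⟩ : ∃ δ : ℝ≥0, 0 < δ ∧ B'' = B + 3 * δ :=
    ⟨(B'' - B) / 3, by simpa using hB'', by
      rw [mul_div_cancel₀ _ three_ne_zero, add_tsub_cancel_of_le hB''.le]⟩
  have hB₁ : (0 : ℝ) < (B + δ : ℝ≥0) := by positivity
  have hC : (0 : ℝ) < (4 * B + 3 : ℝ≥0) := by positivity
  obtain ⟨ξ, ⟨hξ, hξδ⟩, l, hl, hlimit⟩ := exists_decoupleError_limit_lt cs (B + δ : ℝ≥0)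
    (NNReal.coe_pos.2 hδ) (NNReal.coe_pos.2 hε)
  lift ξ to ℝ≥0 using hξ.le
  filter_upwards [eventually_gt_atTop 0,
    (tendsto_decoupleError_div_sq hB₁ hC hξ hl).eventually_le_const hlimit,
    (tendsto_sampleCapacity_error hB₁ hC hξ).eventually_le_const (NNReal.coe_pos.2 hδ)]
    with M hM hdecouple hcapacity
  have : NeZero M := ⟨hM.ne'⟩
  have hmass : ((4 * B + 3) * M : ℝ≥0) = ((4 * B + 3 : ℝ≥0) * M : ℝ) := NNReal.coe_mul _ _
  have hle := cInf_le_liminf_expTorusCost (B₂ := B + 3 * δ) (n := M * Nat.sqrt M) hκ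
    (lt_add_of_pos_right B hδ)
    ((NNReal.coe_le_coe.1 hξδ).trans (le_add_self.trans (le_mul_of_one_le_left zero_le one_le_two)))
    (Nat.mul_pos hM (Nat.sqrt_pos.2 hM)) hl (by
      rw [hmass]
      grw [card_edgeSet_le_real, hcapacity, hξδ]
      push_cast
      linarith)
  refine ENNReal.div_le_of_le_mul (hle.trans ?_)
  rw [add_mul _ (ε : ℝ≥0∞), mul_comm (liminf _ _), hmass]
  gcongr
  exact ofReal_decoupleError_extSquare_le hM hl hdecouple

theorem limsup_cInf_le_liminf_expTorusCost (hκ : ∀ᵐ t ∂κ, t ≤ cs) {B B'' : ℝ≥0} (hB'' : B < B'') :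
    limsup (fun M : ℕ => cInf κ M B'' / (M : ℝ≥0∞) ^ 2) atTop ≤
      liminf (fun N : ℕ => expTorusCost κ N B / (N : ℝ≥0∞) ^ 2) atTop :=
  ENNReal.le_of_forall_pos_le_add fun _ hε _ =>
    limsup_le_of_le (by isBoundedDefault) (eventually_cInf_div_sq_le hκ hB'' hε)

end Limit

end LatticeFlow

end

theorem proposition22_general (κ : MeasureTheory.Measure ℝ≥0)
    [MeasureTheory.IsProbabilityMeasure κ] (cstar : ℝ≥0) (hκ : κ (Set.Icc 0 cstar) = 1)
    (B B'' : ℝ≥0) (hB'' : B < B'') :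
    Filter.limsup (fun M : ℕ => LatticeFlow.cInf κ M B'' / (M : ℝ≥0∞) ^ 2) Filter.atTop ≤
      Filter.liminf (fun N : ℕ => LatticeFlow.expTorusCost κ N B / (N : ℝ≥0∞) ^ 2)
        Filter.atTop := by
  have hbounded : ∀ᵐ t ∂κ, t ≤ cstar := by
    filter_upwards [(MeasureTheory.mem_ae_iff_prob_eq_one measurableSet_Icc).2 hκ] with t ht
    exact ht.2
  exact LatticeFlow.limsup_cInf_le_liminf_expTorusCost hbounded hB''

theorem proposition22 (κ : MeasureTheory.Measure ℝ≥0) [MeasureTheory.IsProbabilityMeasure κ]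
    (cstar : ℝ≥0) (hcstar : 0 < cstar) (hκ : κ (Set.Icc 0 cstar) = 1)
    (B : ℝ≥0) (hB : 1 / 4 < B) (B'' : ℝ≥0) (hB'' : B < B'') :
    Filter.limsup (fun M : ℕ => LatticeFlow.cInf κ M B'' / (M : ℝ≥0∞) ^ 2) Filter.atTop ≤
      Filter.liminf (fun N : ℕ => LatticeFlow.expTorusCost κ N B / (N : ℝ≥0∞) ^ 2)
        Filter.atTop :=
  proposition22_general κ cstar hκ B B'' hB''
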